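/- Let $k$ be a perfect field of characteristic $2$ and let $X$ be a smooth, projective, geometrically irreducible curve over $k$ with function field $K=k(X)$. Write $X^{(i)}$ for the $i$-th Frobenius twist of $X$, $\pi^{(i)}\colon X\to X^{(i)}$ for the relative Frobenius, and $B$ for the image of $\pi^{(1)}_*d\colon \pi^{(1)}_*\mathcal O_X\to\pi^{(1)}_*\omega_{X/k}$. Let $R_X$ be the set of finite separable morphisms $X\to\mathbb P^1_k$, identified with the $f\in K$ with $df\ne 0$. For $f,g\in R_X$ write $f=f_0^4+f_1^4g+f_2^4g^2+f_3^4g^3$ with $f_i\in K$ and put $$\mathrm{SY}(f,g)=\left(\frac{f_1f_3+f_2^2}{f_1^2+f_3^2g}\right)^2dg\in\Omega_{K/k}.$$ A morphism $f\in R_X$ is *tame* at a closed point $x$ if its ramification index at $x$ is odd. It is *pseudotame* at $x$ if, for a uniformizer $t$ of $\mathbb P^1_k$ at $f(x)$, there is $h\in K$ with $v_x(f^*t+h^4)$ odd. It is tame (resp. pseudotame) on an open set if it is so at every closed point of it; "tame" and "pseudotame" without further mention mean on all of $X$. Let $U_1,\dots,U_n$ be a covering of $X$ by affine open subsets and let $f_i\in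 R_X$ be pseudotame on $U_i$. The $k$-points of the SY torsor $\mathcal S_X$ are the $0$-cochains $a=(a_i)$, $a_i\in H^0(U_i^{(1)},B)$, whose differentials satisfy $\mathrm{SY}(f_i,f_j)=da_i+da_j$ for all $i,j$. For such an $a$, the SY conic bundle $Z_{X,a}\subset Y=\mathbb P(\pi^{(2)}_*\mathcal O_X/\mathcal O_{X^{(2)}})$ over $X^{(2)}$ (the fibre over $a$ of the total SY bundle $Z_X\to X^{(2)}\times_k\mathcal S_X$) is given as follows. Points of $Y$ are lines in the fibres of the bundle. Let $V\subseteq U_i$ be open and let $g\in\mathcal O(V)$ be such that $dg$ is a nowhere vanishing section of $B$ on $V$. A line spanned over $V$ by the class of $t_1^4g+t_2^4g^2+t_3^4g^3$ lies in $Z_{X,a}$ if and only if $$t_1t_3+t_2^2+b\,(t_1^2+g\,t_3^2)=0,\qquad\text{where } b\in\mathcal O(V),\ da_i+\mathrm{SY}(f_i,g)=b^2\,dg .$$ Call $f,f'\in R_X$ equivalent if $f'=c^4f+d^4$ with $c\in K^\times$, $d\in K$. Then there is a canonical bijection between the set of equivalence classes of pseudotame morphisms $f\in R_X$ and the set of pairs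 consisting of a $k$-point $a$ of $\mathcal S_X$ and a section over $X^{(2)}$ of the total SY bundle $Z_X$ above $a$ (i.e. of $Z_{X,a}$). It sends $f$ to the pair consisting of the cochain $a$ with $da_i=\mathrm{SY}(f,f_i)$ and the section given by the line subbundle of $\pi^{(2)}_*\mathcal O_X/\mathcal O_{X^{(2)}}$ generically spanned by the class of $f$; the stalk of this subbundle at $x$ consists of the classes of the $e\in\mathcal O_{X,x}$ of the form $c^4f+d^4$ with $c,d\in K$. Consequently $X$ admits a tame morphism $f\in R_X$ to $\mathbb P^1_k$ if and only if, for some $a\in\mathcal S_X(k)$, the conic bundle $Z_{X,a}$ is trivial, i.e. has a section over $X^{(2)}$. -/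

import Mathlib

open CategoryTheory AlgebraicGeometry
open scoped KaehlerDifferential

universe u

namespace SY

noncomputable section

/-! ### Algebra over a perfect field of characteristic two

Below `k` is (in all applications) a perfect field of characteristic `2`, `K` is the function field
of a curve over `k`, and a point of the curve is represented by its local ring `A ⊆ K`.
As `k` is perfect, `k ^ (1/4) * K = K`. -/

section Algebraic

variable (k : Type u) [Field k] {K : Type u} [Field K] [Algebra k K]

/-- `f` has nonzero derivative; such `f` are the finite separable morphisms to the projective line
(the set `R_X`). -/
def IsSeparableMorphism (f : K) : Prop := KaehlerDifferential.D k K f ≠ 0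

open Classical in
/-- The Sugiyama-Yasuda symbol `SY(f, g)`: write `f = f₀⁴ + f₁⁴ g + f₂⁴ g² + f₃⁴ g³` and take
`((f₁ f₃ + f₂²) / (f₁² + f₃² g))² dg`. (For `dg ≠ 0` the `fᵢ` exist and are unique.) -/
def symbol (f g : K) : Ω[K⁄k] :=
  if h : ∃ c : Fin 4 → K, f = c 0 ^ 4 + c 1 ^ 4 * g + c 2 ^ 4 * g ^ 2 + c 3 ^ 4 * g ^ 3 then
    ((h.choose 1 * h.choose 3 + h.choose 2 ^ 2) / (h.choose 1 ^ 2 + h.choose 3 ^ 2 * g)) ^ 2 •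
      KaehlerDifferential.D k K g
  else 0

variable {k}

/-- `z` has order `n` for the discrete valuation ring `A ⊆ K`: `z = u ϖⁿ` with `u` a unit of `A`
and `ϖ` a generator of the maximal ideal of `A`. -/
def HasOrder (A : Subalgebra k K) (z : K) (n : ℤ) : Prop :=
  ∃ ϖ u : A, ϖ ≠ 0 ∧ (∀ a : A, ¬ IsUnit a ↔ ϖ ∣ a) ∧ IsUnit u ∧ z = (u : K) * (ϖ : K) ^ n

/-- `τ = f^* t`, where `t` is a uniformizer of the projective line over `k` at the image under `f`
of the point with local ring `A`. At infinity, `t` is the inverse of the coordinate; at the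
closed point of the affine line given by an irreducible polynomial `P` (which is the image exactly
if `P(f)` vanishes at the given point), `t` is `P`. -/
def IsPulledBackUniformizer (A : Subalgebra k K) (f τ : K) : Prop :=
  (f ∉ A ∧ τ = f⁻¹) ∨
    ∃ hf : f ∈ A, ∃ P : Polynomial k, Irreducible P ∧
      ¬ IsUnit (Polynomial.aeval (⟨f, hf⟩ : A) P) ∧ τ = Polynomial.aeval f P

/-- The ramification index of `f` at the point with local ring `A` is `e`. -/
def HasRamificationIndex (A : Subalgebra k K) (f : K) (e : ℕ) : Prop :=
  ∃ τ : K, IsPulledBackUniformizer A f τ ∧ HasOrder A τ e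

/-- `f` is tame at the point with local ring `A` (in characteristic two). -/
def IsTameAt (A : Subalgebra k K) (f : K) : Prop :=
  ∃ e : ℕ, HasRamificationIndex A f e ∧ ¬ 2 ∣ e

/-- `f` is pseudotame at the point with local ring `A`. -/
def IsPseudotameAt (A : Subalgebra k K) (f : K) : Prop :=
  ∃ τ : K, IsPulledBackUniformizer A f τ ∧
    ∃ h : K, ∃ n : ℤ, Odd n ∧ HasOrder A (τ + h ^ 4) n

/-- Two functions differ by a transformation `f ↦ c⁴ f + d⁴` with `c ≠ 0`. -/
def FourthPowerAffine (f f' : K) : Prop := ∃ c d : K, c ≠ 0 ∧ f' = c ^ 4 * f + d ^ 4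

/-- The image of the class of `g ∈ A` in the stalk of `B = π⁽¹⁾_* 𝒪 / 𝒪^{(1)} ≅ d 𝒪` generates this
stalk over `𝒪^{(1)}` (the squares), i.e. the section of the line bundle `B` defined by `g` does not
vanish at the point with local ring `A`. -/
def GeneratesB (A : Subalgebra k K) (g : A) : Prop :=
  ∀ h : A, ∃ c : A, KaehlerDifferential.D k K (h : K) =
    (c : K) ^ 2 • KaehlerDifferential.D k K (g : K)

variable (k) in
/-- The image of `𝒪_{X⁽²⁾} → π⁽²⁾_* 𝒪_X` on local rings: the `k`-algebra generated by the fourth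
powers. As `X` and its twist `X⁽²⁾` have the same topological space, it is the local ring of
`X⁽²⁾` at the corresponding point. -/
abbrev frobRing (A : Type u) [CommRing A] [Algebra k A] : Subalgebra k A :=
  Algebra.adjoin k (Set.range fun c : A => c ^ 4)

variable (k) in
/-- The stalk of the rank three bundle `π⁽²⁾_* 𝒪_X / 𝒪_{X⁽²⁾}` on `X⁽²⁾`. -/
def FrobQuot (A : Type u) [CommRing A] [Algebra k A] : Type u :=
  A ⧸ LinearMap.range (Algebra.linearMap (frobRing k A) A)

instance (A : Type u) [CommRing A] [Algebra k A] : AddCommGroup (FrobQuot k A) :=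
  inferInstanceAs (AddCommGroup (A ⧸ LinearMap.range (Algebra.linearMap (frobRing k A) A)))

instance (A : Type u) [CommRing A] [Algebra k A] : Module (frobRing k A) (FrobQuot k A) :=
  inferInstanceAs (Module (frobRing k A) (A ⧸ LinearMap.range (Algebra.linearMap (frobRing k A) A)))

variable (k) in
/-- The class of `e` in `π⁽²⁾_* 𝒪_X / 𝒪_{X⁽²⁾}`. -/
def frobMk {A : Type u} [CommRing A] [Algebra k A] : A →ₗ[frobRing k A] FrobQuot k A :=
  (LinearMap.range (Algebra.linearMap (frobRing k A) A)).mkQ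

/-- The affine cone of the conic `C_{g, da}`, `a = b² g`: the classes of the elements
`t₁⁴ g + t₂⁴ g² + t₃⁴ g³` whose coordinates satisfy `t₁ t₃ + t₂² + b (t₁² + g t₃²) = 0`. -/
def conicCone (A : Subalgebra k K) (g b : A) : Set (FrobQuot k A) :=
  {ε | ∃ t₁ t₂ t₃ : A, ε = frobMk k (t₁ ^ 4 * g + t₂ ^ 4 * g ^ 2 + t₃ ^ 4 * g ^ 3) ∧
    t₁ * t₃ + t₂ ^ 2 + b * (t₁ ^ 2 + g * t₃ ^ 2) = 0}

end Algebraic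

/-! ### Curves -/

section Geometric

variable {k : Type u} [Field k] {X : Scheme.{u}} [IsIntegral X]

/-- The function field of an integral scheme over `k` (with its structure of `k`-algebra). -/
def FunctionField (_π : X ⟶ Spec (CommRingCat.of k)) : Type u := X.functionField

variable (π : X ⟶ Spec (CommRingCat.of k))

instance : Field (FunctionField π) := inferInstanceAs (Field X.functionField)

/-- The map from constants to global functions. -/
def constants : k →+* Γ(X, ⊤) :=
  (π.appTop.hom).comp (Scheme.ΓSpecIso (CommRingCat.of k)).inv.hom

instance [Nonempty X] : Nonempty (⊤ : X.Opens) := ⟨⟨Classical.arbitrary X, trivial⟩⟩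

instance : Algebra k (FunctionField π) :=
  RingHom.toAlgebra (S := X.functionField)
    ((X.germToFunctionField ⊤).hom.comp (constants π))

/-- The inclusion of the local ring at `x` in the function field. -/
def stalkMap (x : X) : X.presheaf.stalk x →+* FunctionField π :=
  algebraMap (X.presheaf.stalk x) X.functionField

/-- The local ring at `x` as a subring of the function field. -/
def localRing (x : X) : Subalgebra k (FunctionField π) where
  toSubsemiring := (stalkMap π x).rangeS
  algebraMap_mem' r := by
    refine ⟨X.presheaf.germ ⊤ x trivial (constants π r), ?_⟩
    exact Scheme.algebraMap_germ_eq_germToFunctionField (X := X) (U := ⊤) (x := x) trivial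
      (constants π r)

/-- The finite separable morphism `f` is pseudotame on the open subset `U`. -/
def IsPseudotameOn (U : X.Opens) (f : FunctionField π) : Prop :=
  IsSeparableMorphism k f ∧
    ∀ x : X, x ∈ U → IsClosed ({x} : Set X) → IsPseudotameAt (localRing π x) f

/-- The finite separable morphism `f` is tame. -/
def IsTame (f : FunctionField π) : Prop :=
  IsSeparableMorphism k f ∧
    ∀ x : X, IsClosed ({x} : Set X) → IsTameAt (localRing π x) f

/-- The set of pseudotame morphisms to the projective line. -/
def Pseudotame : Type u := {f : FunctionField π // IsPseudotameOn π ⊤ f}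

/-- Pseudotame morphisms up to the transformations `f ↦ c⁴ f + d⁴`, `c ≠ 0`. -/
instance Pseudotame.setoid [CharP k 2] : Setoid (Pseudotame π) where
  r f f' := FourthPowerAffine f.1 f'.1
  iseqv := by
    have : CharP (FunctionField π) 2 := charP_of_injective_algebraMap' k 2
    refine ⟨fun f => ⟨1, 0, one_ne_zero, by simp⟩, ?_, ?_⟩
    · rintro f f' ⟨c, d, hc, h⟩
      refine ⟨c⁻¹, c⁻¹ * d, inv_ne_zero hc, ?_⟩
      rw [h]
      have h2 : d ^ 4 + d ^ 4 = 0 := CharTwo.add_self_eq_zero _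
      field_simp
      linear_combination -h2
    · rintro f f' f'' ⟨c, d, hc, h⟩ ⟨c', d', hc', h'⟩
      refine ⟨c' * c, c' * d + d', mul_ne_zero hc' hc, ?_⟩
      have h2 : (c' * d + d') ^ 4 = (c' * d) ^ 4 + d' ^ 4 :=
        add_pow_char_pow (p := 2) (n := 2) ..
      rw [h', h, h2]
      ring

/-- `ω` is a section over `U⁽¹⁾` of `B`, the image of `d : π⁽¹⁾_* 𝒪_X → π⁽¹⁾_* ω_{X/k}`: locally
on `U` it is the differential of a regular function. -/
def IsSectionB (U : X.Opens) (ω : Ω[FunctionField π⁄k]) : Prop :=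
  ∀ x : X, x ∈ U → ∃ h : localRing π x, ω = KaehlerDifferential.D k (FunctionField π) h

/-- The SY torsor (the set of `k`-points of the affine space `S_X`) computed with a covering `U` and
morphisms `f i` that are pseudotame on `U i`: the `0`-cochains of `B` whose coboundary is the
cocycle `SY(f i, f j)`. A section `aᵢ` of `B` is given by its differential `daᵢ`. -/
structure Torsor {n : ℕ} (U : Fin n → X.Opens) (f : Fin n → FunctionField π) where
  /-- The components `daᵢ` of the cochain. -/
  cochain : Fin n → Ω[FunctionField π⁄k]
  isSectionB : ∀ i, IsSectionB π (U i) (cochain i)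
  coboundary : ∀ i j, symbol k (f i) (f j) = cochain i + cochain j

/-- A line subbundle of `π⁽²⁾_* 𝒪_X / 𝒪_{X⁽²⁾}`, i.e. a section over `X⁽²⁾` of the bundle
`Y = ℙ(π⁽²⁾_* 𝒪_X / 𝒪_{X⁽²⁾})` of projective planes (of lines in the fibres). The subsheaf is given
by its stalks; locally it is free of rank one on a section `e`, and it is a direct summand. -/
structure LineSubbundle where
  /-- The stalks. -/
  stalk : ∀ x : X, Submodule (frobRing k (localRing π x)) (FrobQuot k (localRing π x))
  locally_generated : ∀ x : X, ∃ V : X.Opens, x ∈ V ∧ ∃ e : FunctionField π, ∀ y : X, y ∈ V →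
    ∃ he : e ∈ localRing π y,
      stalk y = Submodule.span _ {frobMk k (⟨e, he⟩ : localRing π y)} ∧
      frobMk k (⟨e, he⟩ : localRing π y) ≠ 0 ∧
      IsComplemented (stalk y)

variable {π} {n : ℕ} {U : Fin n → X.Opens} {f : Fin n → FunctionField π}

/-- The SY conic bundle of an element `a` of the SY torsor, i.e. the fibre of `Z_X` over `a`, through
its affine cone at `x`. If `x` lies in `U i`, and `g` is any local coordinate at `x`, the bundle is
`C_{f i, daᵢ} = C_{g, daᵢ + SY(f i, g)}`, which is given near `x` by the equation of `conicCone` with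
`daᵢ + SY(f i, g) = b² dg`. -/
def Torsor.bundleCone (a : Torsor π U f) (x : X) : Set (FrobQuot k (localRing π x)) :=
  {ε | ∀ i, x ∈ U i → ∀ g b : localRing π x, GeneratesB (localRing π x) g →
    a.cochain i + symbol k (f i) (g : FunctionField π) =
      (b : FunctionField π) ^ 2 • KaehlerDifferential.D k (FunctionField π) g →
    ε ∈ conicCone (localRing π x) g b}

/-- A section over `X⁽²⁾` of the SY conic bundle of `a`: a section of `Y` that lies in it. -/
structure Torsor.BundleSection (a : Torsor π U f) extends LineSubbundle π where
  mem_bundle : ∀ x : X, ∀ ε ∈ stalk x, ε ∈ a.bundleCone x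

/-- The SY conic bundle of `a` is trivial: it has a section over `X⁽²⁾`. -/
def Torsor.IsTrivialBundle (a : Torsor π U f) : Prop := Nonempty a.BundleSection

end Geometric

end

end SY

/-! If dg ≠ 0, then 1, g form a basis of K over K², hence 1, g, g², g³ form one over K⁴, and the
symbol is well defined. It is additive, SY(f,g) + SY(g,h) = SY(f,h) (`IsCurveField.symbol_add`), and
unchanged under f ↦ c⁴f + d⁴ (`symbol_affine`). The local link with ramification is
`isPseudotameAt_iff`: f is pseudotame at a closed point exactly if SY(f,g) is the differential of a
regular function, g being a local generator of B. Behind it is a comparison of orders: the terms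
zᵢ⁴tⁱ have orders distinct mod 4, and (z₁z₃ + z₂²)/(z₁² + z₃²t) is integral exactly if the least
order among i = 1, 2, 3 is odd.

A pseudotame h therefore gives sections SY(h,fᵢ) of B, and additivity makes them a point of the
torsor. The equation of the conic is SY(h,g) = b²dg with denominators cleared, so the line of h lies
in the bundle (`mem_conicCone_of_mem_lineStalk`). Conversely, a generator e of a section at the
generic point satisfies SY(e,fⱼ) = daⱼ there (`symbol_eq_of_mem_conicCone`); additivity spreads this
to all i, so every SY(e,g) is regular and e is pseudotame. A line subbundle is a direct summand,
hence determined by its generic fibre (`span_eq_lineStalk`).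

A tame morphism is pseudotame. For the converse, let f be pseudotame, and let u be a function
outside whose poles f is étale. Put F = f + u^(4m) and consider F³ + s⁴. Where u is regular, this is
tame with index 1 or 3 for any regular s (`isTameAt_cube_add`). At a pole of u, SY(F³,F) = 0 shows
that F³ plus its fourth power part F₀⁴ has odd order 2 ord F + c, with c independent of m
(`exists_ord_cube_add`). Taking s = F₀ + r, regular where u is and with poles of r bounded
independently of m (`exists_integral_add_bounded`), the error r⁴ is negligible for large m, and F³ +
s⁴ has a pole of odd order.

Smoothness enters through differentials being locally free of rank one: this gives the basis 1, g of
K over K² (`isCurveField_of_kaehler`) and makes the local rings at closed points discrete valuation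
rings (`isPrincipalIdealRing_of_kaehler`). -/

namespace SY

/-! ### Coordinates over fourth powers and the cocycle rule for the symbol. -/

section CharTwoField

variable (k : Type u) [Field k] (K : Type u) [Field K] [Algebra k K]

/-- The properties of a function field of one variable over a perfect field of characteristic two
on which the theory of the symbol rests. -/
structure IsCurveField : Prop where
  sqrt : ∀ c : k, ∃ d : k, d ^ 2 = c
  exists_separable : ∃ g : K, IsSeparableMorphism k g
  decomp : ∀ g : K, IsSeparableMorphism k g → ∀ f : K, ∃ a b : K, f = a ^ 2 + b ^ 2 * g
  isAlgebraic : ∀ g : K, IsSeparableMorphism k g → Algebra.IsAlgebraic (Algebra.adjoin k {g}) K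
  finite : ∀ g : K, IsSeparableMorphism k g →
    FiniteDimensional (IntermediateField.adjoin k {g}) K

variable {k K}
variable [CharP K 2]

local notation "d" => KaehlerDifferential.D k K

lemma two_eq_zero' : (2 : K) = 0 := CharTwo.two_eq_zero

lemma D_add_sq (a b : K) : d (a + b ^ 2) = d a := by
  have h : d (b ^ 2) = 0 := by
    rw [pow_two, Derivation.leibniz, ← add_smul, CharTwo.add_self_eq_zero, zero_smul]
  rw [map_add, h, add_zero]

lemma D_sq_mul (a b : K) : d (b ^ 2 * a) = b ^ 2 • d a := by
  have h : d (b ^ 2) = 0 := by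
    rw [pow_two, Derivation.leibniz, ← add_smul, CharTwo.add_self_eq_zero, zero_smul]
  rw [Derivation.leibniz, h, smul_zero, add_zero]

lemma D_sq (a : K) : d (a ^ 2) = 0 := by simpa using D_add_sq (k := k) 0 a

lemma D_sq_add_sq_mul (a b g : K) : d (a ^ 2 + b ^ 2 * g) = b ^ 2 • d g := by
  rw [add_comm, D_add_sq, D_sq_mul]

lemma D_coords (f₀ f₁ f₂ f₃ g : K) :
    d (f₀ ^ 4 + f₁ ^ 4 * g + f₂ ^ 4 * g ^ 2 + f₃ ^ 4 * g ^ 3) =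
      (f₁ ^ 2 + f₃ ^ 2 * g) ^ 2 • d g := by
  rw [← D_sq_add_sq_mul (f₀ ^ 2 + f₂ ^ 2 * g)]
  congr 1
  linear_combination -(f₀ ^ 2 * f₂ ^ 2 * g + g * f₁ ^ 2 * f₃ ^ 2 * g) * two_eq_zero' (K := K)

/-- Differentiation kills the squares and isolates the coefficient of `g`; squaring is injective in
characteristic two. -/
lemma sq_add_sq_mul_injective {g : K} (hg : IsSeparableMorphism k g) {a b a' b' : K}
    (h : a ^ 2 + b ^ 2 * g = a' ^ 2 + b' ^ 2 * g) : a = a' ∧ b = b' := by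
  have h1 : b ^ 2 • d g = b' ^ 2 • d g := by
    rw [← D_sq_add_sq_mul a, h, D_sq_add_sq_mul]
  have hb : b = b' := CharTwo.sq_injective (smul_left_injective K hg h1)
  subst hb
  exact ⟨CharTwo.sq_injective (add_right_cancel h), rfl⟩

lemma coords_injective {g : K} (hg : IsSeparableMorphism k g) {a₀ a₁ a₂ a₃ b₀ b₁ b₂ b₃ : K}
    (h : a₀ ^ 4 + a₁ ^ 4 * g + a₂ ^ 4 * g ^ 2 + a₃ ^ 4 * g ^ 3 =
      b₀ ^ 4 + b₁ ^ 4 * g + b₂ ^ 4 * g ^ 2 + b₃ ^ 4 * g ^ 3) :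
    a₀ = b₀ ∧ a₁ = b₁ ∧ a₂ = b₂ ∧ a₃ = b₃ := by
  have key : ∀ a₀ a₁ a₂ a₃ : K, a₀ ^ 4 + a₁ ^ 4 * g + a₂ ^ 4 * g ^ 2 + a₃ ^ 4 * g ^ 3 =
      (a₀ ^ 2 + a₂ ^ 2 * g) ^ 2 + (a₁ ^ 2 + a₃ ^ 2 * g) ^ 2 * g := fun a₀ a₁ a₂ a₃ => by
    linear_combination -(a₀ ^ 2 * a₂ ^ 2 * g + g * a₁ ^ 2 * a₃ ^ 2 * g) * two_eq_zero' (K := K)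
  rw [key, key] at h
  obtain ⟨h1, h2⟩ := sq_add_sq_mul_injective hg h
  obtain ⟨h3, h4⟩ := sq_add_sq_mul_injective hg h1
  obtain ⟨h5, h6⟩ := sq_add_sq_mul_injective hg h2
  exact ⟨h3, h5, h4, h6⟩

/-- The square decomposition is applied to `f` and then to both of its coefficients. The set `A`
will be K or a local ring, so that integrality of the coordinates comes with their existence. -/
lemma exists_coords_of_mem {A : Set K} {g : K}
    (hA : ∀ f ∈ A, ∃ a ∈ A, ∃ b ∈ A, f = a ^ 2 + b ^ 2 * g) {f : K} (hf : f ∈ A) :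
    ∃ f₀ ∈ A, ∃ f₁ ∈ A, ∃ f₂ ∈ A, ∃ f₃ ∈ A,
      f = f₀ ^ 4 + f₁ ^ 4 * g + f₂ ^ 4 * g ^ 2 + f₃ ^ 4 * g ^ 3 := by
  obtain ⟨a, ha, b, hb, rfl⟩ := hA f hf
  obtain ⟨f₀, h0, f₂, h2, rfl⟩ := hA a ha
  obtain ⟨f₁, h1, f₃, h3, rfl⟩ := hA b hb
  refine ⟨f₀, h0, f₁, h1, f₂, h2, f₃, h3, ?_⟩
  linear_combination (f₀ ^ 2 * f₂ ^ 2 * g + g * f₁ ^ 2 * f₃ ^ 2 * g) * two_eq_zero' (K := K)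

lemma IsCurveField.exists_coords (hK : IsCurveField k K) {g : K} (hg : IsSeparableMorphism k g)
    (f : K) : ∃ f₀ f₁ f₂ f₃ : K, f = f₀ ^ 4 + f₁ ^ 4 * g + f₂ ^ 4 * g ^ 2 + f₃ ^ 4 * g ^ 3 := by
  obtain ⟨f₀, -, f₁, -, f₂, -, f₃, -, h⟩ := exists_coords_of_mem (A := Set.univ) (g := g)
    (fun f _ => by simpa using hK.decomp g hg f) (Set.mem_univ f)
  exact ⟨f₀, f₁, f₂, f₃, h⟩

lemma symbol_eq {f g : K} (hg : IsSeparableMorphism k g) {f₀ f₁ f₂ f₃ : K}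
    (hf : f = f₀ ^ 4 + f₁ ^ 4 * g + f₂ ^ 4 * g ^ 2 + f₃ ^ 4 * g ^ 3) :
    symbol k f g = ((f₁ * f₃ + f₂ ^ 2) / (f₁ ^ 2 + f₃ ^ 2 * g)) ^ 2 • d g := by
  have h : ∃ c : Fin 4 → K, f = c 0 ^ 4 + c 1 ^ 4 * g + c 2 ^ 4 * g ^ 2 + c 3 ^ 4 * g ^ 3 :=
    ⟨![f₀, f₁, f₂, f₃], by simpa using hf⟩
  rw [symbol, dif_pos h]
  obtain ⟨-, h1, h2, h3⟩ := coords_injective hg (h.choose_spec.symm.trans hf)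
  rw [h1, h2, h3]

lemma isSeparable_iff_coords {f g : K} (hg : IsSeparableMorphism k g) {f₀ f₁ f₂ f₃ : K}
    (hf : f = f₀ ^ 4 + f₁ ^ 4 * g + f₂ ^ 4 * g ^ 2 + f₃ ^ 4 * g ^ 3) :
    IsSeparableMorphism k f ↔ f₁ ^ 2 + f₃ ^ 2 * g ≠ 0 := by
  rw [IsSeparableMorphism, hf, D_coords, smul_ne_zero_iff, pow_ne_zero_iff two_ne_zero]
  exact and_iff_left hg

lemma sq_add_sq_mul_ne_zero {g : K} (hg : IsSeparableMorphism k g) {a b : K} :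
    a ^ 2 + b ^ 2 * g = 0 ↔ a = 0 ∧ b = 0 := by
  constructor
  · intro h
    exact sq_add_sq_mul_injective hg (a' := 0) (b' := 0) (by simpa using h)
  · rintro ⟨rfl, rfl⟩; simp

/-- The symbol is a cocycle. -/
theorem IsCurveField.symbol_add (hK : IsCurveField k K) {f g h : K}
    (hf : IsSeparableMorphism k f) (hg : IsSeparableMorphism k g)
    (hh : IsSeparableMorphism k h) : symbol k f g + symbol k g h = symbol k f h := by
  obtain ⟨f₀, f₁, f₂, f₃, ef⟩ := hK.exists_coords hg f
  obtain ⟨g₀, g₁, g₂, g₃, eg⟩ := hK.exists_coords hh g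
  have h2 := two_eq_zero' (K := K)
  -- Writing g = c₀² + c₂²h makes g² = c₀⁴ + c₂⁴h², so the coordinates eᵢ of g³ = g · g² come from a
  -- single multiplication, with h⁴ absorbed into fourth powers.
  set c₀ := g₀ ^ 2 + g₂ ^ 2 * h with hc0
  set c₂ := g₁ ^ 2 + g₃ ^ 2 * h with hc2
  have eg1 : g = c₀ ^ 2 + c₂ ^ 2 * h := by
    rw [eg]
    linear_combination -(g₀ ^ 2 * g₂ ^ 2 * h + h * g₁ ^ 2 * g₃ ^ 2 * h) * h2
  have eg2 : g ^ 2 = c₀ ^ 4 + c₂ ^ 4 * h ^ 2 := by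
    rw [eg1]; linear_combination (c₀ ^ 2 * c₂ ^ 2 * h) * h2
  set e₁ := g₁ * c₀ + g₃ * c₂ * h
  set e₂ := g₂ * c₀ + g₀ * c₂
  set e₃ := g₃ * c₀ + g₁ * c₂
  set e₀ := g₀ * c₀ + g₂ * c₂ * h
  have fourth : ∀ a b : K, (a + b) ^ 4 = a ^ 4 + b ^ 4 := fun a b => by
    linear_combination (2 * a ^ 3 * b + 3 * a ^ 2 * b ^ 2 + 2 * a * b ^ 3) * h2
  have eg3 : g ^ 3 = e₀ ^ 4 + e₁ ^ 4 * h + e₂ ^ 4 * h ^ 2 + e₃ ^ 4 * h ^ 3 := by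
    calc g ^ 3 = (g₀ ^ 4 + g₁ ^ 4 * h + g₂ ^ 4 * h ^ 2 + g₃ ^ 4 * h ^ 3) *
          (c₀ ^ 4 + c₂ ^ 4 * h ^ 2) := by rw [← eg2, ← eg]; ring
      _ = _ := by
        simp only [e₀, e₁, e₂, e₃, fourth]
        ring
  have ef' : f = (f₀ + f₁ * g₀ + f₂ * c₀ + f₃ * e₀) ^ 4 + (f₁ * g₁ + f₃ * e₁) ^ 4 * h +
      (f₁ * g₂ + f₂ * c₂ + f₃ * e₂) ^ 4 * h ^ 2 + (f₁ * g₃ + f₃ * e₃) ^ 4 * h ^ 3 := by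
    rw [ef, eg3, eg2]
    simp only [fourth]
    rw [eg]
    ring
  have hgd : c₂ ≠ 0 := (isSeparable_iff_coords hh eg).1 hg
  have hfd := (isSeparable_iff_coords hg ef).1 hf
  -- The square root of the chain rule: the squares of both sides are the ratio of df to dh.
  have hden : (f₁ * g₁ + f₃ * e₁) ^ 2 + (f₁ * g₃ + f₃ * e₃) ^ 2 * h =
      (f₁ ^ 2 + f₃ ^ 2 * g) * c₂ := by
    rw [eg1]
    simp only [e₁, e₃]
    rw [hc2]
    clear_value c₀
    linear_combination (f₁ * g₁ * f₃ * (g₁ * c₀ + g₃ * (g₁ ^ 2 + g₃ ^ 2 * h) * h) +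
      f₁ * g₃ * f₃ * (g₃ * c₀ + g₁ * (g₁ ^ 2 + g₃ ^ 2 * h)) * h +
      2 * f₃ ^ 2 * g₁ * c₀ * g₃ * (g₁ ^ 2 + g₃ ^ 2 * h) * h) * h2
  -- Divided by the denominator, the first summand becomes the root of SY(f,g), because dg = c₂²dh,
  -- and the second the root of SY(g,h).
  have hnum : (f₁ * g₁ + f₃ * e₁) * (f₁ * g₃ + f₃ * e₃) + (f₁ * g₂ + f₂ * c₂ + f₃ * e₂) ^ 2 =
      (f₁ * f₃ + f₂ ^ 2) * c₂ ^ 2 + (g₁ * g₃ + g₂ ^ 2) * (f₁ ^ 2 + f₃ ^ 2 * g) := by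
    rw [eg1]
    simp only [e₁, e₂, e₃]
    linear_combination (f₁ * f₃ * g₁ * g₃ * c₀ + f₁ * g₂ * f₂ * c₂ +
      (f₁ * g₂ + f₂ * c₂) * f₃ * (g₂ * c₀ + g₀ * c₂) +
      f₃ ^ 2 * (g₂ * g₀ * c₀ * c₂ + g₀ ^ 2 * c₂ ^ 2)) * h2 -
      (f₁ * f₃ * c₂ + f₃ ^ 2 * c₀ * c₂) * hc2 + f₃ ^ 2 * c₂ ^ 2 * hc0
  have hDg : d g = c₂ ^ 2 • d h := by rw [eg, D_coords]
  rw [symbol_eq hg ef, symbol_eq hh eg, symbol_eq hh ef', hDg, smul_smul, ← add_smul, hnum, hden,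
    ← mul_pow, ← CharTwo.add_sq]
  congr 2
  rw [← hc2]
  field_simp

lemma symbol_self {f : K} (hf : IsSeparableMorphism k f) : symbol k f f = 0 := by
  rw [symbol_eq (f₀ := 0) (f₁ := 1) (f₂ := 0) (f₃ := 0) hf (by ring)]
  simp

lemma add_self_eq_zero' {M : Type*} [AddCommGroup M] [Module K M] (x : M) : x + x = 0 := by
  rw [← two_smul K, two_eq_zero', zero_smul]

/-- The cocycle rule for f, g, f has right side 0, and signs do not matter. -/
theorem IsCurveField.symbol_comm (hK : IsCurveField k K) {f g : K}
    (hf : IsSeparableMorphism k f) (hg : IsSeparableMorphism k g) :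
    symbol k f g = symbol k g f := by
  have h := hK.symbol_add hf hg hf
  rw [symbol_self hf] at h
  calc symbol k f g = symbol k f g + (symbol k g f + symbol k g f) := by
        rw [add_self_eq_zero' (K := K), add_zero]
    _ = symbol k g f := by rw [← add_assoc, h, zero_add]

lemma add_pow_four (a b : K) : (a + b) ^ 4 = a ^ 4 + b ^ 4 := by
  linear_combination (2 * a ^ 3 * b + 3 * a ^ 2 * b ^ 2 + 2 * a * b ^ 3) * two_eq_zero' (K := K)

lemma D_affine (c e f : K) : d (c ^ 4 * f + e ^ 4) = c ^ 4 • d f := by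
  rw [show e ^ 4 = (e ^ 2) ^ 2 by ring, show c ^ 4 = (c ^ 2) ^ 2 by ring, D_add_sq, D_sq_mul]

lemma FourthPowerAffine.isSeparable {f f' : K} (h : FourthPowerAffine f f')
    (hf : IsSeparableMorphism k f) : IsSeparableMorphism k f' := by
  obtain ⟨c, e, hc, rfl⟩ := h
  rw [IsSeparableMorphism, D_affine]
  exact smul_ne_zero (pow_ne_zero _ hc) hf

lemma symbol_affine (hK : IsCurveField k K) {f f' g : K} (h : FourthPowerAffine f f')
    (hg : IsSeparableMorphism k g) : symbol k f' g = symbol k f g := by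
  obtain ⟨c, e, hc, rfl⟩ := h
  obtain ⟨f₀, f₁, f₂, f₃, ef⟩ := hK.exists_coords hg f
  have ef' : c ^ 4 * f + e ^ 4 = (c * f₀ + e) ^ 4 + (c * f₁) ^ 4 * g + (c * f₂) ^ 4 * g ^ 2 +
      (c * f₃) ^ 4 * g ^ 3 := by
    rw [ef, add_pow_four]; ring
  rw [symbol_eq hg ef, symbol_eq hg ef']
  congr 2
  rw [show c * f₁ * (c * f₃) + (c * f₂) ^ 2 = c ^ 2 * (f₁ * f₃ + f₂ ^ 2) by ring,
    show (c * f₁) ^ 2 + (c * f₃) ^ 2 * g = c ^ 2 * (f₁ ^ 2 + f₃ ^ 2 * g) by ring,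
    mul_div_mul_left _ _ (pow_ne_zero 2 hc)]

lemma IsCurveField.exists_D_eq_smul (hK : IsCurveField k K) {g : K}
    (hg : IsSeparableMorphism k g) (f : K) : ∃ b : K, d f = b ^ 2 • d g := by
  obtain ⟨a, b, rfl⟩ := hK.decomp g hg f
  exact ⟨b, D_sq_add_sq_mul a b g⟩

lemma IsCurveField.isSquare_of_D_eq_zero (hK : IsCurveField k K) {f : K} (h : d f = 0) :
    ∃ a : K, f = a ^ 2 := by
  obtain ⟨g, hg⟩ := hK.exists_separable
  obtain ⟨a, b, rfl⟩ := hK.decomp g hg f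
  rw [D_sq_add_sq_mul, smul_eq_zero, or_iff_left hg] at h
  exact ⟨a, by rw [h]; ring⟩

lemma sq_smul_D_injective {g : K} (hg : IsSeparableMorphism k g) {a b : K}
    (h : a ^ 2 • d g = b ^ 2 • d g) : a = b :=
  CharTwo.sq_injective (smul_left_injective K hg h)

end CharTwoField

/-! ### The order function of a discrete valuation ring inside K. -/

section Valuation

variable {k : Type u} [Field k] {K : Type u} [Field K] [Algebra k K]

/-- `A` is a discrete valuation ring with quotient field `K` and uniformizer `t`. -/
structure IsUniformizer (A : Subalgebra k K) (t : K) : Prop where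
  mem : t ∈ A
  inv_notMem : t⁻¹ ∉ A
  exists_eq : ∀ z : K, z ≠ 0 → ∃ (n : ℤ) (u : K), u ∈ A ∧ u⁻¹ ∈ A ∧ u ≠ 0 ∧ z = u * t ^ n

open Classical in
/-- The normalized discrete valuation of a nonzero element, and `0` at `0`. -/
noncomputable def ord (A : Subalgebra k K) (z : K) : ℤ :=
  if h : ∃ n, HasOrder A z n then h.choose else 0

namespace IsUniformizer

variable {A : Subalgebra k K} {t : K} (ht : IsUniformizer A t)
include ht

lemma ne_zero : t ≠ 0 := by
  rintro rfl
  exact ht.inv_notMem (by simp)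

lemma zpow_mem_iff (n : ℤ) : t ^ n ∈ A ↔ 0 ≤ n := by
  constructor
  · intro h
    by_contra hn
    obtain ⟨m, hm⟩ : ∃ m : ℕ, n = -1 - m := ⟨(-1 - n).toNat, by omega⟩
    apply ht.inv_notMem
    have : t⁻¹ = t ^ n * t ^ m := by
      rw [hm, ← zpow_natCast, ← zpow_add₀ ht.ne_zero]; simp
    rw [this]
    exact A.mul_mem h (A.pow_mem ht.mem m)
  · intro h
    lift n to ℕ using h
    rw [zpow_natCast]
    exact A.pow_mem ht.mem n

lemma unit_zpow_mem_iff {u : K} (hu : u ∈ A) (hu' : u⁻¹ ∈ A) (h0 : u ≠ 0) (n : ℤ) :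
    u * t ^ n ∈ A ↔ 0 ≤ n := by
  rw [← ht.zpow_mem_iff]
  refine ⟨fun h => ?_, fun h => A.mul_mem hu h⟩
  simpa [h0] using A.mul_mem hu' h

omit ht in
lemma isUnit_iff (a : A) : IsUnit a ↔ (a : K) ≠ 0 ∧ (a : K)⁻¹ ∈ A := by
  constructor
  · rintro ⟨u, rfl⟩
    have h : ((u : A) : K) * ((u⁻¹ : Aˣ) : A) = 1 := by
      rw [← MulMemClass.coe_mul, Units.mul_inv]; rfl
    refine ⟨left_ne_zero_of_mul_eq_one h, ?_⟩
    rw [inv_eq_of_mul_eq_one_right h]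
    exact ((u⁻¹ : Aˣ) : A).2
  · rintro ⟨h0, h⟩
    exact IsUnit.of_mul_eq_one ⟨_, h⟩ (Subtype.ext (mul_inv_cancel₀ h0))

lemma not_isUnit_iff_dvd (a : A) : ¬ IsUnit a ↔ (⟨t, ht.mem⟩ : A) ∣ a := by
  have key : (⟨t, ht.mem⟩ : A) ∣ a ↔ (a : K) * t⁻¹ ∈ A := by
    constructor
    · rintro ⟨b, rfl⟩
      have : ((⟨t, ht.mem⟩ * b : A) : K) * t⁻¹ = b := by
        simp [mul_comm t, ht.ne_zero]
      rw [this]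
      exact b.2
    · intro h
      exact ⟨⟨_, h⟩, Subtype.ext (by simp [mul_comm t, ht.ne_zero])⟩
  rw [key, isUnit_iff]
  by_cases h0 : (a : K) = 0
  · simp [h0]
  obtain ⟨n, u, hu, hu', hu0, e⟩ := ht.exists_eq a h0
  have hn : 0 ≤ n := (ht.unit_zpow_mem_iff hu hu' hu0 n).1 (e ▸ a.2)
  rw [and_iff_right h0, e, mul_assoc, ← zpow_sub_one₀ ht.ne_zero, mul_inv, ← zpow_neg,
    ht.unit_zpow_mem_iff hu hu' hu0, ht.unit_zpow_mem_iff hu' (by simpa) (inv_ne_zero hu0)]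
  omega

lemma hasOrder_iff {z : K} {n : ℤ} :
    HasOrder A z n ↔ ∃ u ∈ A, u⁻¹ ∈ A ∧ u ≠ 0 ∧ z = u * t ^ n := by
  constructor
  · rintro ⟨ϖ, u, h0, hϖ, hu, rfl⟩
    obtain ⟨hu0, hu'⟩ := (isUnit_iff u).1 hu
    have h1 : (⟨t, ht.mem⟩ : A) ∣ ϖ := (ht.not_isUnit_iff_dvd ϖ).1 ((hϖ ϖ).2 dvd_rfl)
    have h2 : ϖ ∣ (⟨t, ht.mem⟩ : A) := (hϖ _).1 ((ht.not_isUnit_iff_dvd _).2 dvd_rfl)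
    -- Any two generators of the maximal ideal differ by a unit, whose powers are absorbed into the
    -- unit factor.
    obtain ⟨v, hv⟩ := associated_of_dvd_dvd h1 h2
    obtain ⟨hv0, hv'⟩ := (isUnit_iff (v : A)).1 v.isUnit
    have e : (ϖ : K) = t * (v : A) := by rw [← hv]; rfl
    have hvn : ∀ m : ℤ, ((v : A) : K) ^ m ∈ A := by
      intro m
      obtain ⟨m, rfl | rfl⟩ := m.eq_nat_or_neg
      · simp [A.pow_mem (v : A).2 m]
      · simpa using A.pow_mem hv' m
    refine ⟨u * ((v : A) : K) ^ n, A.mul_mem u.2 (hvn n), ?_, mul_ne_zero hu0 (zpow_ne_zero _ hv0),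
      ?_⟩
    · rw [mul_inv, ← zpow_neg]; exact A.mul_mem hu' (hvn _)
    · rw [e, mul_zpow]; ring
  · rintro ⟨u, hu, hu', hu0, rfl⟩
    exact ⟨⟨t, ht.mem⟩, ⟨u, hu⟩, fun h => ht.ne_zero (congrArg Subtype.val h),
      ht.not_isUnit_iff_dvd, (isUnit_iff _).2 ⟨hu0, hu'⟩, rfl⟩

lemma hasOrder_unique {z : K} {n m : ℤ} (hn : HasOrder A z n) (hm : HasOrder A z m) : n = m := by
  obtain ⟨u, hu, hu', hu0, rfl⟩ := ht.hasOrder_iff.1 hn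
  obtain ⟨v, hv, hv', hv0, e⟩ := ht.hasOrder_iff.1 hm
  have h1 : u * t ^ (n - m) ∈ A := by
    rw [zpow_sub₀ ht.ne_zero, ← mul_div_assoc, e, mul_div_assoc, div_self (zpow_ne_zero _ ht.ne_zero),
      mul_one]
    exact hv
  have h2 : v * t ^ (m - n) ∈ A := by
    rw [zpow_sub₀ ht.ne_zero, ← mul_div_assoc, ← e, mul_div_assoc,
      div_self (zpow_ne_zero _ ht.ne_zero), mul_one]
    exact hu
  rw [ht.unit_zpow_mem_iff hu hu' hu0] at h1
  rw [ht.unit_zpow_mem_iff hv hv' hv0] at h2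
  omega

lemma hasOrder_ord {z : K} (hz : z ≠ 0) : HasOrder A z (ord A z) := by
  obtain ⟨n, u, h⟩ := ht.exists_eq z hz
  have h : ∃ n, HasOrder A z n := ⟨n, ht.hasOrder_iff.2 ⟨u, h⟩⟩
  rw [ord, dif_pos h]
  exact h.choose_spec

lemma hasOrder_iff_ord {z : K} {n : ℤ} : HasOrder A z n ↔ z ≠ 0 ∧ ord A z = n := by
  constructor
  · intro h
    have hz : z ≠ 0 := by
      obtain ⟨u, -, -, h0, rfl⟩ := ht.hasOrder_iff.1 h
      exact mul_ne_zero h0 (zpow_ne_zero _ ht.ne_zero)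
    exact ⟨hz, ht.hasOrder_unique (ht.hasOrder_ord hz) h⟩
  · rintro ⟨h, rfl⟩
    exact ht.hasOrder_ord h

lemma exists_unit {z : K} (hz : z ≠ 0) :
    ∃ u ∈ A, u⁻¹ ∈ A ∧ u ≠ 0 ∧ z = u * t ^ ord A z :=
  ht.hasOrder_iff.1 (ht.hasOrder_ord hz)

lemma ord_eq {z u : K} {n : ℤ} (hu : u ∈ A) (hu' : u⁻¹ ∈ A) (h0 : u ≠ 0) (h : z = u * t ^ n) :
    ord A z = n :=
  (ht.hasOrder_iff_ord.1 (ht.hasOrder_iff.2 ⟨u, hu, hu', h0, h⟩)).2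

lemma ord_self : ord A t = 1 :=
  ht.ord_eq A.one_mem (by simp) one_ne_zero (by simp)

lemma ord_one : ord A (1 : K) = 0 :=
  ht.ord_eq A.one_mem (by simp) one_ne_zero (by simp)

lemma ord_mul {z w : K} (hz : z ≠ 0) (hw : w ≠ 0) : ord A (z * w) = ord A z + ord A w := by
  obtain ⟨u, hu, hu', hu0, e⟩ := ht.exists_unit hz
  obtain ⟨v, hv, hv', hv0, e'⟩ := ht.exists_unit hw
  refine ht.ord_eq (u := u * v) (A.mul_mem hu hv) ?_ (mul_ne_zero hu0 hv0) ?_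
  · rw [mul_inv]; exact A.mul_mem hu' hv'
  · rw [zpow_add₀ ht.ne_zero]; nth_rewrite 1 [e, e']; ring

lemma ord_pow {z : K} (hz : z ≠ 0) (n : ℕ) : ord A (z ^ n) = n * ord A z := by
  induction n with
  | zero => simp [ht.ord_one]
  | succ n ih => rw [pow_succ, ht.ord_mul (pow_ne_zero _ hz) hz, ih]; push_cast; ring

lemma ord_inv {z : K} (hz : z ≠ 0) : ord A z⁻¹ = -ord A z := by
  have h := ht.ord_mul hz (inv_ne_zero hz)
  rw [mul_inv_cancel₀ hz, ht.ord_one] at h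
  omega

lemma ord_zpow {z : K} (hz : z ≠ 0) (n : ℤ) : ord A (z ^ n) = n * ord A z := by
  obtain ⟨n, rfl | rfl⟩ := n.eq_nat_or_neg
  · simpa using ht.ord_pow hz n
  · simp [ht.ord_pow hz, ht.ord_inv (pow_ne_zero n hz)]

lemma mem_iff {z : K} : z ∈ A ↔ z = 0 ∨ 0 ≤ ord A z := by
  by_cases hz : z = 0
  · simp [hz]
  obtain ⟨u, hu, hu', hu0, e⟩ := ht.exists_unit hz
  rw [or_iff_right hz, ← ht.unit_zpow_mem_iff hu hu' hu0, ← e]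

lemma mul_zpow_mem_iff {z : K} {n : ℤ} : z * t ^ (-n) ∈ A ↔ z = 0 ∨ n ≤ ord A z := by
  by_cases hz : z = 0
  · simp [hz]
  rw [ht.mem_iff, ht.ord_mul hz (zpow_ne_zero _ ht.ne_zero), ht.ord_zpow ht.ne_zero, ht.ord_self]
  simp [hz, zpow_ne_zero, ht.ne_zero]

lemma le_ord_add {z w : K} {n : ℤ} (hz : z = 0 ∨ n ≤ ord A z) (hw : w = 0 ∨ n ≤ ord A w) :
    z + w = 0 ∨ n ≤ ord A (z + w) := by
  rw [← ht.mul_zpow_mem_iff] at *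
  rw [add_mul]
  exact A.add_mem hz hw

lemma ord_neg {z : K} : ord A (-z) = ord A z := by
  by_cases hz : z = 0
  · simp [hz]
  rw [← neg_one_mul, ht.ord_mul (by simp) hz]
  have h := ht.ord_mul (z := (-1 : K)) (w := -1) (by simp) (by simp)
  rw [neg_one_mul, neg_neg, ht.ord_one] at h
  omega

lemma ord_add_of_lt {z w : K} (hz : z ≠ 0) (h : w = 0 ∨ ord A z < ord A w) :
    z + w ≠ 0 ∧ ord A (z + w) = ord A z := by
  rcases eq_or_ne w 0 with rfl | hw
  · simpa using hz
  have h := h.resolve_left hw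
  have h0 : z + w ≠ 0 := by
    intro h0
    rw [eq_neg_of_add_eq_zero_left h0, ht.ord_neg] at h
    exact lt_irrefl _ h
  refine ⟨h0, le_antisymm ?_ ?_⟩
  · have h1 := ht.le_ord_add (z := z + w) (w := -w) (n := min (ord A (z + w)) (ord A w))
      (.inr (min_le_left _ _)) (.inr (by rw [ht.ord_neg]; exact min_le_right _ _))
    rw [add_neg_cancel_right, or_iff_right hz, min_le_iff] at h1
    omega
  · exact (ht.le_ord_add (.inr le_rfl) (.inr h.le)).resolve_left h0

lemma mem_or_inv_mem (z : K) : z ∈ A ∨ z⁻¹ ∈ A := by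
  by_cases hz : z = 0
  · simp [hz]
  rw [ht.mem_iff, ht.mem_iff, ht.ord_inv hz]
  omega

end IsUniformizer

end Valuation

/-! ### Parity of orders, and odd order up to fourth powers. -/

section OddOrder

variable {k : Type u} [Field k] {K : Type u} [Field K] [Algebra k K] [CharP K 2]

/-- The order of `z` is at least `n`. -/
def LeOrd (A : Subalgebra k K) (n : ℤ) (z : K) : Prop := z = 0 ∨ n ≤ ord A z

omit [CharP K 2] in
lemma LeOrd.mono {A : Subalgebra k K} {m n : ℤ} {z : K} (h : LeOrd A n z) (hm : m ≤ n) :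
    LeOrd A m z := h.imp_right hm.trans

namespace IsUniformizer

variable {A : Subalgebra k K} {t : K} (ht : IsUniformizer A t)
include ht

omit [CharP K 2] in
lemma leOrd_mul {z w : K} {m n : ℤ} (hz : LeOrd A m z) (hw : LeOrd A n w) :
    LeOrd A (m + n) (z * w) := by
  by_cases h1 : z = 0
  · left; simp [h1]
  by_cases h2 : w = 0
  · left; simp [h2]
  right
  rw [ht.ord_mul h1 h2]
  exact add_le_add (hz.resolve_left h1) (hw.resolve_left h2)

omit [CharP K 2] in
lemma leOrd_add {z w : K} {n : ℤ} (hz : LeOrd A n z) (hw : LeOrd A n w) :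
    LeOrd A n (z + w) := ht.le_ord_add hz hw

omit [CharP K 2] in
lemma leOrd_sq {a : K} {n : ℤ} : LeOrd A n (a ^ 2) ↔ LeOrd A ((n + 1) / 2) a := by
  rcases eq_or_ne a 0 with rfl | ha
  · simp [LeOrd]
  simp only [LeOrd, ha, pow_eq_zero_iff, ne_eq, OfNat.ofNat_ne_zero, not_false_eq_true, false_or,
    ht.ord_pow ha]
  push_cast
  omega

omit [CharP K 2] in
lemma leOrd_sq_mul {a g : K} (hg : g ≠ 0) {n : ℤ} :
    LeOrd A n (a ^ 2 * g) ↔ LeOrd A ((n - ord A g + 1) / 2) a := by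
  rcases eq_or_ne a 0 with rfl | ha
  · simp [LeOrd]
  simp only [LeOrd, ha, mul_eq_zero, hg, pow_eq_zero_iff, ne_eq, OfNat.ofNat_ne_zero,
    not_false_eq_true, false_or, ht.ord_pow ha, ht.ord_mul (pow_ne_zero 2 ha) hg]
  push_cast
  omega

-- The two summands have orders of different parity, so their leading terms cannot cancel.
omit [CharP K 2] in
lemma leOrd_sq_add_sq_mul {g : K} (hg : g ≠ 0) (hodd : Odd (ord A g)) {a b : K} {n : ℤ} :
    LeOrd A n (a ^ 2 + b ^ 2 * g) ↔ LeOrd A n (a ^ 2) ∧ LeOrd A n (b ^ 2 * g) := by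
  refine ⟨fun h => ?_, fun h => ht.leOrd_add h.1 h.2⟩
  rcases eq_or_ne a 0 with rfl | ha
  · simpa [LeOrd] using h
  rcases eq_or_ne b 0 with rfl | hb
  · simpa [LeOrd] using h
  have ha' := pow_ne_zero 2 ha
  have hb' := mul_ne_zero (pow_ne_zero 2 hb) hg
  have e1 := ht.ord_pow ha 2
  have e2 := ht.ord_mul (pow_ne_zero 2 hb) hg
  rw [ht.ord_pow hb 2] at e2
  obtain ⟨γ, hγ⟩ := hodd
  simp only [LeOrd, ha', hb', false_or] at h ⊢
  rcases lt_or_ge (ord A (a ^ 2)) (ord A (b ^ 2 * g)) with hlt | hle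
  · obtain ⟨h0, h1⟩ := ht.ord_add_of_lt ha' (.inr hlt)
    have h := h.resolve_left h0
    omega
  · obtain ⟨h0, h1⟩ := ht.ord_add_of_lt (z := b ^ 2 * g) (w := a ^ 2) hb' (.inr (by omega))
    rw [add_comm] at h0 h1
    have h := h.resolve_left h0
    omega

/-- The parity argument is used for the outer decomposition and again for its two coefficients, so
none of the four terms can cancel another. -/
lemma leOrd_coords {g : K} (hg : g ≠ 0) (hodd : Odd (ord A g)) {z₀ z₁ z₂ z₃ : K} {n : ℤ} :
    LeOrd A n (z₀ ^ 4 + z₁ ^ 4 * g + z₂ ^ 4 * g ^ 2 + z₃ ^ 4 * g ^ 3) ↔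
      (z₀ = 0 ∨ n ≤ 4 * ord A z₀) ∧ (z₁ = 0 ∨ n ≤ 4 * ord A z₁ + ord A g) ∧
      (z₂ = 0 ∨ n ≤ 4 * ord A z₂ + 2 * ord A g) ∧
      (z₃ = 0 ∨ n ≤ 4 * ord A z₃ + 3 * ord A g) := by
  have key : z₀ ^ 4 + z₁ ^ 4 * g + z₂ ^ 4 * g ^ 2 + z₃ ^ 4 * g ^ 3 =
      (z₀ ^ 2 + z₂ ^ 2 * g) ^ 2 + (z₁ ^ 2 + z₃ ^ 2 * g) ^ 2 * g := by
    linear_combination -(z₀ ^ 2 * z₂ ^ 2 * g + g * z₁ ^ 2 * z₃ ^ 2 * g) * two_eq_zero' (K := K)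
  rw [key, ht.leOrd_sq_add_sq_mul hg hodd, ht.leOrd_sq, ht.leOrd_sq_mul hg,
    ht.leOrd_sq_add_sq_mul hg hodd, ht.leOrd_sq_add_sq_mul hg hodd, ht.leOrd_sq, ht.leOrd_sq,
    ht.leOrd_sq_mul hg, ht.leOrd_sq_mul hg]
  obtain ⟨γ, hγ⟩ := hodd
  simp only [LeOrd]
  -- Adding one before halving rounds up; the nested roundings unwind to linear bounds.
  have h0 : (((n + 1) / 2 + 1) / 2 ≤ ord A z₀) ↔ n ≤ 4 * ord A z₀ := by omega
  have h1 : (((n - ord A g + 1) / 2 + 1) / 2 ≤ ord A z₁) ↔ n ≤ 4 * ord A z₁ + ord A g := by omega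
  have h2 : (((n + 1) / 2 - ord A g + 1) / 2 ≤ ord A z₂) ↔ n ≤ 4 * ord A z₂ + 2 * ord A g := by
    omega
  have h3 : (((n - ord A g + 1) / 2 - ord A g + 1) / 2 ≤ ord A z₃) ↔
      n ≤ 4 * ord A z₃ + 3 * ord A g := by omega
  rw [h0, h1, h2, h3]
  exact ⟨fun ⟨⟨a, c⟩, b, e⟩ => ⟨a, b, c, e⟩, fun ⟨a, b, c, e⟩ => ⟨⟨a, c⟩, b, e⟩⟩

/-- If `z` becomes of odd order after adding a fourth power, then it does so after removing its
fourth power part with respect to any function of odd order. -/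
lemma ord_eq_of_odd {g : K} (hg : g ≠ 0) (hodd : Odd (ord A g)) {z h z₀ z₁ z₂ z₃ : K} {n : ℤ}
    (hz : z = z₀ ^ 4 + z₁ ^ 4 * g + z₂ ^ 4 * g ^ 2 + z₃ ^ 4 * g ^ 3) (hn : Odd n)
    (ho : HasOrder A (z + h ^ 4) n) :
    z + z₀ ^ 4 ≠ 0 ∧ ord A (z + z₀ ^ 4) = n := by
  have e1 : z + h ^ 4 = (z₀ + h) ^ 4 + z₁ ^ 4 * g + z₂ ^ 4 * g ^ 2 + z₃ ^ 4 * g ^ 3 := by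
    rw [hz, add_pow_four]; ring
  have e2 : z + z₀ ^ 4 = 0 ^ 4 + z₁ ^ 4 * g + z₂ ^ 4 * g ^ 2 + z₃ ^ 4 * g ^ 3 := by
    rw [hz]; linear_combination z₀ ^ 4 * two_eq_zero' (K := K)
  obtain ⟨h0, ho⟩ := ht.hasOrder_iff_ord.1 ho
  have hle : LeOrd A n (z + h ^ 4) := .inr ho.ge
  have hnle : ¬ LeOrd A (n + 1) (z + h ^ 4) := by
    simp only [LeOrd, h0, false_or]; omega
  rw [e1, ht.leOrd_coords hg hodd] at hle hnle
  have hle' : LeOrd A n (z + z₀ ^ 4) := by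
    rw [e2, ht.leOrd_coords hg hodd]
    exact ⟨.inl rfl, hle.2⟩
  have hnle' : ¬ LeOrd A (n + 1) (z + z₀ ^ 4) := by
    rw [e2, ht.leOrd_coords hg hodd]
    -- The term of index 0 has order divisible by 4, so it cannot attain the odd number `n`.
    refine fun H => hnle ⟨hle.1.imp_right fun h => ?_, H.2⟩
    obtain ⟨m, rfl⟩ := hn
    omega
  simp only [LeOrd, not_or] at hnle'
  exact ⟨hnle'.1, by have := hle'.resolve_left hnle'.1; omega⟩

/-- After removal of z₀⁴, the order of z is the least 4 ord zᵢ + i with i = 1, 2, 3. If i = 1 or 3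
attains it, the denominator of the symbol has order 2 ord z₁ or 2 ord z₃ + 1 and the numerator at
least this order. If i = 2 attains it, the numerator has order 2 ord z₂ and the denominator a larger
one. -/
lemma exists_odd_order_iff (hK : IsCurveField k K) (htt : IsSeparableMorphism k t) {z : K}
    (hz : IsSeparableMorphism k z) :
    (∃ h : K, ∃ n : ℤ, Odd n ∧ HasOrder A (z + h ^ 4) n) ↔
      ∃ b ∈ A, symbol k z t = b ^ 2 • KaehlerDifferential.D k K t := by
  obtain ⟨z₀, z₁, z₂, z₃, e⟩ := hK.exists_coords htt z
  have hden := (isSeparable_iff_coords htt e).1 hz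
  have h1 : ord A t = 1 := ht.ord_self
  have t0 := ht.ne_zero
  have hodd : Odd (ord A t) := by rw [h1]; exact odd_one
  rw [symbol_eq htt e]
  set Q := (z₁ * z₃ + z₂ ^ 2) / (z₁ ^ 2 + z₃ ^ 2 * t) with hQ
  have hQ' : Q * (z₁ ^ 2 + z₃ ^ 2 * t) = z₁ * z₃ + z₂ ^ 2 := div_mul_cancel₀ _ hden
  have e2 : z + z₀ ^ 4 = 0 ^ 4 + z₁ ^ 4 * t + z₂ ^ 4 * t ^ 2 + z₃ ^ 4 * t ^ 3 := by
    rw [e]; linear_combination z₀ ^ 4 * two_eq_zero' (K := K)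
  have pt : ∀ x : K, x ≠ 0 → (x ^ 2 * t) ≠ 0 ∧ ord A (x ^ 2 * t) = 2 * ord A x + 1 := fun x hx =>
    ⟨mul_ne_zero (pow_ne_zero 2 hx) t0, by
      rw [ht.ord_mul (pow_ne_zero 2 hx) t0, ht.ord_pow hx, h1]; rfl⟩
  have ps : ∀ x : K, x ≠ 0 → ord A (x ^ 2) = 2 * ord A x := fun x hx => ht.ord_pow hx 2
  have of_bounds : ∀ m : ℤ, ord A (z₁ ^ 2 + z₃ ^ 2 * t) = m → LeOrd A m (z₁ * z₃ + z₂ ^ 2) →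
      ∃ b ∈ A, Q ^ 2 • KaehlerDifferential.D k K t = b ^ 2 • KaehlerDifferential.D k K t := by
    refine fun m hm h => ⟨Q, ?_, rfl⟩
    rw [ht.mem_iff]
    rcases eq_or_ne Q 0 with h0 | h0
    · exact .inl h0
    right
    rw [← hQ'] at h
    have := h.resolve_left (mul_ne_zero h0 hden)
    rw [ht.ord_mul h0 hden] at this
    omega
  constructor
  · rintro ⟨h, n, hn, ho⟩
    obtain ⟨w0, hw⟩ := ht.ord_eq_of_odd t0 hodd e hn ho
    have hle : LeOrd A n (z + z₀ ^ 4) := .inr hw.ge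
    have hnle : ¬ LeOrd A (n + 1) (z + z₀ ^ 4) := by
      simp only [LeOrd, w0, false_or]; omega
    rw [e2, ht.leOrd_coords t0 hodd, h1] at hle hnle
    obtain ⟨-, l1, l2, l3⟩ := hle
    obtain ⟨m, rfl⟩ := hn
    have l2' : z₂ = 0 ∨ 2 * m + 1 + 1 ≤ 4 * ord A z₂ + 2 * 1 := l2.imp_right fun _ => by omega
    -- The term of index 2 has even order, so an odd minimum is attained at index 1 or 3.
    have : (z₁ ≠ 0 ∧ 4 * ord A z₁ + 1 = 2 * m + 1) ∨ (z₃ ≠ 0 ∧ 4 * ord A z₃ + 3 = 2 * m + 1) := by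
      by_contra! H
      refine hnle ⟨.inl rfl, ?_, l2', ?_⟩
      · rcases eq_or_ne z₁ 0 with h | h
        · exact .inl h
        · have := H.1 h; have := l1.resolve_left h; right; omega
      · rcases eq_or_ne z₃ 0 with h | h
        · exact .inl h
        · have := H.2 h; have := l3.resolve_left h; right; omega
    rcases this with ⟨hz1, hm⟩ | ⟨hz3, hm⟩
    · refine of_bounds (2 * ord A z₁) ?_ ?_
      · rw [(ht.ord_add_of_lt (pow_ne_zero 2 hz1) ?_).2, ps _ hz1]
        rcases eq_or_ne z₃ 0 with h | h
        · simp [h]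
        · have := l3.resolve_left h
          rw [(pt _ h).2, ps _ hz1]; right; omega
      · refine ht.leOrd_add ((ht.leOrd_mul (m := ord A z₁) (n := ord A z₁) (.inr le_rfl)
          (l3.imp_right fun _ => by omega)).mono (by omega)) (ht.leOrd_sq.2 (l2.imp_right ?_))
        omega
    · refine of_bounds (2 * ord A z₃ + 1) ?_ ?_
      · rw [add_comm, (ht.ord_add_of_lt (pt _ hz3).1 ?_).2, (pt _ hz3).2]
        rcases eq_or_ne z₁ 0 with h | h
        · simp [h]
        · have := l1.resolve_left h
          rw [(pt _ hz3).2, ps _ h]; right; omega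
      · refine ht.leOrd_add ((ht.leOrd_mul (m := ord A z₃ + 1) (n := ord A z₃)
          (l1.imp_right fun _ => by omega) (.inr le_rfl)).mono (by omega))
          (ht.leOrd_sq.2 (l2.imp_right ?_))
        omega
  · rintro ⟨b, hb, hbQ⟩
    have hbQ : Q = b := sq_smul_D_injective htt hbQ
    have w0 : z + z₀ ^ 4 ≠ 0 := by
      intro h0
      apply hz
      rw [← add_zero z, ← CharTwo.add_self_eq_zero (z₀ ^ 4), ← add_assoc, h0, zero_add,
        show z₀ ^ 4 = (z₀ ^ 2) ^ 2 by ring, D_sq]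
    refine ⟨z₀, ord A (z + z₀ ^ 4), ?_, ht.hasOrder_ord w0⟩
    by_contra hev
    rw [Int.not_odd_iff_even] at hev
    set n := ord A (z + z₀ ^ 4) with hn
    have hle : LeOrd A n (z + z₀ ^ 4) := .inr le_rfl
    have hnle : ¬ LeOrd A (n + 1) (z + z₀ ^ 4) := by
      simp only [LeOrd, w0, false_or]; omega
    rw [e2, ht.leOrd_coords t0 hodd, h1] at hle hnle
    obtain ⟨-, l1, l2, l3⟩ := hle
    obtain ⟨m, hm⟩ := hev
    have l1' : z₁ = 0 ∨ n + 1 ≤ 4 * ord A z₁ + 1 := l1.imp_right fun _ => by omega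
    have l3' : z₃ = 0 ∨ n + 1 ≤ 4 * ord A z₃ + 3 * 1 := l3.imp_right fun _ => by omega
    have hz2 : z₂ ≠ 0 := fun h => hnle ⟨.inl rfl, l1', .inl h, l3'⟩
    -- An even minimum is attained at index 2 only.
    have hn2 : n = 4 * ord A z₂ + 2 := by
      by_contra h
      refine hnle ⟨.inl rfl, l1', .inr ?_, l3'⟩
      have := l2.resolve_left hz2
      omega
    have hnum : z₂ ^ 2 + z₁ * z₃ ≠ 0 ∧ ord A (z₂ ^ 2 + z₁ * z₃) = 2 * ord A z₂ := by
      rw [← ps _ hz2]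
      refine ht.ord_add_of_lt (pow_ne_zero 2 hz2) ?_
      rw [ps _ hz2]
      refine (ht.leOrd_mul (m := ord A z₂ + 1) (n := ord A z₂) (l1'.imp_right ?_)
        (l3'.imp_right ?_)).imp_right ?_ <;> omega
    have hd : LeOrd A (2 * ord A z₂ + 1) (z₁ ^ 2 + z₃ ^ 2 * t) := by
      refine ht.leOrd_add (ht.leOrd_sq.2 (l1'.imp_right ?_))
        ((ht.leOrd_sq_mul t0).2 (l3'.imp_right ?_)) <;> omega
    have hb : LeOrd A 0 b := ht.mem_iff.1 hb
    have := ht.leOrd_mul hb hd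
    rw [← hbQ, hQ', add_comm (z₁ * z₃)] at this
    have := this.resolve_left hnum.1
    omega

end IsUniformizer

end OddOrder

/-! ### Local generators of B. -/

section LocalAlgebra

variable {k : Type u} [Field k] {K : Type u} [Field K] [Algebra k K]

local notation "d" => KaehlerDifferential.D k K

lemma mem_of_isIntegral {A : Subalgebra k K} (hv : ∀ z : K, z ∈ A ∨ z⁻¹ ∈ A)
    {R : Subalgebra k K} (hR : R ≤ A) {z : K} (hz : IsIntegral R z) : z ∈ A := by
  let V : ValuationSubring K := { A.toSubring with mem_or_inv_mem' := hv }
  have hz' : IsIntegral V z := by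
    obtain ⟨p, hp, hp'⟩ := hz
    refine ⟨p.map (Subring.inclusion (S := R.toSubring) (T := V.toSubring) hR), hp.map _, ?_⟩
    rw [Polynomial.eval₂_map]
    exact hp'
  obtain ⟨y, hy⟩ := IsIntegrallyClosed.isIntegral_iff.1 hz'
  rw [← hy]
  exact y.2

lemma mem_of_pow_four_mem {A : Subalgebra k K} (hv : ∀ z : K, z ∈ A ∨ z⁻¹ ∈ A) {z : K}
    (h : z ^ 4 ∈ A) : z ∈ A := by
  rcases hv z with hz | hz
  · exact hz
  rcases eq_or_ne z 0 with rfl | h0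
  · exact A.zero_mem
  have : z = z ^ 4 * z⁻¹ ^ 3 := by field_simp
  rw [this]
  exact A.mul_mem h (A.pow_mem hz 3)

lemma mem_of_sq_mem {A : Subalgebra k K} (hv : ∀ z : K, z ∈ A ∨ z⁻¹ ∈ A) {z : K}
    (h : z ^ 2 ∈ A) : z ∈ A := by
  refine mem_of_pow_four_mem hv ?_
  rw [show z ^ 4 = (z ^ 2) ^ 2 by ring]
  exact A.pow_mem h 2

variable [CharP K 2]

lemma symbol_mem_of_generatesB_aux {A : Subalgebra k K} {g : K} {Q : K} (hQ : Q ∈ A) (hg : g ∈ A) :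
    ∃ h ∈ A, Q ^ 2 • d g = d h :=
  ⟨Q ^ 2 * g, A.mul_mem (A.pow_mem hQ 2) hg, (D_sq_mul g Q).symm⟩

namespace GeneratesB

variable {A : Subalgebra k K} {g : A} (hK : IsCurveField k K)
  (hv : ∀ z : K, z ∈ A ∨ z⁻¹ ∈ A)

include hK hv in
lemma isSeparable (hg : GeneratesB A g) : IsSeparableMorphism k (g : K) := by
  obtain ⟨z, hz⟩ := hK.exists_separable
  obtain ⟨w, hw, hw'⟩ : ∃ w ∈ A, IsSeparableMorphism k w := by
    rcases hv z with h | h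
    · exact ⟨z, h, hz⟩
    · refine ⟨z⁻¹, h, ?_⟩
      have hz0 : z ≠ 0 := by rintro rfl; exact hz (map_zero _)
      rw [show z⁻¹ = z⁻¹ ^ 2 * z by field_simp, IsSeparableMorphism, D_sq_mul]
      exact smul_ne_zero (pow_ne_zero 2 (inv_ne_zero hz0)) hz
  obtain ⟨c, hc⟩ := hg ⟨w, hw⟩
  intro h0
  rw [h0, smul_zero] at hc
  exact hw' hc

-- Subtracting the right multiple of `g` leaves a function with zero differential, hence a square;
-- its root is integral because valuation rings contain square roots of their elements.
include hK hv in
lemma decomp (hg : GeneratesB A g) {h : K} (hh : h ∈ A) :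
    ∃ a ∈ A, ∃ b ∈ A, h = a ^ 2 + b ^ 2 * g := by
  obtain ⟨c, hc⟩ := hg ⟨h, hh⟩
  have : d (h + c ^ 2 * g) = 0 := by
    rw [map_add, D_sq_mul, ← hc, add_self_eq_zero' (K := K)]
  obtain ⟨a, ha⟩ := hK.isSquare_of_D_eq_zero this
  refine ⟨a, mem_of_sq_mem hv ?_, c, c.2, ?_⟩
  · rw [← ha]
    exact A.add_mem hh (A.mul_mem (A.pow_mem c.2 2) g.2)
  · rw [← ha]; linear_combination -(c : K) ^ 2 * g * two_eq_zero' (K := K)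

omit hK hv in
lemma of_decomp (H : ∀ h ∈ A, ∃ a ∈ A, ∃ b ∈ A, h = a ^ 2 + b ^ 2 * g) : GeneratesB A g := by
  intro h
  obtain ⟨a, ha, b, hb, e⟩ := H h h.2
  exact ⟨⟨b, hb⟩, by rw [e, D_sq_add_sq_mul]⟩

include hK hv in
lemma exists_coords (hg : GeneratesB A g) {f : K} (hf : f ∈ A) :
    ∃ f₀ ∈ A, ∃ f₁ ∈ A, ∃ f₂ ∈ A, ∃ f₃ ∈ A,
      f = f₀ ^ 4 + f₁ ^ 4 * g + f₂ ^ 4 * (g : K) ^ 2 + f₃ ^ 4 * (g : K) ^ 3 :=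
  exists_coords_of_mem (A := (A : Set K)) (fun _ hf => hg.decomp hK hv hf) hf

include hK hv in
lemma coords_mem (hg : GeneratesB A g) {f₀ f₁ f₂ f₃ : K}
    (hf : f₀ ^ 4 + f₁ ^ 4 * g + f₂ ^ 4 * (g : K) ^ 2 + f₃ ^ 4 * (g : K) ^ 3 ∈ A) :
    f₀ ∈ A ∧ f₁ ∈ A ∧ f₂ ∈ A ∧ f₃ ∈ A := by
  obtain ⟨a₀, h0, a₁, h1, a₂, h2, a₃, h3, e⟩ := hg.exists_coords hK hv hf
  obtain ⟨rfl, rfl, rfl, rfl⟩ := coords_injective (hg.isSeparable hK hv) e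
  exact ⟨h0, h1, h2, h3⟩

include hK hv in
lemma exists_unit {g' : A} (hg : GeneratesB A g) (hg' : GeneratesB A g') :
    ∃ c ∈ A, c⁻¹ ∈ A ∧ c ≠ 0 ∧ d (g : K) = c ^ 2 • d (g' : K) := by
  obtain ⟨c, hc⟩ := hg' g
  obtain ⟨c', hc'⟩ := hg g'
  have h : (c' * c : K) = 1 := by
    refine sq_smul_D_injective (hg'.isSeparable hK hv) ?_
    rw [mul_pow, mul_smul, ← hc, ← hc', one_pow, one_smul]
  refine ⟨c, c.2, ?_, right_ne_zero_of_mul_eq_one h, hc⟩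
  rw [inv_eq_of_mul_eq_one_left h]
  exact c'.2

-- The denominator of the symbol is the unit relating the two differentials, and the numerator has
-- integral coordinates.
include hK hv in
lemma symbol_mem {g' : A} (hg : GeneratesB A g) (hg' : GeneratesB A g') :
    ∃ h ∈ A, symbol k (g : K) (g' : K) = d h := by
  obtain ⟨g₀, h0, g₁, h1, g₂, h2, g₃, h3, e⟩ := hg'.exists_coords hK hv g.2
  obtain ⟨c, hc, hc', hc0, ec⟩ := hg.exists_unit hK hv hg'
  have hs := hg'.isSeparable hK hv
  rw [symbol_eq hs e]
  refine symbol_mem_of_generatesB_aux ?_ g'.2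
  have : g₁ ^ 2 + g₃ ^ 2 * g' = c := sq_smul_D_injective hs (by rw [← ec, e, D_coords])
  rw [this, div_eq_mul_inv]
  exact A.mul_mem (A.add_mem (A.mul_mem h1 h3) (A.pow_mem h2 2)) hc'

end GeneratesB

lemma IsCurveField.isSeparable_of_odd (hK : IsCurveField k K) {A : Subalgebra k K} {t : K}
    (ht : IsUniformizer A t) {g : K} (hg : g ≠ 0) (hodd : Odd (ord A g)) :
    IsSeparableMorphism k g := by
  intro h
  obtain ⟨a, rfl⟩ := hK.isSquare_of_D_eq_zero h
  rw [ht.ord_pow (by rintro rfl; simp at hg)] at hodd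
  push_cast at hodd
  obtain ⟨m, hm⟩ := hodd
  omega

lemma IsUniformizer.isSeparable (hK : IsCurveField k K) {A : Subalgebra k K} {t : K}
    (ht : IsUniformizer A t) : IsSeparableMorphism k t :=
  hK.isSeparable_of_odd ht ht.ne_zero (by rw [ht.ord_self]; exact odd_one)

/-- By parity, integrality of a² + b²t forces that of a and b. -/
lemma IsUniformizer.generatesB (hK : IsCurveField k K) {A : Subalgebra k K} {t : K}
    (ht : IsUniformizer A t) : GeneratesB A ⟨t, ht.mem⟩ := by
  refine GeneratesB.of_decomp fun h hh => ?_
  obtain ⟨a, b, rfl⟩ := hK.decomp t (ht.isSeparable hK) h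
  have hh := ht.mem_iff.1 hh
  change LeOrd A 0 _ at hh
  rw [ht.leOrd_sq_add_sq_mul ht.ne_zero (by rw [ht.ord_self]; exact odd_one), ht.leOrd_sq,
    ht.leOrd_sq_mul ht.ne_zero, ht.ord_self] at hh
  exact ⟨a, ht.mem_iff.2 hh.1, b, ht.mem_iff.2 hh.2, rfl⟩

end LocalAlgebra

/-! ### Polynomials in a function and the image point on the line. -/

section Polynomials

open Polynomial

variable {k : Type u} [Field k] {K : Type u} [Field K] [Algebra k K]

/-- Monomials are sorted by exponent mod 4, and coefficients have fourth roots. -/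
lemma exists_polynomial_coords [CharP k 2] (hk : ∀ c : k, ∃ e : k, e ^ 2 = c) (P : k[X]) :
    ∃ p₀ p₁ p₂ p₃ : k[X], P = p₀ ^ 4 + p₁ ^ 4 * X + p₂ ^ 4 * X ^ 2 + p₃ ^ 4 * X ^ 3 := by
  have add4 : ∀ a b : k[X], (a + b) ^ 4 = a ^ 4 + b ^ 4 := fun a b =>
    add_pow_char_pow (p := 2) (n := 2) ..
  induction P using Polynomial.induction_on' with
  | add p q hp hq =>
    obtain ⟨p₀, p₁, p₂, p₃, rfl⟩ := hp
    obtain ⟨q₀, q₁, q₂, q₃, rfl⟩ := hq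
    refine ⟨p₀ + q₀, p₁ + q₁, p₂ + q₂, p₃ + q₃, ?_⟩
    simp only [add4]
    ring
  | monomial n a =>
    obtain ⟨b, rfl⟩ := hk a
    obtain ⟨c, rfl⟩ := hk b
    have e : monomial n ((c ^ 2) ^ 2) = (C c * X ^ (n / 4)) ^ 4 * X ^ (n % 4) := by
      have h4 : n / 4 * 4 + n % 4 = n := Nat.div_add_mod' n 4
      rw [← C_mul_X_pow_eq_monomial, mul_pow, mul_assoc, ← pow_mul X, ← pow_add, h4, ← pow_mul,
        map_pow]
    have : n % 4 < 4 := Nat.mod_lt _ (by norm_num)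
    rw [e]
    interval_cases n % 4
    · exact ⟨C c * X ^ (n / 4), 0, 0, 0, by simp⟩
    · exact ⟨0, C c * X ^ (n / 4), 0, 0, by simp⟩
    · exact ⟨0, 0, C c * X ^ (n / 4), 0, by simp⟩
    · exact ⟨0, 0, 0, C c * X ^ (n / 4), by simp⟩

/-- Over a perfect field aP + bP' = 1; evaluated in a local ring where P(f) is not a unit, this
makes P'(f) one. -/
lemma isUnit_aeval_derivative [PerfectField k] {A : Type*} [CommRing A] [Algebra k A]
    [IsLocalRing A] {P : k[X]} (hP : Irreducible P) {f : A} (h : ¬ IsUnit (aeval f P)) :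
    IsUnit (aeval f (derivative P)) := by
  obtain ⟨a, b, hab⟩ := PerfectField.separable_of_irreducible hP
  have := congrArg (aeval f) hab
  simp only [map_add, map_mul, map_one] at this
  rcases IsLocalRing.isUnit_or_isUnit_of_add_one this with h1 | h1
  · exact absurd (isUnit_of_mul_isUnit_right h1) h
  · exact isUnit_of_mul_isUnit_right h1

lemma isLocalRing_of_mem_or_inv_mem {A : Subalgebra k K} (hv : ∀ z : K, z ∈ A ∨ z⁻¹ ∈ A) :
    IsLocalRing A := by
  let V : ValuationSubring K := { A.toSubring with mem_or_inv_mem' := hv }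
  exact inferInstanceAs (IsLocalRing V)

/-- The image of the point on the affine line exists: otherwise every nonzero P(f) is a unit, and
`A`, being integrally closed, contains everything algebraic over k(f), that is, all of K. -/
lemma exists_irreducible_not_isUnit [CharP K 2] (hK : IsCurveField k K) {A : Subalgebra k K}
    (hv : ∀ z : K, z ∈ A ∨ z⁻¹ ∈ A) (hA : A ≠ ⊤) {f : A} (hf : IsSeparableMorphism k (f : K)) :
    ∃ P : k[X], Irreducible P ∧ ¬ IsUnit (aeval f P) := by
  by_contra! H
  have hunit : ∀ P : k[X], P ≠ 0 → IsUnit (aeval f P) := by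
    intro P
    induction P using WfDvdMonoid.induction_on_irreducible with
    | zero => intro h; exact absurd rfl h
    | unit u hu => intro; exact hu.map _
    | mul a i ha hi IH =>
      intro
      rw [map_mul]
      exact (H i hi).mul (IH ha)
  apply hA
  rw [eq_top_iff]
  rintro z -
  have := hK.isAlgebraic f hf
  obtain ⟨y, hy0, hy⟩ := (Algebra.IsAlgebraic.isAlgebraic (R := Algebra.adjoin k {(f : K)})
    z).exists_integral_multiple
  have hle : Algebra.adjoin k {(f : K)} ≤ A := by
    rw [Algebra.adjoin_le_iff, Set.singleton_subset_iff]
    exact f.2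
  have h1 := mem_of_isIntegral hv hle hy
  obtain ⟨P, hP⟩ : ∃ P : k[X], aeval (f : K) P = y := by
    obtain ⟨P, hP⟩ := (Algebra.adjoin_singleton_eq_range_aeval k (f : K)).le y.2
    exact ⟨P, hP⟩
  have hP0 : P ≠ 0 := by
    rintro rfl
    rw [map_zero] at hP
    exact hy0 (Subtype.ext hP.symm)
  obtain ⟨h2, h3⟩ := (IsUniformizer.isUnit_iff _).1 (hunit P hP0)
  rw [aeval_subalgebra_coe, hP] at h2 h3
  have : z = (y : K)⁻¹ * (y • z) := by
    rw [Subalgebra.smul_def, smul_eq_mul, inv_mul_cancel_left₀ h2]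
  rw [this]
  exact A.mul_mem h3 h1

end Polynomials

/-! ### The symbol criterion for pseudotameness. -/

section Pseudotame

open Polynomial

variable {k : Type u} [Field k] [CharP k 2] [PerfectField k] {K : Type u} [Field K] [Algebra k K]
  [CharP K 2]

local notation "d" => KaehlerDifferential.D k K

/-- Pseudotameness concerns `τ`, the criterion concerns `f`; the cocycle rule passes between them
once this symbol is known to be regular. -/
lemma symbol_pulledBackUniformizer (hK : IsCurveField k K) {A : Subalgebra k K}
    (hv : ∀ z : K, z ∈ A ∨ z⁻¹ ∈ A) {f τ : K} (hf : IsSeparableMorphism k f)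
    (hτ : IsPulledBackUniformizer A f τ) :
    IsSeparableMorphism k τ ∧ ∃ h ∈ A, symbol k τ f = d h := by
  rcases hτ with ⟨hfA, rfl⟩ | ⟨hfA, P, hP, hu, rfl⟩
  · have h0 : f ≠ 0 := by rintro rfl; exact hfA A.zero_mem
    -- At infinity f⁻¹ = (f⁻¹)⁴f³ has only the coordinate of index 3, so its symbol vanishes.
    have e : f⁻¹ = 0 ^ 4 + 0 ^ 4 * f + 0 ^ 4 * f ^ 2 + f⁻¹ ^ 4 * f ^ 3 := by field_simp; simp
    refine ⟨(isSeparable_iff_coords hf e).2 (by simpa using h0), 0, A.zero_mem, ?_⟩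
    rw [symbol_eq hf e]
    simp
  · have := isLocalRing_of_mem_or_inv_mem hv
    obtain ⟨h1, h2⟩ := (IsUniformizer.isUnit_iff _).1 (isUnit_aeval_derivative hP hu)
    rw [aeval_subalgebra_coe] at h1 h2
    simp only at h1 h2
    have hD : d (aeval f P) = aeval f (derivative P) • d f := Derivation.map_aeval _ P f
    refine ⟨by rw [IsSeparableMorphism, hD]; exact smul_ne_zero h1 hf, ?_⟩
    obtain ⟨p₀, p₁, p₂, p₃, e⟩ := exists_polynomial_coords hK.sqrt P
    have e' := congrArg (aeval f) e
    simp only [map_add, map_mul, map_pow, aeval_X] at e'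
    rw [symbol_eq hf e']
    refine symbol_mem_of_generatesB_aux ?_ hfA
    -- The denominator of the symbol is a square root of the unit P'(f).
    have hu2 : (aeval f p₁ ^ 2 + aeval f p₃ ^ 2 * f) ^ 2 = aeval f (derivative P) := by
      refine smul_left_injective K hf ?_
      simp only
      rw [← hD, e', D_coords]
    have hmem : ∀ p : k[X], aeval f p ∈ A := fun p => by
      have := (aeval (⟨f, hfA⟩ : A) p).2
      rwa [aeval_subalgebra_coe] at this
    rw [div_eq_mul_inv]
    refine A.mul_mem (A.add_mem (A.mul_mem (hmem _) (hmem _)) (A.pow_mem (hmem _) 2))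
      (mem_of_sq_mem hv ?_)
    rwa [inv_pow, hu2]

omit [CharP k 2] [PerfectField k] [CharP K 2] in
lemma IsUniformizer.ne_top {A : Subalgebra k K} {t : K} (ht : IsUniformizer A t) : A ≠ ⊤ := by
  rintro rfl
  exact ht.inv_notMem trivial

/-- The criterion for pseudotameness in terms of the symbol. -/
theorem isPseudotameAt_iff (hK : IsCurveField k K) {A : Subalgebra k K} {t : K}
    (ht : IsUniformizer A t) {f : K} (hf : IsSeparableMorphism k f) {g : A} (hg : GeneratesB A g) :
    IsPseudotameAt A f ↔ ∃ h ∈ A, symbol k f (g : K) = d h := by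
  have hv := ht.mem_or_inv_mem
  have hts := ht.isSeparable hK
  have htB := ht.generatesB hK
  have hgs := hg.isSeparable hK hv
  have sum_mem : ∀ {ω₁ ω₂ : Ω[K⁄k]}, (∃ h ∈ A, ω₁ = d h) → (∃ h ∈ A, ω₂ = d h) →
      ∃ h ∈ A, ω₁ + ω₂ = d h := by
    rintro _ _ ⟨h, hh, rfl⟩ ⟨h', hh', rfl⟩
    exact ⟨h + h', A.add_mem hh hh', (map_add _ _ _).symm⟩
  have mem_t : ∀ ω : Ω[K⁄k], (∃ b ∈ A, ω = b ^ 2 • d t) ↔ ∃ h ∈ A, ω = d h := by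
    refine fun ω => ⟨?_, ?_⟩
    · rintro ⟨b, hb, rfl⟩
      exact symbol_mem_of_generatesB_aux hb ht.mem
    · rintro ⟨h, hh, rfl⟩
      obtain ⟨c, hc⟩ := htB ⟨h, hh⟩
      exact ⟨c, c.2, hc⟩
  -- SY(τ,f) and SY(t,g) are regular, so by the cocycle rule SY(τ,t) is regular exactly if SY(f,g)
  -- is. This holds for every admissible `τ`, so the choice is immaterial.
  have key : ∀ τ, IsPulledBackUniformizer A f τ →
      ((∃ h : K, ∃ n : ℤ, Odd n ∧ HasOrder A (τ + h ^ 4) n) ↔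
        ∃ h ∈ A, symbol k f (g : K) = d h) := by
    intro τ hτ
    obtain ⟨hτs, hτm⟩ := symbol_pulledBackUniformizer hK hv hf hτ
    rw [ht.exists_odd_order_iff hK hts hτs, mem_t]
    constructor
    · intro h
      rw [← hK.symbol_add hf hτs hgs, ← hK.symbol_add hτs hts hgs, hK.symbol_comm hf hτs]
      exact sum_mem hτm (sum_mem h (htB.symbol_mem hK hv hg))
    · intro h
      rw [← hK.symbol_add hτs hf hts, ← hK.symbol_add hf hgs hts]
      exact sum_mem hτm (sum_mem h (hg.symbol_mem hK hv htB))
  constructor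
  · rintro ⟨τ, hτ, h⟩
    exact (key τ hτ).1 h
  · intro h
    obtain ⟨τ, hτ⟩ : ∃ τ, IsPulledBackUniformizer A f τ := by
      by_cases hfA : f ∈ A
      · obtain ⟨P, hP, hu⟩ := exists_irreducible_not_isUnit hK hv ht.ne_top (f := ⟨f, hfA⟩) hf
        exact ⟨_, .inr ⟨hfA, P, hP, hu, rfl⟩⟩
      · exact ⟨_, .inl ⟨hfA, rfl⟩⟩
    exact ⟨τ, hτ, (key τ hτ).2 h⟩

end Pseudotame

/-! ### The quotient by fourth powers. -/

section FrobeniusQuotient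

variable {k : Type u} [Field k] {A : Type u} [CommRing A] [Algebra k A]

lemma pow_four_mem_frobRing (s : A) : s ^ 4 ∈ frobRing k A :=
  Algebra.subset_adjoin ⟨s, rfl⟩

/-- Fourth powers are closed under sums in characteristic two and contain the constants, as these
have fourth roots. -/
lemma mem_frobRing_iff [CharP A 2] (hk : ∀ c : k, ∃ e : k, e ^ 2 = c) {x : A} :
    x ∈ frobRing k A ↔ ∃ s : A, x = s ^ 4 := by
  refine ⟨fun h => ?_, fun ⟨s, hs⟩ => hs ▸ pow_four_mem_frobRing s⟩
  induction h using Algebra.adjoin_induction with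
  | mem x hx => obtain ⟨s, rfl⟩ := hx; exact ⟨s, rfl⟩
  | algebraMap r =>
    obtain ⟨b, rfl⟩ := hk r
    obtain ⟨c, rfl⟩ := hk b
    exact ⟨algebraMap k A c, by rw [map_pow, map_pow]; ring⟩
  | add x y _ _ hx hy =>
    obtain ⟨s, rfl⟩ := hx
    obtain ⟨t, rfl⟩ := hy
    exact ⟨s + t, (add_pow_char_pow (p := 2) (n := 2) s t).symm⟩
  | mul x y _ _ hx hy =>
    obtain ⟨s, rfl⟩ := hx
    obtain ⟨t, rfl⟩ := hy
    exact ⟨s * t, (mul_pow s t 4).symm⟩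

lemma frobMk_surjective : Function.Surjective (frobMk k (A := A)) :=
  Submodule.mkQ_surjective _

lemma frobMk_pow_four_mul (s e : A) :
    frobMk k (s ^ 4 * e) = (⟨s ^ 4, pow_four_mem_frobRing s⟩ : frobRing k A) • frobMk k e := by
  rw [← map_smul]
  rfl

variable [CharP A 2] (hk : ∀ c : k, ∃ e : k, e ^ 2 = c)

include hk

lemma frobMk_eq_zero_iff {e : A} : frobMk k e = 0 ↔ ∃ s : A, e = s ^ 4 := by
  have h : frobMk k e = 0 ↔ e ∈ LinearMap.range (Algebra.linearMap (frobRing k A) A) :=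
    Submodule.Quotient.mk_eq_zero _
  rw [h, ← mem_frobRing_iff hk, LinearMap.mem_range]
  constructor
  · rintro ⟨y, rfl⟩; exact y.2
  · intro h; exact ⟨⟨e, h⟩, rfl⟩

lemma frobMk_eq_iff {e e' : A} : frobMk k e = frobMk k e' ↔ ∃ s : A, e = e' + s ^ 4 := by
  rw [← sub_eq_zero, ← map_sub, frobMk_eq_zero_iff hk]
  exact exists_congr fun s => sub_eq_iff_eq_add'

lemma smul_frobMk (r : frobRing k A) (e : A) : ∃ s : A, (r : A) = s ^ 4 ∧
    r • frobMk k e = frobMk k (s ^ 4 * e) := by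
  obtain ⟨s, hs⟩ := (mem_frobRing_iff hk).1 r.2
  refine ⟨s, hs, ?_⟩
  rw [frobMk_pow_four_mul]
  congr 1
  exact Subtype.ext hs

lemma mem_span_frobMk {e h : A} :
    frobMk k h ∈ Submodule.span (frobRing k A) {frobMk k e} ↔ ∃ s w : A, h = s ^ 4 * e + w ^ 4 := by
  rw [Submodule.mem_span_singleton]
  constructor
  · rintro ⟨r, hr⟩
    obtain ⟨s, -, hs⟩ := smul_frobMk hk r e
    rw [hs, eq_comm, frobMk_eq_iff hk] at hr
    exact ⟨s, hr⟩
  · rintro ⟨s, w, h⟩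
    exact ⟨⟨s ^ 4, pow_four_mem_frobRing s⟩, by
      rw [← frobMk_pow_four_mul, eq_comm, frobMk_eq_iff hk]; exact ⟨w, h⟩⟩

end FrobeniusQuotient

/-! ### Line subbundles and the conic, locally. -/

section Lines

variable {k : Type u} [Field k] {K : Type u} [Field K] [Algebra k K]

/-- The stalk of the line subbundle generically spanned by `f`. -/
def lineStalk (A : Subalgebra k K) (f : K) : Submodule (frobRing k A) (FrobQuot k A) :=
  Submodule.span _ {ε | ∃ e : A, ε = frobMk k e ∧ ∃ c w : K, (e : K) = c ^ 4 * f + w ^ 4}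

variable [CharP K 2] (hK : IsCurveField k K) {A : Subalgebra k K}

instance charP_subalgebra (A : Subalgebra k K) : CharP A 2 :=
  A.val.toRingHom.charP Subtype.val_injective 2

-- Taking the span adds nothing, since fourth powers are additive; changing the representative of a
-- class only changes `w`.
include hK in
lemma frobMk_mem_lineStalk {f : K} {e : A} :
    frobMk k e ∈ lineStalk A f ↔ ∃ c w : K, (e : K) = c ^ 4 * f + w ^ 4 := by
  refine ⟨fun h => ?_, fun h => Submodule.subset_span ⟨e, rfl, h⟩⟩
  suffices H : ∀ ε ∈ lineStalk A f, ∃ e : A, ε = frobMk k e ∧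
      ∃ c w : K, (e : K) = c ^ 4 * f + w ^ 4 by
    obtain ⟨e', he', c, w, hcw⟩ := H _ h
    obtain ⟨s, rfl⟩ := (frobMk_eq_iff hK.sqrt).1 he'
    refine ⟨c, w + s, ?_⟩
    rw [add_pow_four, ← add_assoc, ← hcw]
    rfl
  intro ε hε
  induction hε using Submodule.span_induction with
  | mem x hx => exact hx
  | zero => exact ⟨0, by simp, 0, 0, by simp⟩
  | add x y _ _ hx hy =>
    obtain ⟨e, rfl, c, w, h⟩ := hx
    obtain ⟨e', rfl, c', w', h'⟩ := hy
    refine ⟨e + e', (map_add _ _ _).symm, c + c', w + w', ?_⟩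
    rw [AddMemClass.coe_add, h, h', add_pow_four, add_pow_four]; ring
  | smul r x _ hx =>
    obtain ⟨e, rfl, c, w, h⟩ := hx
    obtain ⟨s, -, hs⟩ := smul_frobMk hK.sqrt r e
    refine ⟨s ^ 4 * e, hs, s * c, s * w, ?_⟩
    rw [MulMemClass.coe_mul, h, SubmonoidClass.coe_pow]; ring

include hK in
lemma lineStalk_affine {f f' : K} (h : FourthPowerAffine f f') : lineStalk A f = lineStalk A f' := by
  obtain ⟨c, w, hc, rfl⟩ := h
  ext ε
  obtain ⟨e, rfl⟩ := frobMk_surjective ε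
  rw [frobMk_mem_lineStalk hK, frobMk_mem_lineStalk hK]
  constructor
  · rintro ⟨a, b, h⟩
    refine ⟨a / c, a / c * w + b, ?_⟩
    rw [h, add_pow_four]
    have : c ^ 4 * (a / c) ^ 4 = a ^ 4 := by field_simp
    linear_combination -f * this - (a / c) ^ 4 * w ^ 4 * two_eq_zero' (K := K)
  · rintro ⟨a, b, h⟩
    refine ⟨a * c, a * w + b, ?_⟩
    rw [h, add_pow_four]; ring

/-- The combination `∑ tᵢ⁴ gⁱ`, `i = 1, 2, 3`. -/
def coordSum {R : Type*} [CommRing R] (g : R) (t : Fin 3 → R) : R :=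
  t 0 ^ 4 * g + t 1 ^ 4 * g ^ 2 + t 2 ^ 4 * g ^ 3

omit [CharP K 2] in
lemma coe_coordSum (g : A) (t : Fin 3 → A) :
    ((coordSum g t : A) : K) = coordSum (g : K) (fun i => (t i : K)) := by
  simp [coordSum]

omit [Algebra k K] in
lemma coordSum_add (g : K) (s t : Fin 3 → K) :
    coordSum g (s + t) = coordSum g s + coordSum g t := by
  simp only [coordSum, Pi.add_apply, add_pow_four]; ring

lemma coordSum_injective {g : K} (hg : IsSeparableMorphism k g) {w w' : K} {s s' : Fin 3 → K}
    (h : coordSum g s + w ^ 4 = coordSum g s' + w' ^ 4) : s = s' ∧ w = w' := by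
  obtain ⟨h0, h1, h2, h3⟩ := coords_injective hg (a₀ := w) (b₀ := w') (a₁ := s 0) (b₁ := s' 0)
    (a₂ := s 1) (b₂ := s' 1) (a₃ := s 2) (b₃ := s' 2)
    (by simp only [coordSum] at h; linear_combination h)
  refine ⟨?_, h0⟩
  ext i
  fin_cases i <;> assumption

omit [CharP K 2] in
lemma exists_dominating (hv : ∀ z : K, z ∈ A ∨ z⁻¹ ∈ A) (t : Fin 3 → K) (ht : t ≠ 0) :
    ∃ j, t j ≠ 0 ∧ ∀ i, t i / t j ∈ A := by
  let V : ValuationSubring K := { A.toSubring with mem_or_inv_mem' := hv }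
  obtain ⟨j, hj⟩ := Finite.exists_max (fun i => V.valuation (t i))
  have h0 : t j ≠ 0 := by
    intro h0
    apply ht
    ext i
    have := hj i
    rw [h0, map_zero, le_zero_iff] at this
    simpa using this
  refine ⟨j, h0, fun i => ?_⟩
  change t i / t j ∈ V
  rw [← V.valuation_le_one_iff, map_div₀]
  exact div_le_one_of_le₀ (hj i) zero_le

-- Dividing by the coordinate of largest valuation makes all coordinates integral and one of them
-- equal to 1, which is what makes the line a direct summand.
include hK in
lemma exists_primitive (hv : ∀ z : K, z ∈ A ∨ z⁻¹ ∈ A) {g : K} (hg : IsSeparableMorphism k g)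
    {f : K} (hf : IsSeparableMorphism k f) :
    ∃ t : Fin 3 → K, (∀ i, t i ∈ A) ∧ (∃ j, t j = 1) ∧ FourthPowerAffine f (coordSum g t) := by
  obtain ⟨f₀, f₁, f₂, f₃, e⟩ := hK.exists_coords hg f
  have hne : ![f₁, f₂, f₃] ≠ 0 := by
    intro h
    apply (isSeparable_iff_coords hg e).1 hf
    have h1 := congrFun h 0
    have h3 := congrFun h 2
    simp at h1 h3
    simp [h1, h3]
  obtain ⟨j, hj, h⟩ := exists_dominating hv _ hne
  set c := ![f₁, f₂, f₃] j
  refine ⟨fun i => ![f₁, f₂, f₃] i / c, h, ⟨j, div_self hj⟩, c⁻¹, c⁻¹ * f₀, inv_ne_zero hj, ?_⟩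
  rw [e]
  simp only [coordSum, Matrix.cons_val_zero, Matrix.cons_val_one, Matrix.cons_val]
  field_simp
  linear_combination -f₀ ^ 4 * two_eq_zero' (K := K)

include hK in
/-- The line spanned by a function with unimodular coordinates is a direct summand. -/
theorem lineStalk_eq_span (hv : ∀ z : K, z ∈ A ∨ z⁻¹ ∈ A) {g : A} (hg : GeneratesB A g)
    {t : Fin 3 → A} {j : Fin 3} (hj : t j = 1) :
    lineStalk A ((coordSum g t : A) : K) = Submodule.span _ {frobMk k (coordSum g t)} ∧
      frobMk k (coordSum g t) ≠ 0 ∧ IsComplemented (lineStalk A ((coordSum g t : A) : K)) := by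
  have hgs := hg.isSeparable hK hv
  have cinj : ∀ {w w' : A} {s s' : Fin 3 → A},
      coordSum g s + w ^ 4 = coordSum g s' + w' ^ 4 → s = s' ∧ w = w' := by
    intro w w' s s' h
    have h := congrArg (Subtype.val : A → K) h
    simp only [AddMemClass.coe_add, SubmonoidClass.coe_pow, coe_coordSum] at h
    obtain ⟨h1, h2⟩ := coordSum_injective hgs h
    exact ⟨funext fun i => Subtype.ext (congrFun h1 i), Subtype.ext h2⟩
  have smul_cs : ∀ (c : A) (s : Fin 3 → A), c ^ 4 * coordSum g s = coordSum g (fun i => c * s i) :=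
    fun c s => by simp only [coordSum]; ring
  have add_cs : ∀ (s s' : Fin 3 → A), coordSum g (s + s') = coordSum g s + coordSum g s' := by
    intro s s'
    apply Subtype.ext
    rw [AddMemClass.coe_add, coe_coordSum, coe_coordSum, coe_coordSum, ← coordSum_add]
    rfl
  have exists_cs : ∀ h : A, ∃ (s : Fin 3 → A) (w : A), h = coordSum g s + w ^ 4 := by
    intro h
    obtain ⟨f₀, h0, f₁, h1, f₂, h2, f₃, h3, e⟩ := hg.exists_coords hK hv h.2
    refine ⟨![⟨f₁, h1⟩, ⟨f₂, h2⟩, ⟨f₃, h3⟩], ⟨f₀, h0⟩, Subtype.ext ?_⟩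
    rw [e]
    simp [coordSum]
    ring
  have hspan : lineStalk A ((coordSum g t : A) : K) = Submodule.span _ {frobMk k (coordSum g t)} := by
    ext ε
    obtain ⟨e, rfl⟩ := frobMk_surjective ε
    rw [frobMk_mem_lineStalk hK, mem_span_frobMk hK.sqrt]
    constructor
    · rintro ⟨c, w, h⟩
      have h' : c ^ 4 * ((coordSum g t : A) : K) + w ^ 4 = w ^ 4 + (c * t 0) ^ 4 * g +
          (c * t 1) ^ 4 * (g : K) ^ 2 + (c * t 2) ^ 4 * (g : K) ^ 3 := by
        simp [coordSum]; ring
      obtain ⟨m0, m1, m2, m3⟩ := hg.coords_mem hK hv (by rw [← h', ← h]; exact e.2)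
      -- The coordinate of index `j` is `c` itself, because `t j = 1`.
      have hc : c * t j ∈ A := by fin_cases j <;> assumption
      rw [hj, OneMemClass.coe_one, mul_one] at hc
      exact ⟨⟨c, hc⟩, ⟨w, m0⟩, Subtype.ext h⟩
    · rintro ⟨s, w, rfl⟩
      exact ⟨s, w, rfl⟩
  refine ⟨hspan, ?_, ?_⟩
  · intro h0
    obtain ⟨s, hs⟩ := (frobMk_eq_zero_iff hK.sqrt).1 h0
    have := (cinj (w := 0) (s' := 0) (w' := s) (by rw [hs]; simp [coordSum])).1
    rw [this] at hj
    exact zero_ne_one hj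
  · rw [hspan]
    -- The complement consists of the classes whose coordinate of index `j` vanishes.
    let N : Submodule (frobRing k A) (FrobQuot k A) :=
      { carrier := {ε | ∃ s : Fin 3 → A, s j = 0 ∧ ε = frobMk k (coordSum g s)}
        zero_mem' := ⟨0, rfl, by simp [coordSum]⟩
        add_mem' := by
          rintro _ _ ⟨s, hs, rfl⟩ ⟨s', hs', rfl⟩
          exact ⟨s + s', by simp [hs, hs'], by rw [add_cs, map_add]⟩
        smul_mem' := by
          rintro r _ ⟨s, hs, rfl⟩
          obtain ⟨c, -, hc⟩ := smul_frobMk hK.sqrt r (coordSum g s)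
          exact ⟨fun i => c * s i, by simp [hs], by rw [hc, smul_cs]⟩ }
    refine ⟨N, ?_, ?_⟩
    · rw [Submodule.disjoint_def]
      rintro _ hx ⟨s, hs, rfl⟩
      obtain ⟨c, w, h⟩ := (mem_span_frobMk hK.sqrt).1 hx
      rw [smul_cs] at h
      obtain ⟨h1, -⟩ := cinj (w := 0) (w' := w) (by simpa using h)
      have : c = 0 := by
        have := congrFun h1 j
        simp only [hs, hj, mul_one] at this
        exact this.symm
      rw [h1, this]
      simp [coordSum]
    · rw [codisjoint_iff, eq_top_iff]
      rintro ε -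
      obtain ⟨h, rfl⟩ := frobMk_surjective ε
      obtain ⟨s, w, rfl⟩ := exists_cs h
      rw [Submodule.mem_sup]
      refine ⟨frobMk k (s j ^ 4 * coordSum g t), (mem_span_frobMk hK.sqrt).2 ⟨s j, 0, by simp⟩,
        frobMk k (coordSum g (s - fun i => s j * t i)), ⟨_, by simp [hj], rfl⟩, ?_⟩
      rw [← map_add, smul_cs, ← add_cs, eq_comm, frobMk_eq_iff hK.sqrt]
      exact ⟨w, by simp⟩

-- With denominators cleared, the symbol condition is the conic equation for the coordinates of `f`.
-- It is homogeneous, so it persists for c⁴f + w⁴.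
include hK in
theorem mem_conicCone_of_mem_lineStalk (hv : ∀ z : K, z ∈ A ∨ z⁻¹ ∈ A) {f : K}
    (hf : IsSeparableMorphism k f) {g b : A} (hg : GeneratesB A g)
    (h : symbol k f (g : K) = (b : K) ^ 2 • KaehlerDifferential.D k K (g : K))
    {ε : FrobQuot k A} (hε : ε ∈ lineStalk A f) : ε ∈ conicCone A g b := by
  have hgs := hg.isSeparable hK hv
  obtain ⟨e, rfl⟩ := frobMk_surjective ε
  obtain ⟨c, w, he⟩ := (frobMk_mem_lineStalk hK).1 hε
  obtain ⟨f₀, f₁, f₂, f₃, ef⟩ := hK.exists_coords hgs f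
  have hden := (isSeparable_iff_coords hgs ef).1 hf
  rw [symbol_eq hgs ef] at h
  have h := sq_smul_D_injective hgs h
  rw [div_eq_iff hden] at h
  have he' : (e : K) = (c * f₀ + w) ^ 4 + (c * f₁) ^ 4 * g + (c * f₂) ^ 4 * (g : K) ^ 2 +
      (c * f₃) ^ 4 * (g : K) ^ 3 := by
    rw [he, ef, add_pow_four]; ring
  obtain ⟨m0, m1, m2, m3⟩ := hg.coords_mem hK hv (he' ▸ e.2)
  refine ⟨⟨_, m1⟩, ⟨_, m2⟩, ⟨_, m3⟩, ?_, ?_⟩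
  · rw [frobMk_eq_iff hK.sqrt]
    refine ⟨⟨_, m0⟩, Subtype.ext ?_⟩
    rw [he']
    simp only [AddMemClass.coe_add, MulMemClass.coe_mul, SubmonoidClass.coe_pow]
    ring
  · apply Subtype.ext
    simp only [AddMemClass.coe_add, MulMemClass.coe_mul, SubmonoidClass.coe_pow,
      ZeroMemClass.coe_zero]
    linear_combination c ^ 2 * h + b * c ^ 2 * (f₁ ^ 2 + f₃ ^ 2 * g) * two_eq_zero' (K := K)

-- Division by t₁² + g t₃² is harmless: its vanishing forces t₁ = t₃ = 0, then t₂ = 0 by the conic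
-- equation, and the class would be zero.
include hK in
theorem symbol_eq_of_mem_conicCone {g b e : A} (hg : IsSeparableMorphism k (g : K))
    (h0 : frobMk k e ≠ 0) (h : frobMk k e ∈ conicCone A g b) :
    IsSeparableMorphism k (e : K) ∧
      symbol k (e : K) (g : K) = (b : K) ^ 2 • KaehlerDifferential.D k K (g : K) := by
  obtain ⟨t₁, t₂, t₃, h1, h2⟩ := h
  obtain ⟨s, hs⟩ := (frobMk_eq_iff hK.sqrt).1 h1
  have he : (e : K) = (s : K) ^ 4 + (t₁ : K) ^ 4 * g + (t₂ : K) ^ 4 * (g : K) ^ 2 +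
      (t₃ : K) ^ 4 * (g : K) ^ 3 := by
    rw [hs]
    simp only [AddMemClass.coe_add, MulMemClass.coe_mul, SubmonoidClass.coe_pow]
    ring
  have h2 := congrArg (Subtype.val : A → K) h2
  simp only [AddMemClass.coe_add, MulMemClass.coe_mul, SubmonoidClass.coe_pow,
      ZeroMemClass.coe_zero] at h2
  have hsep : IsSeparableMorphism k (e : K) := by
    rw [isSeparable_iff_coords hg he]
    intro hd
    obtain ⟨h3, h4⟩ := (sq_add_sq_mul_ne_zero hg).1 hd
    have h5 : (t₂ : K) = 0 := by
      rw [h3, h4] at h2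
      simpa using h2
    apply h0
    rw [frobMk_eq_zero_iff hK.sqrt]
    exact ⟨s, Subtype.ext (by rw [he, h3, h4, h5]; simp)⟩
  refine ⟨hsep, ?_⟩
  rw [symbol_eq hg he]
  congr 2
  rw [div_eq_iff ((isSeparable_iff_coords hg he).1 hsep)]
  linear_combination h2 - b * (t₁ ^ 2 + t₃ ^ 2 * g : K) * two_eq_zero' (K := K)

include hK in
/-- A direct summand of rank one is determined by its generic fibre. -/
theorem span_eq_lineStalk (hv : ∀ z : K, z ∈ A ∨ z⁻¹ ∈ A) {e : A} (h0 : frobMk k e ≠ 0)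
    (hc : IsComplemented (Submodule.span (frobRing k A) {frobMk k e})) {f : K}
    (hf : FourthPowerAffine (e : K) f) :
    Submodule.span (frobRing k A) {frobMk k e} = lineStalk A f := by
  rw [← lineStalk_affine hK hf]
  ext ε
  obtain ⟨h, rfl⟩ := frobMk_surjective ε
  rw [frobMk_mem_lineStalk hK, mem_span_frobMk hK.sqrt]
  constructor
  · rintro ⟨s, w, rfl⟩
    exact ⟨s, w, rfl⟩
  rintro ⟨c, w, hcw⟩
  rcases eq_or_ne c 0 with rfl | hc0
  · refine ⟨0, ⟨w, mem_of_pow_four_mem hv ?_⟩, Subtype.ext (by simpa using hcw)⟩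
    have : w ^ 4 = h := by simpa using hcw.symm
    rw [this]
    exact h.2
  by_cases hcA : c ∈ A
  · refine ⟨⟨c, hcA⟩, ⟨w, mem_of_pow_four_mem hv ?_⟩, Subtype.ext hcw⟩
    have : w ^ 4 = h - c ^ 4 * e := by rw [hcw]; ring
    rw [this]
    exact A.sub_mem h.2 (A.mul_mem (A.pow_mem hcA 4) e.2)
  -- If `c` is not integral, the class of `e` is s⁴ times that of `h` with s = c⁻¹ a nonunit.
  -- Projecting `h` to the summand gives r times the class of `e`, so (1 - s⁴r) kills that class;
  -- but 1 - s⁴r is a unit.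
  exfalso
  have hc' := (hv c).resolve_left hcA
  have : IsLocalRing A := isLocalRing_of_mem_or_inv_mem hv
  set s : A := ⟨c⁻¹, hc'⟩
  have hs : s ∈ nonunits A := by
    intro hu
    exact hcA (by simpa [s] using (IsUniformizer.isUnit_iff _).1 hu |>.2)
  have hw : c⁻¹ * w ∈ A := by
    refine mem_of_pow_four_mem hv ?_
    have : (c⁻¹ * w) ^ 4 = c⁻¹ ^ 4 * h - e := by rw [hcw]; field_simp; ring
    rw [this]
    exact A.sub_mem (A.mul_mem (A.pow_mem hc' 4) h.2) e.2
  have he : frobMk k e = frobMk k (s ^ 4 * h) := by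
    rw [frobMk_eq_iff hK.sqrt]
    refine ⟨⟨_, hw⟩, Subtype.ext ?_⟩
    simp only [AddMemClass.coe_add, MulMemClass.coe_mul, SubmonoidClass.coe_pow, s]
    rw [hcw]
    field_simp
    linear_combination -w ^ 4 * two_eq_zero' (K := K)
  obtain ⟨N, hN⟩ := hc
  obtain ⟨x, hx, y, hy, hxy⟩ := Submodule.mem_sup.1
    (hN.sup_eq_top ▸ Submodule.mem_top : frobMk k h ∈ Submodule.span _ {frobMk k e} ⊔ N)
  obtain ⟨r, rfl⟩ := Submodule.mem_span_singleton.1 hx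
  obtain ⟨q, hq, -⟩ := smul_frobMk hK.sqrt r e
  set σ : frobRing k A := ⟨s ^ 4, pow_four_mem_frobRing s⟩
  have h1 : (1 - σ * r) • frobMk k e = σ • y := by
    rw [sub_smul, one_smul, sub_eq_iff_eq_add', mul_smul, ← smul_add, hxy, he, frobMk_pow_four_mul]
  have h2 : (1 - σ * r) • frobMk k e = 0 := by
    refine Submodule.disjoint_def.1 hN.disjoint _ ?_ ?_
    · exact Submodule.smul_mem _ _ (Submodule.mem_span_singleton_self _)
    · rw [h1]; exact Submodule.smul_mem _ _ hy
  have h3 : IsUnit (1 - s * q) := by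
    rcases IsLocalRing.isUnit_or_isUnit_of_add_one (sub_add_cancel 1 (s * q)) with h | h
    · exact h
    · exact absurd (isUnit_of_mul_isUnit_left h) hs
  obtain ⟨v, hv'⟩ := h3.exists_left_inv
  have h4 : (⟨v ^ 4, pow_four_mem_frobRing v⟩ : frobRing k A) * (1 - σ * r) = 1 := by
    apply Subtype.ext
    change v ^ 4 * (1 - s ^ 4 * (r : A)) = 1
    have h5 : (1 - s * q) ^ 4 = 1 - s ^ 4 * q ^ 4 := by
      rw [← mul_pow, ← one_pow (M := A) 4]
      simpa using sub_pow_char_pow (p := 2) (n := 2) (1 : A) (s * q)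
    rw [hq, ← h5, ← mul_pow, hv', one_pow]
  apply h0
  rw [← one_smul (frobRing k A) (frobMk k e), ← h4, mul_smul, h2, smul_zero]

end Lines

/-! ### Consequences of a cyclic module of differentials. -/

section Kaehler

open scoped TensorProduct

lemma span_kaehler_of_isLocalization {k R S : Type u} [CommRing k] [CommRing R] [CommRing S]
    [Algebra k R] [Algebra k S] [Algebra R S] [IsScalarTower k R S] (M : Submonoid R)
    [IsLocalization M S] {ω : Ω[R⁄k]} (hω : Submodule.span R {ω} = ⊤) :
    Submodule.span S {KaehlerDifferential.map k k R S ω} = ⊤ := by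
  have := span_eq_top_of_isLocalizedModule S M (KaehlerDifferential.map k k R S) (v := {ω}) hω
  rwa [Set.image_singleton] at this

/-- A local domain with cyclic module of differentials over a perfect field is a principal ideal
domain. -/
theorem isPrincipalIdealRing_of_kaehler {k A : Type u} [Field k] [PerfectField k] [CommRing A]
    [Algebra k A] [IsLocalRing A] [IsNoetherianRing A] [IsDomain A] [Algebra.EssFiniteType k A]
    [Algebra.FormallySmooth k A] {ω : Ω[A⁄k]} (hω : Submodule.span A {ω} = ⊤) :
    IsPrincipalIdealRing A := by
  let κ := IsLocalRing.ResidueField A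
  have hs : Function.Surjective (algebraMap A κ) := IsLocalRing.residue_surjective
  have : Algebra.EssFiniteType k κ := .comp k A κ
  have : Algebra.FormallySmooth k κ := inferInstance
  -- The residue field is formally smooth over the perfect field k, so the conormal map from the
  -- cotangent space to κ ⊗ Ω splits. The cotangent space is thus a quotient of a cyclic module, and
  -- Nakayama's lemma applies.
  obtain ⟨l, hl⟩ := (Algebra.FormallySmooth.iff_split_injection (R := k) hs).1 this
  let I := RingHom.ker (algebraMap A κ)
  have hI : I = IsLocalRing.maximalIdeal A := IsLocalRing.ker_residue
  have hgen : ∀ x : κ ⊗[A] Ω[A⁄k], ∃ a : A, x = a • ((1 : κ) ⊗ₜ[A] ω) := by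
    intro x
    induction x with
    | zero => exact ⟨0, by simp⟩
    | tmul c η =>
      obtain ⟨c, rfl⟩ := hs c
      obtain ⟨b, rfl⟩ := Submodule.mem_span_singleton.1 (hω ▸ Submodule.mem_top : η ∈ _)
      refine ⟨c * b, ?_⟩
      rw [mul_smul, ← TensorProduct.tmul_smul b, TensorProduct.smul_tmul', Algebra.smul_def c,
        mul_one]
    | add x y hx hy =>
      obtain ⟨a, rfl⟩ := hx
      obtain ⟨b, rfl⟩ := hy
      exact ⟨a + b, (add_smul _ _ _).symm⟩
  obtain ⟨y, hy⟩ := I.toCotangent_surjective (l ((1 : κ) ⊗ₜ[A] ω))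
  have hle : I ≤ Ideal.span {(y : A)} ⊔ I * I := by
    intro x hx
    obtain ⟨a, ha⟩ := hgen (KaehlerDifferential.kerCotangentToTensor k A κ (I.toCotangent ⟨x, hx⟩))
    have h1 := congrArg l ha
    rw [map_smul, ← hy, ← LinearMap.comp_apply, hl, LinearMap.id_apply, ← map_smul,
      Ideal.toCotangent_eq] at h1
    rw [← sub_add_cancel x (a * y), add_comm]
    refine Submodule.add_mem_sup (Ideal.mul_mem_left _ _ (Ideal.mem_span_singleton_self _)) ?_
    rw [← pow_two]
    exact h1
  have hprinc : I = Ideal.span {(y : A)} := by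
    refine le_antisymm ?_ ((Ideal.span_singleton_le_iff_mem _).2 y.2)
    refine Submodule.le_of_le_smul_of_le_jacobson_bot (I := I) (IsNoetherian.noetherian I) ?_ hle
    rw [IsLocalRing.jacobson_eq_maximalIdeal _ bot_ne_top, hI]
  refine ((tfae_of_isNoetherianRing_of_isLocalRing_of_isDomain A).out 0 4).2 ?_
  rw [← hI, hprinc]
  exact ⟨⟨_, rfl⟩⟩

section CurveField

variable {k K : Type u} [Field k] [Field K] [Algebra k K]

/-- Adjoining a function with nonzero differential generates the field up to a finite separable
extension. -/
lemma isSeparable_of_generates [Algebra.EssFiniteType k K] {ω : Ω[K⁄k]}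
    (hω : Submodule.span K {ω} = ⊤) {g : K} (hg : IsSeparableMorphism k g)
    (E : IntermediateField k K) (hE : g ∈ E) :
    Algebra.IsSeparable E K ∧ Module.Finite E K := by
  have hspan : ∀ η : Ω[K⁄k], ∃ c : K, η = c • KaehlerDifferential.D k K g := by
    intro η
    obtain ⟨b, hb⟩ := Submodule.mem_span_singleton.1
      (hω ▸ Submodule.mem_top : KaehlerDifferential.D k K g ∈ _)
    obtain ⟨a, rfl⟩ := Submodule.mem_span_singleton.1 (hω ▸ Submodule.mem_top : η ∈ _)
    have hb0 : b ≠ 0 := by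
      rintro rfl
      exact hg (by rw [← hb, zero_smul])
    exact ⟨a / b, by rw [← hb, smul_smul, div_mul_cancel₀ _ hb0]⟩
  -- Every differential is a multiple of dg, and dg vanishes over E; so the extension is unramified.
  have hsub : Subsingleton (Ω[K⁄E]) := by
    refine subsingleton_of_forall_eq 0 fun x => ?_
    obtain ⟨η, rfl⟩ := KaehlerDifferential.map_surjective k E K x
    obtain ⟨c, rfl⟩ := hspan η
    rw [map_smul, KaehlerDifferential.map_D, Algebra.algebraMap_self_apply]
    have : KaehlerDifferential.D E K g = 0 :=
      (KaehlerDifferential.D E K).map_algebraMap (⟨g, hE⟩ : E)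
    rw [this, smul_zero]
  have : Algebra.FormallyUnramified E K := ⟨hsub⟩
  have : Algebra.EssFiniteType E K := Algebra.EssFiniteType.of_comp k E K
  exact ⟨Algebra.FormallyUnramified.isSeparable E K, Algebra.FormallyUnramified.finite_of_free E K⟩

theorem isCurveField_of_kaehler [CharP k 2] [PerfectField k] [CharP K 2]
    [Algebra.EssFiniteType k K] [Nontrivial (Ω[K⁄k])] {ω : Ω[K⁄k]}
    (hω : Submodule.span K {ω} = ⊤) : IsCurveField k K where
  sqrt c := by
    have := PerfectField.toPerfectRing (K := k) 2
    obtain ⟨e, he⟩ := surjective_frobenius k 2 c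
    exact ⟨e, he⟩
  exists_separable := by
    by_contra! H
    have h0 := KaehlerDifferential.span_range_derivation k K
    have : Set.range (KaehlerDifferential.D k K) ⊆ {0} := by
      rintro _ ⟨g, rfl⟩
      by_contra h
      exact H g h
    have h1 := Submodule.span_mono (R := K) this
    rw [h0, Submodule.span_zero_singleton, top_le_iff] at h1
    exact bot_ne_top h1
  decomp g hg := by
    have h2 := two_eq_zero' (K := K)
    -- K is separable over E = k(g, K²) because g ∈ E, and purely inseparable because K² ⊆ E; hence
    -- E = K. It remains to see that the elements a² + b²g are closed under the field operations.
    let E := IntermediateField.adjoin k (insert g (Set.range fun z : K => z ^ 2))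
    have hsq : ∀ z : K, z ^ 2 ∈ E := fun z =>
      IntermediateField.subset_adjoin _ _ (.inr ⟨z, rfl⟩)
    obtain ⟨h3, -⟩ := isSeparable_of_generates hω hg E
      (IntermediateField.subset_adjoin _ _ (.inl rfl))
    have : IsPurelyInseparable E K := by
      have : CharP E 2 := (algebraMap E K).charP (algebraMap E K).injective 2
      rw [isPurelyInseparable_iff_pow_mem E 2]
      exact fun z => ⟨1, ⟨z ^ 2, hsq z⟩, by simp⟩
    intro f
    obtain ⟨f, rfl⟩ := IsPurelyInseparable.surjective_algebraMap_of_isSeparable E K f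
    obtain ⟨f, hf⟩ := f
    change ∃ a b : K, f = a ^ 2 + b ^ 2 * g
    induction hf using IntermediateField.adjoin_induction with
    | mem x hx =>
      rcases hx with rfl | ⟨z, rfl⟩
      · exact ⟨0, 1, by simp⟩
      · exact ⟨z, 0, by simp⟩
    | algebraMap c =>
      have := PerfectField.toPerfectRing (K := k) 2
      obtain ⟨e, rfl⟩ := surjective_frobenius k 2 c
      exact ⟨algebraMap k K e, 0, by simp [frobenius_def]⟩
    | add x y _ _ hx hy =>
      obtain ⟨a, b, rfl⟩ := hx
      obtain ⟨a', b', rfl⟩ := hy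
      exact ⟨a + a', b + b', by linear_combination -(a * a' + b * b' * g) * h2⟩
    | inv x _ hx =>
      rcases eq_or_ne x 0 with rfl | h0
      · exact ⟨0, 0, by simp⟩
      obtain ⟨a, b, e⟩ := hx
      refine ⟨a * x⁻¹, b * x⁻¹, ?_⟩
      -- An inverse is the element itself times a square.
      calc x⁻¹ = x * x⁻¹ ^ 2 := by field_simp
        _ = (a ^ 2 + b ^ 2 * g) * x⁻¹ ^ 2 := by rw [← e]
        _ = _ := by ring
    | mul x y _ _ hx hy =>
      obtain ⟨a, b, rfl⟩ := hx
      obtain ⟨a', b', rfl⟩ := hy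
      exact ⟨a * a' + b * b' * g, a * b' + a' * b,
        by linear_combination -(2 * a * a' * b * b' * g) * h2⟩
  isAlgebraic g hg := by
    obtain ⟨h1, -⟩ := isSeparable_of_generates hω hg (IntermediateField.adjoin k {g})
      (IntermediateField.mem_adjoin_simple_self k g)
    open scoped IntermediateField.algebraAdjoinAdjoin in
    exact Algebra.IsAlgebraic.trans (Algebra.adjoin k {g}) (IntermediateField.adjoin k {g}) K
  finite g hg := (isSeparable_of_generates hω hg (IntermediateField.adjoin k {g})
      (IntermediateField.mem_adjoin_simple_self k g)).2

end CurveField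

section Chart

variable {k R : Type u} [Field k] [PerfectField k] [CommRing R] [IsDomain R] [Algebra k R]
  [Algebra.IsStandardSmoothOfRelativeDimension 1 k R]

omit [PerfectField k] in
variable (k R) in
lemma exists_span_kaehler : ∃ ω : Ω[R⁄k], Submodule.span R {ω} = ⊤ ∧
    ∀ c : R, c • ω = 0 → c = 0 := by
  have := Algebra.IsStandardSmoothOfRelativeDimension.isStandardSmooth 1 (R := k) (S := R)
  have h1 := Algebra.IsStandardSmoothOfRelativeDimension.rank_kaehlerDifferential (R := k) (S := R) 1
  have h2 : Module.finrank R Ω[R⁄k] = 1 :=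
    Module.finrank_eq_of_rank_eq (by simpa using h1)
  have b : Module.Basis Unit R Ω[R⁄k] := Module.basisUnique Unit h2
  refine ⟨b (), ?_, fun c hc => ?_⟩
  · rw [← b.span_eq]
    congr
    ext x; exact ⟨fun h => ⟨(), h.symm⟩, fun ⟨_, h⟩ => h.symm⟩
  · simpa using congrArg (fun x => b.repr x ()) hc

omit [PerfectField k] [IsDomain R] in
variable (k R) in
lemma finiteType_of_chart : Algebra.FiniteType k R := by
  have := Algebra.IsStandardSmoothOfRelativeDimension.isStandardSmooth 1 (R := k) (S := R)
  infer_instance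

omit [PerfectField k] in
lemma nontrivial_kaehler_of_chart {K : Type u} [Field K] [Algebra k K] [Algebra R K]
    [IsScalarTower k R K] [IsFractionRing R K] : Nontrivial (Ω[K⁄k]) := by
  obtain ⟨ω, -, h0⟩ := exists_span_kaehler k R
  refine ⟨KaehlerDifferential.map k k R K ω, 0, fun h => ?_⟩
  rw [IsLocalizedModule.eq_zero_iff (nonZeroDivisors R)] at h
  obtain ⟨c, hc⟩ := h
  exact nonZeroDivisors.ne_zero c.2 (h0 c hc)

theorem isCurveField_of_chart [CharP k 2] {K : Type u} [Field K] [Algebra k K] [Algebra R K]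
    [IsScalarTower k R K] [IsFractionRing R K] [CharP K 2] : IsCurveField k K := by
  obtain ⟨ω, hω, -⟩ := exists_span_kaehler k R
  have := finiteType_of_chart k R
  have : Algebra.EssFiniteType R K := .of_isLocalization _ (nonZeroDivisors R)
  have : Algebra.EssFiniteType k K := .comp k R K
  have := nontrivial_kaehler_of_chart (k := k) (R := R) (K := K)
  exact isCurveField_of_kaehler (span_kaehler_of_isLocalization (nonZeroDivisors R) hω)

theorem isPrincipalIdealRing_of_chart (p : Ideal R) [p.IsPrime] (A : Type u) [CommRing A]
    [Algebra k A] [Algebra R A] [IsScalarTower k R A] [IsLocalization.AtPrime A p] :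
    IsPrincipalIdealRing A := by
  obtain ⟨ω, hω, -⟩ := exists_span_kaehler k R
  have := Algebra.IsStandardSmoothOfRelativeDimension.isStandardSmooth 1 (R := k) (S := R)
  have : Algebra.EssFiniteType R A := .of_isLocalization _ p.primeCompl
  have : Algebra.EssFiniteType k A := .comp k R A
  have : Algebra.FormallySmooth R A := .of_isLocalization p.primeCompl
  have : Algebra.FormallySmooth k A := .comp k R A
  have : IsNoetherianRing R := Algebra.FiniteType.isNoetherianRing k R
  have : IsNoetherianRing A := IsLocalization.isNoetherianRing p.primeCompl A ‹_›
  have : IsLocalRing A := IsLocalization.AtPrime.isLocalRing A p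
  have : IsDomain A := IsLocalization.isDomain_of_le_nonZeroDivisors A p.primeCompl_le_nonZeroDivisors
  exact isPrincipalIdealRing_of_kaehler (span_kaehler_of_isLocalization p.primeCompl hω)

-- The localizations at nonzero primes are discrete valuation rings, so the chart is a Dedekind
-- domain.
variable (k) in
include k in
lemma isMaximal_of_chart {p : Ideal R} [hp : p.IsPrime] (h0 : p ≠ ⊥) : p.IsMaximal := by
  have := finiteType_of_chart k R
  have : IsNoetherianRing R := Algebra.FiniteType.isNoetherianRing k R
  have : IsDedekindDomainDvr R :=
    { is_dvr_at_nonzero_prime := fun P hP hPp => by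
        have := hPp
        have := isPrincipalIdealRing_of_chart (k := k) P (Localization.AtPrime P)
        exact { not_a_field' := fun h => IsLocalization.AtPrime.not_isField R hP
                  (Localization.AtPrime P) (IsLocalRing.isField_iff_maximalIdeal_eq.2 h) } }
  exact hp.isMaximal h0

-- By the Nullstellensatz such a field is finite over k, hence separable as k is perfect, and has no
-- differentials; but their rank is one.
omit [IsDomain R] in
variable (k R) in
include k in
lemma not_isField_of_chart : ¬ IsField R := by
  intro h
  have : IsDomain R := h.isDomain
  let := h.toField
  have := finiteType_of_chart k R
  have := finite_of_finite_type_of_isJacobsonRing k R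
  have : Algebra.FormallyUnramified k R := Algebra.FormallyUnramified.of_isSeparable k R
  obtain ⟨ω, -, h0⟩ := exists_span_kaehler k R
  exact one_ne_zero (h0 1 (Subsingleton.elim _ _))

end Chart

end Kaehler

/-! ### Affine charts of the curve. -/

section Sections

variable {k : Type u} [Field k] {X : Scheme.{u}} (π : X ⟶ Spec (CommRingCat.of k))

/-- The ring of sections over `V`, as a `k`-algebra. -/
def Sections (_π : X ⟶ Spec (CommRingCat.of k)) (V : X.Opens) : Type u := Γ(X, V)

variable (V : X.Opens)

noncomputable instance : CommRing (Sections π V) := inferInstanceAs (CommRing Γ(X, V))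

noncomputable instance : Algebra k (Sections π V) :=
  RingHom.toAlgebra (S := Γ(X, V)) ((X.presheaf.map (homOfLE le_top).op).hom.comp (constants π))

instance [IsIntegral X] [Nonempty V] : IsDomain (Sections π V) :=
  inferInstanceAs (IsDomain Γ(X, V))

noncomputable instance [IsIntegral X] [Nonempty V] : Algebra (Sections π V) (FunctionField π) :=
  inferInstanceAs (Algebra Γ(X, V) X.functionField)

instance [IsIntegral X] [Nonempty V] : IsScalarTower k (Sections π V) (FunctionField π) := by
  refine IsScalarTower.of_algebraMap_eq fun c => ?_
  exact (X.presheaf.germ_res_apply (homOfLE le_top) _ _ (constants π c)).symm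

theorem exists_chart [SmoothOfRelativeDimension 1 π] (x : X) : ∃ V : X.Opens, x ∈ V ∧
    IsAffineOpen V ∧ Algebra.IsStandardSmoothOfRelativeDimension 1 k (Sections π V) := by
  obtain ⟨U, hU, V, hV, hx, e, H⟩ :=
    SmoothOfRelativeDimension.exists_isStandardSmoothOfRelativeDimension (n := 1) (f := π) x
  have hxU : π x ∈ U := e hx
  have : Subsingleton (Spec (CommRingCat.of k)) :=
    inferInstanceAs (Subsingleton (PrimeSpectrum k))
  obtain rfl : U = ⊤ := by
    refine top_le_iff.1 fun y _ => ?_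
    rwa [Subsingleton.elim y (π x)]
  refine ⟨V, hx, hV, ?_⟩
  have h2 := RingHom.isStandardSmoothOfRelativeDimension_respectsIso.2 _
    (Scheme.ΓSpecIso (CommRingCat.of k)).commRingCatIsoToRingEquiv.symm H
  exact h2

end Sections

-- Local rings are now compared with localizations of chart rings inside the function field.
section Points

variable {k : Type u} [Field k] {X : Scheme.{u}} [IsIntegral X]
  (π : X ⟶ Spec (CommRingCat.of k))

lemma mem_localRing_iff {x : X} {z : FunctionField π} :
    z ∈ localRing π x ↔ ∃ s : X.presheaf.stalk x, stalkMap π x s = z := Iff.rfl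

lemma localRing_genericPoint : localRing π (genericPoint X) = ⊤ := by
  refine top_le_iff.1 fun z _ => ?_
  refine ⟨z, ?_⟩
  change (X.presheaf.stalkSpecializes _).hom z = z
  rw [TopCat.Presheaf.stalkSpecializes_refl]
  rfl

lemma eq_genericPoint_of_primeIdealOf {V : X.Opens} (hV : IsAffineOpen V) {x : X} (hx : x ∈ V)
    (h : (hV.primeIdealOf ⟨x, hx⟩).asIdeal = ⊥) : x = genericPoint X := by
  have : Nonempty V := ⟨⟨_, hx⟩⟩
  have h1 : hV.primeIdealOf ⟨x, hx⟩ = hV.primeIdealOf ⟨genericPoint X,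
      ((genericPoint_spec X).mem_open_set_iff V.isOpen).mpr (by simpa using this)⟩ := by
    rw [hV.primeIdealOf_genericPoint, genericPoint_eq_bot_of_affine]
    exact PrimeSpectrum.ext h
  have h2 := congrArg hV.fromSpec h1
  rwa [hV.fromSpec_primeIdealOf, hV.fromSpec_primeIdealOf] at h2

/-- The prime ideal of a point of an affine open subset. -/
lemma exists_prime {V : X.Opens} (hV : IsAffineOpen V) {x : X} (hx : x ∈ V) [Nonempty V] :
    ∃ p : Ideal (Sections π V), p.IsPrime ∧
      (IsClosed ({x} : Set X) → p.IsMaximal) ∧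
      (∀ z : FunctionField π, z ∈ localRing π x ↔ ∃ r s : Sections π V, s ∉ p ∧
        z * algebraMap _ _ s = algebraMap _ _ r) ∧
      ∀ [Algebra.IsStandardSmoothOfRelativeDimension 1 k (Sections π V)] [PerfectField k],
        IsPrincipalIdealRing (localRing π x) := by
  let R := Sections π V
  let p : PrimeSpectrum R := hV.primeIdealOf ⟨x, hx⟩
  let S : Type u := X.presheaf.stalk x
  let _ : Algebra R S := X.presheaf.algebra_section_stalk ⟨x, hx⟩
  have : IsLocalization.AtPrime S p.asIdeal := hV.isLocalization_stalk ⟨x, hx⟩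
  have htower : ∀ r : R, stalkMap π x (algebraMap R S r) = algebraMap R (FunctionField π) r := fun r =>
    Scheme.algebraMap_germ_eq_germToFunctionField (X := X) (U := V) (x := x) hx r
  refine ⟨p.asIdeal, p.2, hV.primeIdealOf_isMaximal_of_isClosed ⟨x, hx⟩, fun z => ?_, ?_⟩
  · rw [mem_localRing_iff]
    constructor
    · rintro ⟨s, rfl⟩
      obtain ⟨⟨r, s', hs⟩, h⟩ := IsLocalization.surj (S := S) p.asIdeal.primeCompl s
      refine ⟨r, s', hs, ?_⟩
      erw [← htower, ← htower, ← map_mul]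
      exact congrArg _ h
    · rintro ⟨r, s, hs, h⟩
      refine ⟨IsLocalization.mk' S r (⟨s, hs⟩ : p.asIdeal.primeCompl), ?_⟩
      have h0 : algebraMap R (FunctionField π) s ≠ 0 := by
        rw [← htower]
        refine (IsUnit.map (stalkMap π x) ?_).ne_zero
        exact IsLocalization.map_units S (⟨s, hs⟩ : p.asIdeal.primeCompl)
      apply mul_right_cancel₀ h0
      rw [h, ← htower]
      erw [← htower, ← map_mul]
      exact congrArg _ (IsLocalization.mk'_spec S r (⟨s, hs⟩ : p.asIdeal.primeCompl))
  · intro _ _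
    let _ : Algebra k S := ((algebraMap R S).comp (algebraMap k _)).toAlgebra
    have : IsScalarTower k R S := .of_algebraMap_eq fun _ => rfl
    have : p.asIdeal.IsPrime := p.2
    have : IsDomain R := inferInstanceAs (IsDomain Γ(X, V))
    have : IsPrincipalIdealRing S :=
      isPrincipalIdealRing_of_chart (k := k) (R := R) p.asIdeal S
    refine IsPrincipalIdealRing.of_surjective
      ((stalkMap π x).codRestrict (localRing π x) fun s => ⟨s, rfl⟩) ?_
    rintro ⟨_, s, rfl⟩
    exact ⟨s, rfl⟩

instance isLocalRing_localRing (x : X) : IsLocalRing (localRing π x) := by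
  refine IsLocalRing.of_surjective'
    ((stalkMap π x).codRestrict (localRing π x) fun s => ⟨s, rfl⟩) ?_
  rintro ⟨_, s, rfl⟩
  exact ⟨s, rfl⟩

end Points

/-! ### Uniformizers from principal local rings. -/

section Uniformizer

variable {k K : Type u} [Field k] [Field K] [Algebra k K]

lemma exists_isUniformizer {A : Subalgebra k K} [IsPrincipalIdealRing A] [IsLocalRing A]
    (hfrac : ∀ z : K, ∃ a b : A, (b : K) ≠ 0 ∧ z * b = a) (hA : A ≠ ⊤) :
    ∃ t, IsUniformizer A t := by
  have hnf : ¬ IsField A := by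
    intro h
    refine hA (top_le_iff.1 fun z _ => ?_)
    obtain ⟨a, b, hb, e⟩ := hfrac z
    obtain ⟨c, hc⟩ := h.mul_inv_cancel (a := b) (fun h0 => hb (by rw [h0]; rfl))
    have hc' : (b : K) * c = 1 := congrArg Subtype.val hc
    have : z = a * c := by rw [← e, mul_assoc, hc', mul_one]
    rw [this]
    exact (a * c).2
  have : IsDiscreteValuationRing A :=
    { not_a_field' := fun h => hnf (IsLocalRing.isField_iff_maximalIdeal_eq.2 h) }
  obtain ⟨t, ht⟩ := IsDiscreteValuationRing.exists_irreducible A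
  have ht0 : (t : K) ≠ 0 := fun h => ht.ne_zero (Subtype.ext h)
  have hunit : ∀ a : A, a ≠ 0 → ∃ (n : ℕ) (u : K), u ∈ A ∧ u⁻¹ ∈ A ∧ u ≠ 0 ∧ (a : K) = u * t ^ n := by
    intro a ha
    obtain ⟨n, u, rfl⟩ := IsDiscreteValuationRing.eq_unit_mul_pow_irreducible ha ht
    obtain ⟨h1, h2⟩ := (IsUniformizer.isUnit_iff (u : A)).1 u.isUnit
    exact ⟨n, _, (u : A).2, h2, h1, rfl⟩
  refine ⟨t, t.2, fun h => ht.not_isUnit ((IsUniformizer.isUnit_iff t).2 ⟨ht0, h⟩), fun z hz => ?_⟩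
  obtain ⟨a, b, hb, e⟩ := hfrac z
  have ha : a ≠ 0 := fun h => mul_ne_zero hz hb (by rw [e, h]; rfl)
  obtain ⟨n, u, hu, hu', hu0, hau⟩ := hunit a ha
  obtain ⟨m, v, hv, hv', hv0, hbv⟩ := hunit b fun h => hb (by rw [h]; rfl)
  refine ⟨n - m, u * v⁻¹, A.mul_mem hu hv', ?_, mul_ne_zero hu0 (inv_ne_zero hv0), ?_⟩
  · rw [mul_inv, inv_inv]
    exact A.mul_mem hu' hv
  · rw [zpow_sub₀ ht0, zpow_natCast, zpow_natCast]
    rw [hau, hbv] at e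
    field_simp
    linear_combination e

end Uniformizer

/-! ### Local and global geometry of the curve. -/

section Curve

variable {k : Type u} [Field k] {X : Scheme.{u}} [IsIntegral X]
  (π : X ⟶ Spec (CommRingCat.of k))

instance charP_functionField [CharP k 2] : CharP (FunctionField π) 2 :=
  charP_of_injective_algebraMap' k 2

lemma isFractionRing_sections {V : X.Opens} (hV : IsAffineOpen V) [Nonempty V] :
    IsFractionRing (Sections π V) (FunctionField π) :=
  functionField_isFractionRing_of_isAffineOpen X V hV

variable [SmoothOfRelativeDimension 1 π] [PerfectField k]

theorem isCurveField_functionField [CharP k 2] : IsCurveField k (FunctionField π) := by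
  obtain ⟨V, hx, hV, H⟩ := exists_chart π (genericPoint X)
  have : Nonempty V := ⟨⟨_, hx⟩⟩
  have := isFractionRing_sections π hV
  exact isCurveField_of_chart (R := Sections π V)

theorem exists_isUniformizer_localRing {x : X} (hx : localRing π x ≠ ⊤) :
    ∃ t, IsUniformizer (localRing π x) t := by
  obtain ⟨V, hxV, hV, H⟩ := exists_chart π x
  have : Nonempty V := ⟨⟨_, hxV⟩⟩
  obtain ⟨p, hp, -, hmem, hprinc⟩ := exists_prime π hV hxV
  have := hprinc
  have := isFractionRing_sections π hV
  refine exists_isUniformizer (fun z => ?_) hx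
  obtain ⟨a, b, hb, rfl⟩ := IsFractionRing.div_surjective (A := Sections π V) z
  have hb0 := IsFractionRing.to_map_ne_zero_of_mem_nonZeroDivisors (K := FunctionField π) hb
  have hS : ∀ s : Sections π V, algebraMap _ _ s ∈ localRing π x := fun s =>
    (hmem _).2 ⟨s, 1, p.ne_top_iff_one.1 hp.ne_top, by simp⟩
  exact ⟨⟨_, hS a⟩, ⟨_, hS b⟩, hb0, div_mul_cancel₀ _ hb0⟩

/-- A closed point is a maximal ideal of a chart, nonzero since the chart is not a field; the
inverse of a nonzero element of the ideal is not regular at the point. -/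
theorem localRing_ne_top {x : X} (hx : IsClosed ({x} : Set X)) : localRing π x ≠ ⊤ := by
  obtain ⟨V, hxV, hV, H⟩ := exists_chart π x
  have : Nonempty V := ⟨⟨_, hxV⟩⟩
  obtain ⟨p, hp, hmax, hmem, -⟩ := exists_prime π hV hxV
  have := isFractionRing_sections π hV
  intro htop
  have h0 : p ≠ ⊥ := fun h => not_isField_of_chart k (Sections π V)
    ((Ring.isField_iff_maximal_bot).2 (h ▸ hmax hx))
  obtain ⟨r, hr, hr0⟩ := Submodule.exists_mem_ne_zero_of_ne_bot h0
  obtain ⟨a, s, hs, e⟩ := (hmem (algebraMap _ _ r)⁻¹).1 (by rw [htop]; trivial)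
  have hr0' : algebraMap (Sections π V) (FunctionField π) r ≠ 0 := by
    simpa using hr0
  apply hs
  have : s = r * a := by
    apply IsFractionRing.injective (Sections π V) (FunctionField π)
    rw [map_mul, ← e, mul_inv_cancel_left₀ hr0']
  rw [this]
  exact p.mul_mem_right _ hr

omit [SmoothOfRelativeDimension 1 π] [PerfectField k] in
lemma exists_mem_localRing_nhds {x : X} {e : FunctionField π} (he : e ∈ localRing π x) :
    ∃ V : X.Opens, x ∈ V ∧ ∀ y ∈ V, e ∈ localRing π y := by
  obtain ⟨s, rfl⟩ := he
  obtain ⟨V, hx, s, rfl⟩ := X.presheaf.exists_germ_eq s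
  have : Nonempty V := ⟨⟨_, hx⟩⟩
  refine ⟨V, hx, fun y hy => ⟨X.presheaf.germ V y hy s, ?_⟩⟩
  exact (Scheme.algebraMap_germ_eq_germToFunctionField (X := X) hy s).trans
    (Scheme.algebraMap_germ_eq_germToFunctionField (X := X) hx s).symm

omit [SmoothOfRelativeDimension 1 π] [PerfectField k] in
lemma exists_mem_localRing_nhds_of_finite {x : X} {T : Set (FunctionField π)} (hT : T.Finite)
    (h : T ⊆ localRing π x) : ∃ V : X.Opens, x ∈ V ∧ ∀ y ∈ V, T ⊆ localRing π y := by
  induction T, hT using Set.Finite.induction_on with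
  | empty => exact ⟨⊤, trivial, fun y _ => Set.empty_subset _⟩
  | @insert a T _ _ ih =>
    obtain ⟨V, hV, H⟩ := ih ((Set.subset_insert _ _).trans h)
    obtain ⟨W, hW, H'⟩ := exists_mem_localRing_nhds π (h (Set.mem_insert _ _))
    exact ⟨V ⊓ W, ⟨hV, hW⟩, fun y hy => Set.insert_subset (H' y hy.2) (H y hy.1)⟩

omit [PerfectField k] [IsIntegral X] in
lemma locallyOfFiniteType : LocallyOfFiniteType π := by
  have := SmoothOfRelativeDimension.smooth 1 π
  infer_instance

-- A specialization of `x` shares a chart with it. There `x` is a nonzero prime, hence maximal, so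
-- the specialization is `x` itself.
include π in
omit [IsIntegral X] in
lemma isClosed_singleton_of_ne [IsIntegral X] {x : X} (hx : x ≠ genericPoint X) :
    IsClosed ({x} : Set X) := by
  rw [← closure_subset_iff_isClosed]
  intro y hy
  obtain ⟨V, hyV, hV, H⟩ := exists_chart π y
  have hxy : x ⤳ y := specializes_iff_mem_closure.2 hy
  have hxV : x ∈ V := hxy.mem_open V.isOpen hyV
  have : Nonempty V := ⟨⟨_, hxV⟩⟩
  have h1 : hV.primeIdealOf ⟨x, hxV⟩ ⤳ hV.primeIdealOf ⟨y, hyV⟩ := by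
    refine hV.fromSpec.isOpenEmbedding.isInducing.specializes_iff.1 ?_
    rwa [hV.fromSpec_primeIdealOf, hV.fromSpec_primeIdealOf]
  have h2 : (hV.primeIdealOf ⟨x, hxV⟩).asIdeal.IsMaximal :=
    isMaximal_of_chart k (R := Sections π V) (hp := (hV.primeIdealOf ⟨x, hxV⟩).2)
      fun h => hx (eq_genericPoint_of_primeIdealOf hV hxV h)
  have h3 := h2.eq_of_le (hV.primeIdealOf ⟨y, hyV⟩).2.ne_top
    ((PrimeSpectrum.le_iff_specializes _ _).2 h1)
  have h4 := congrArg hV.fromSpec (PrimeSpectrum.ext h3)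
  rw [hV.fromSpec_primeIdealOf, hV.fromSpec_primeIdealOf] at h4
  exact h4.symm

lemma mem_or_inv_mem_localRing (x : X) (z : FunctionField π) :
    z ∈ localRing π x ∨ z⁻¹ ∈ localRing π x := by
  by_cases hx : localRing π x = ⊤
  · exact .inl (hx ▸ Algebra.mem_top)
  · obtain ⟨t, ht⟩ := exists_isUniformizer_localRing π hx
    exact ht.mem_or_inv_mem z

omit [PerfectField k] in
lemma generatesB_top {K : Type u} [Field K] [Algebra k K] [CharP K 2] (hK : IsCurveField k K)
    {A : Subalgebra k K} (hA : A = ⊤) {g : A} (hg : IsSeparableMorphism k (g : K)) :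
    GeneratesB A g := by
  subst hA
  refine GeneratesB.of_decomp fun h _ => ?_
  obtain ⟨a, b, e⟩ := hK.decomp g hg h
  exact ⟨a, trivial, b, trivial, e⟩

theorem exists_generatesB [CharP k 2] (x : X) : ∃ g : localRing π x, GeneratesB (localRing π x) g := by
  have hK := isCurveField_functionField π
  by_cases hx : localRing π x = ⊤
  · obtain ⟨g, hg⟩ := hK.exists_separable
    exact ⟨⟨g, hx ▸ Algebra.mem_top⟩, generatesB_top hK hx hg⟩
  · obtain ⟨t, ht⟩ := exists_isUniformizer_localRing π hx
    exact ⟨_, ht.generatesB hK⟩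

/-- The elements of a subalgebra that have a decomposition `h = a ^ 2 + b ^ 2 * g`. -/
def decompSubalgebra {K : Type u} [Field K] [Algebra k K] [CharP K 2]
    (hk : ∀ c : k, ∃ e : k, e ^ 2 = c) {A : Subalgebra k K} {g : K} (hg : g ∈ A) :
    Subalgebra k K where
  carrier := {h | ∃ a ∈ A, ∃ b ∈ A, h = a ^ 2 + b ^ 2 * g}
  algebraMap_mem' c := by
    obtain ⟨e, rfl⟩ := hk c
    exact ⟨algebraMap k K e, A.algebraMap_mem e, 0, A.zero_mem, by simp⟩
  add_mem' := by
    rintro _ _ ⟨a, ha, b, hb, rfl⟩ ⟨a', ha', b', hb', rfl⟩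
    exact ⟨a + a', A.add_mem ha ha', b + b', A.add_mem hb hb',
      by linear_combination -(a * a' + b * b' * g) * two_eq_zero' (K := K)⟩
  mul_mem' := by
    rintro _ _ ⟨a, ha, b, hb, rfl⟩ ⟨a', ha', b', hb', rfl⟩
    exact ⟨a * a' + b * b' * g, A.add_mem (A.mul_mem ha ha') (A.mul_mem (A.mul_mem hb hb') hg),
      a * b' + a' * b, A.add_mem (A.mul_mem ha hb') (A.mul_mem ha' hb),
      by linear_combination -(2 * a * a' * b * b' * g) * two_eq_zero' (K := K)⟩

/-- A chart ring is a finitely generated algebra. The decompositions of its generators involve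
finitely many coefficients, all regular near `x`, and the decomposable elements form an algebra. -/
theorem exists_generatesB_nhds [CharP k 2] {x : X} {g : localRing π x}
    (hg : GeneratesB (localRing π x) g) :
    ∃ V : X.Opens, x ∈ V ∧ ∀ y ∈ V, ∃ hy : (g : FunctionField π) ∈ localRing π y,
      GeneratesB (localRing π y) ⟨g, hy⟩ := by
  have hK := isCurveField_functionField π
  obtain ⟨V, hxV, hV, H⟩ := exists_chart π x
  have : Nonempty V := ⟨⟨_, hxV⟩⟩
  have hsec : ∀ y ∈ V, ∀ s : Sections π V, algebraMap _ (FunctionField π) s ∈ localRing π y := by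
    intro y hy s
    obtain ⟨p, hp, -, hmem, -⟩ := exists_prime π hV hy
    exact (hmem _).2 ⟨s, 1, p.ne_top_iff_one.1 hp.ne_top, by simp⟩
  obtain ⟨T, hT⟩ := (finiteType_of_chart k (Sections π V)).out
  choose a ha b hb e using fun s : Sections π V =>
    hg.decomp hK (mem_or_inv_mem_localRing π x) (hsec x hxV s)
  obtain ⟨W, hxW, hW⟩ := exists_mem_localRing_nhds_of_finite π (x := x)
    (T := insert (g : FunctionField π) (a '' T ∪ b '' T))
    (((T.finite_toSet.image a).union (T.finite_toSet.image b)).insert _) (by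
      rintro _ (rfl | ⟨s, -, rfl⟩ | ⟨s, -, rfl⟩)
      exacts [g.2, ha s, hb s])
  refine ⟨V ⊓ W, ⟨hxV, hxW⟩, fun y hy => ?_⟩
  have hgy := hW y hy.2 (.inl rfl)
  refine ⟨hgy, GeneratesB.of_decomp fun h hh => ?_⟩
  have hdec : ∀ s : Sections π V, algebraMap _ _ s ∈ decompSubalgebra hK.sqrt hgy := by
    intro s
    have : s ∈ Algebra.adjoin k (T : Set (Sections π V)) := hT ▸ trivial
    induction this using Algebra.adjoin_induction with
    | mem s hs =>
      exact ⟨a s, hW y hy.2 (.inr (.inl ⟨s, hs, rfl⟩)), b s, hW y hy.2 (.inr (.inr ⟨s, hs, rfl⟩)), e s⟩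
    | algebraMap c =>
      rw [← IsScalarTower.algebraMap_apply]
      exact Subalgebra.algebraMap_mem _ c
    | add s t _ _ hs ht => rw [map_add]; exact add_mem hs ht
    | mul s t _ _ hs ht => rw [map_mul]; exact mul_mem hs ht
  obtain ⟨p, hp, -, hmem, -⟩ := exists_prime π hV hy.1
  obtain ⟨r, s, hs, hrs⟩ := (hmem h).1 hh
  have := isFractionRing_sections π hV
  have hs0 : algebraMap _ (FunctionField π) s ≠ 0 := by
    have : s ≠ 0 := fun h0 => hs (h0 ▸ p.zero_mem)
    simpa using this
  have hs' : (algebraMap _ (FunctionField π) s)⁻¹ ∈ localRing π y :=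
    (hmem _).2 ⟨1, s, hs, by rw [inv_mul_cancel₀ hs0, map_one]⟩
  -- The fraction r/s is rs/s², and a square denominator can be moved into both coefficients.
  obtain ⟨a', ha', b', hb', e'⟩ := hdec (r * s)
  refine ⟨a' * (algebraMap _ _ s)⁻¹, mul_mem ha' hs', b' * (algebraMap _ _ s)⁻¹, mul_mem hb' hs', ?_⟩
  rw [map_mul, ← hrs] at e'
  field_simp
  linear_combination e'

-- The complement has finitely many irreducible components; the generic point of each differs from
-- that of X, so it is closed and is the whole component.
include π in
theorem finite_compl [CompactSpace X] {V : X.Opens} (hV : (V : Set X).Nonempty) :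
    ((V : Set X)ᶜ).Finite := by
  have := locallyOfFiniteType π
  have : IsLocallyNoetherian X := LocallyOfFiniteType.isLocallyNoetherian π
  have : AlgebraicGeometry.IsNoetherian X := {}
  obtain ⟨S, hS, hS1, hS2, e⟩ :=
    TopologicalSpace.NoetherianSpace.exists_finite_set_isClosed_irreducible V.isOpen.isClosed_compl
  rw [e]
  refine hS.sUnion fun Z hZ => ?_
  obtain ⟨x, hx⟩ := QuasiSober.sober (hS2 Z hZ) (hS1 Z hZ)
  have hxZ : x ∈ (V : Set X)ᶜ := e ▸ ⟨Z, hZ, hx ▸ subset_closure rfl⟩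
  have hx' : x ≠ genericPoint X := by
    rintro rfl
    exact hxZ (((genericPoint_spec X).mem_open_set_iff V.isOpen).mpr (by simpa using hV))
  rw [← hx.def, (isClosed_singleton_of_ne π hx').closure_eq]
  exact Set.finite_singleton x

end Curve

/-! ### The bijection between classes and sections. -/

section Bijection

variable {k : Type u} [Field k] {X : Scheme.{u}} [IsIntegral X]
  {π : X ⟶ Spec (CommRingCat.of k)} {n : ℕ} {U : Fin n → X.Opens} {f : Fin n → FunctionField π}

lemma sigma_bundleSection_ext {p q : Σ a : Torsor π U f, a.BundleSection}
    (h : ∀ i, p.1.cochain i = q.1.cochain i) (h' : ∀ x, p.2.stalk x = q.2.stalk x) : p = q := by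
  obtain ⟨⟨a, ha, ha'⟩, ⟨⟨s, hs⟩, hs'⟩⟩ := p
  obtain ⟨⟨b, hb, hb'⟩, ⟨⟨t, ht⟩, ht'⟩⟩ := q
  obtain rfl : a = b := funext h
  obtain rfl : s = t := funext h'
  rfl

lemma genericPoint_mem {V : X.Opens} {x : X} (hx : x ∈ V) : genericPoint X ∈ V :=
  ((genericPoint_spec X).mem_open_set_iff V.isOpen).mpr ⟨x, trivial, hx⟩

variable [CharP k 2] [PerfectField k] [SmoothOfRelativeDimension 1 π]

local notation "d" => KaehlerDifferential.D k (FunctionField π)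

/-- At closed points this is the pseudotameness criterion; at the generic point every function is
regular, so nothing is required of `h`. -/
lemma exists_symbol_eq_D {x : X} {h : FunctionField π} (hs : IsSeparableMorphism k h)
    (hpt : IsClosed ({x} : Set X) → IsPseudotameAt (localRing π x) h) {g : localRing π x}
    (hg : GeneratesB (localRing π x) g) : ∃ w ∈ localRing π x, symbol k h (g : FunctionField π) = d w := by
  have hK := isCurveField_functionField π
  have hgs := hg.isSeparable hK (mem_or_inv_mem_localRing π x)
  by_cases hx : IsClosed ({x} : Set X)
  · obtain ⟨t, ht⟩ := exists_isUniformizer_localRing π (localRing_ne_top π hx)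
    exact (isPseudotameAt_iff hK ht hs hg).1 (hpt hx)
  · obtain rfl : x = genericPoint X := by
      by_contra h
      exact hx (isClosed_singleton_of_ne π h)
    obtain ⟨a, b, c, e, he⟩ := hK.exists_coords hgs h
    rw [symbol_eq hgs he]
    exact ⟨_, (localRing_genericPoint π).ge Algebra.mem_top, (D_sq_mul _ _).symm⟩

lemma isPseudotameAt_of_symbol {x : X} {h : FunctionField π} (hs : IsSeparableMorphism k h)
    (hx : IsClosed ({x} : Set X)) {g : localRing π x} (hg : GeneratesB (localRing π x) g)
    {w : FunctionField π} (hw : w ∈ localRing π x) (e : symbol k h (g : FunctionField π) = d w) :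
    IsPseudotameAt (localRing π x) h := by
  obtain ⟨t, ht⟩ := exists_isUniformizer_localRing π (localRing_ne_top π hx)
  exact (isPseudotameAt_iff (isCurveField_functionField π) ht hs hg).2 ⟨w, hw, e⟩

/-- The point of the SY torsor defined by a pseudotame function. -/
noncomputable def Pseudotame.torsor (hf : ∀ i, IsPseudotameOn π (U i) (f i)) (h : Pseudotame π) :
    Torsor π U f where
  cochain i := symbol k h.1 (f i)
  isSectionB i x hx := by
    have hK := isCurveField_functionField π
    obtain ⟨g, hg⟩ := exists_generatesB π x
    have hgs := hg.isSeparable hK (mem_or_inv_mem_localRing π x)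
    obtain ⟨w, hw, e⟩ := exists_symbol_eq_D h.2.1 (h.2.2 x trivial) hg
    obtain ⟨w', hw', e'⟩ := exists_symbol_eq_D (hf i).1 ((hf i).2 x hx) hg
    refine ⟨⟨w + w', add_mem hw hw'⟩, ?_⟩
    rw [← hK.symbol_add h.2.1 hgs (hf i).1, hK.symbol_comm hgs (hf i).1, e, e']
    exact (map_add _ _ _).symm
  coboundary i j := by
    have hK := isCurveField_functionField π
    rw [← hK.symbol_add (hf i).1 h.2.1 (hf j).1, hK.symbol_comm (hf i).1 h.2.1]

/-- The line subbundle generically spanned by a function. -/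
noncomputable def lineSubbundle {h : FunctionField π} (hs : IsSeparableMorphism k h) :
    LineSubbundle π where
  stalk x := lineStalk (localRing π x) h
  locally_generated x := by
    have hK := isCurveField_functionField π
    obtain ⟨g, hg⟩ := exists_generatesB π x
    -- Coordinates normalized at `x`, with one equal to 1, remain integral nearby, and `g` still
    -- generates B there; so one function generates the line on a neighbourhood.
    obtain ⟨t, ht, ⟨j, hj⟩, haff⟩ := exists_primitive hK (mem_or_inv_mem_localRing π x)
      (hg.isSeparable hK (mem_or_inv_mem_localRing π x)) hs
    obtain ⟨V, hxV, hV⟩ := exists_generatesB_nhds π hg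
    obtain ⟨W, hxW, hW⟩ := exists_mem_localRing_nhds_of_finite π (Set.finite_range t)
      (Set.range_subset_iff.2 ht)
    refine ⟨V ⊓ W, ⟨hxV, hxW⟩, coordSum (g : FunctionField π) t, fun y hy => ?_⟩
    obtain ⟨hgy, hgB⟩ := hV y hy.1
    have hty : ∀ i, t i ∈ localRing π y := fun i => hW y hy.2 ⟨i, rfl⟩
    have hcoe := coe_coordSum (⟨g, hgy⟩ : localRing π y) fun i => ⟨t i, hty i⟩
    obtain ⟨h1, h2, h3⟩ := lineStalk_eq_span hK (mem_or_inv_mem_localRing π y) hgB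
      (t := fun i => ⟨t i, hty i⟩) (j := j) (Subtype.ext hj)
    have he : coordSum (g : FunctionField π) t ∈ localRing π y := hcoe ▸ SetLike.coe_mem _
    have heq : (⟨_, he⟩ : localRing π y) = coordSum ⟨g, hgy⟩ fun i => ⟨t i, hty i⟩ :=
      Subtype.ext hcoe.symm
    refine ⟨he, ?_⟩
    rw [lineStalk_affine hK haff, heq, ← h1]
    rw [hcoe] at h1 h3 ⊢
    exact ⟨rfl, h2, h3⟩

/-- The section of the SY conic bundle defined by a pseudotame function. -/
noncomputable def Pseudotame.bundleSection (hf : ∀ i, IsPseudotameOn π (U i) (f i))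
    (h : Pseudotame π) : (h.torsor hf).BundleSection where
  toLineSubbundle := lineSubbundle h.2.1
  mem_bundle x ε hε i hx g b hg e := by
    have hK := isCurveField_functionField π
    have hgs := hg.isSeparable hK (mem_or_inv_mem_localRing π x)
    refine mem_conicCone_of_mem_lineStalk hK (mem_or_inv_mem_localRing π x) h.2.1 hg ?_ hε
    rw [← e]
    exact (hK.symbol_add h.2.1 (hf i).1 hgs).symm

/-- The map from classes of pseudotame functions to sections of SY conic bundles. -/
noncomputable def toBundleSection (hf : ∀ i, IsPseudotameOn π (U i) (f i)) :
    Quotient (Pseudotame.setoid π) → Σ a : Torsor π U f, a.BundleSection :=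
  Quotient.lift (fun h => ⟨h.torsor hf, h.bundleSection hf⟩) fun h h' hh => by
    have hK := isCurveField_functionField π
    exact sigma_bundleSection_ext (fun i => (symbol_affine hK hh (hf i).1).symm)
      fun x => lineStalk_affine hK hh

lemma toBundleSection_injective (hf : ∀ i, IsPseudotameOn π (U i) (f i)) :
    Function.Injective (toBundleSection hf) := by
  have hK := isCurveField_functionField π
  rintro ⟨h⟩ ⟨h'⟩ e
  refine Quotient.sound ?_
  have hmem : h'.1 ∈ localRing π (genericPoint X) := by rw [localRing_genericPoint]; trivial
  have h1 : lineStalk (localRing π (genericPoint X)) h.1 = lineStalk _ h'.1 :=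
    congrArg (fun p : Σ a : Torsor π U f, a.BundleSection => p.2.stalk (genericPoint X)) e
  have h2 : frobMk k (⟨h'.1, hmem⟩ : localRing π (genericPoint X)) ∈ lineStalk _ h'.1 :=
    (frobMk_mem_lineStalk hK).2 ⟨1, 0, by simp⟩
  rw [← h1, frobMk_mem_lineStalk hK] at h2
  obtain ⟨c, w, h3⟩ := h2
  refine ⟨c, w, ?_, h3⟩
  -- With `c = 0`, `h'` would be a fourth power and have zero differential.
  rintro rfl
  refine h'.2.1 ?_
  change h'.1 = _ at h3
  rw [h3, D_affine]
  simp

/-- The preimage is a generator of the stalk at the generic point; its symbols are computed there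
and then read at closed points. -/
lemma toBundleSection_surjective (hf : ∀ i, IsPseudotameOn π (U i) (f i)) (hcover : ⨆ i, U i = ⊤) :
    Function.Surjective (toBundleSection hf) := by
  have hK := isCurveField_functionField π
  have hU : ∀ x : X, ∃ i, x ∈ U i := fun x => by
    have : x ∈ ⨆ i, U i := hcover ▸ trivial
    simpa using this
  rintro ⟨a, s⟩
  let η := genericPoint X
  obtain ⟨V, hηV, e, hV⟩ := s.locally_generated η
  obtain ⟨he, h1, h2, -⟩ := hV η hηV
  obtain ⟨j, hj⟩ := hU η
  have htop : localRing π η = ⊤ := localRing_genericPoint π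
  have hfj : f j ∈ localRing π η := by rw [htop]; trivial
  obtain ⟨w, hw⟩ := a.isSectionB j η hj
  obtain ⟨b, hb⟩ := hK.exists_D_eq_smul (hf j).1 w
  have hbη : b ∈ localRing π η := by rw [htop]; trivial
  -- The conic is taken in the coordinate `f j` itself, so the correction SY(fⱼ,fⱼ) vanishes and the
  -- equation says SY(e,fⱼ) = daⱼ.
  obtain ⟨hsep, hsym⟩ := symbol_eq_of_mem_conicCone hK (g := ⟨f j, hfj⟩) (b := ⟨b, hbη⟩) (hf j).1 h2
    (s.mem_bundle η _ (h1 ▸ Submodule.mem_span_singleton_self _) j hj _ _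
      (generatesB_top hK htop (hf j).1) (by rw [symbol_self (hf j).1, add_zero, hw, hb]))
  change IsSeparableMorphism k e at hsep
  change symbol k e (f j) = b ^ 2 • d (f j) at hsym
  rw [← hb, ← hw] at hsym
  have hco : ∀ i, symbol k e (f i) = a.cochain i := by
    intro i
    rw [← hK.symbol_add hsep (hf j).1 (hf i).1, hsym, a.coboundary, ← add_assoc,
      add_self_eq_zero' (K := FunctionField π), zero_add]
  have hpt : IsPseudotameOn π ⊤ e := by
    refine ⟨hsep, fun x _ hx => ?_⟩
    obtain ⟨i, hi⟩ := hU x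
    obtain ⟨g, hg⟩ := exists_generatesB π x
    have hgs := hg.isSeparable hK (mem_or_inv_mem_localRing π x)
    obtain ⟨w, hw⟩ := a.isSectionB i x hi
    obtain ⟨w', hw', e'⟩ := exists_symbol_eq_D (hf i).1 ((hf i).2 x hi) hg
    refine isPseudotameAt_of_symbol hsep hx hg (add_mem w.2 hw') ?_
    rw [← hK.symbol_add hsep (hf i).1 hgs, hco, hw, e', map_add]
  refine ⟨Quotient.mk _ ⟨e, hpt⟩, sigma_bundleSection_ext hco fun x => ?_⟩
  obtain ⟨V', hxV, e', hV'⟩ := s.locally_generated x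
  obtain ⟨he', h1', -, -⟩ := hV' η (genericPoint_mem hxV)
  -- The generators from different neighbourhoods span the same line at the generic point; the
  -- factor is nonzero because the class of `e` is.
  have haff : FourthPowerAffine e' e := by
    have h3 : frobMk k (⟨e, he⟩ : localRing π η) ∈ s.stalk η :=
      h1 ▸ Submodule.mem_span_singleton_self _
    rw [h1', mem_span_frobMk hK.sqrt] at h3
    obtain ⟨c, w, h3⟩ := h3
    refine ⟨c, w, ?_, congrArg Subtype.val h3⟩
    intro hc
    apply h2
    rw [frobMk_eq_zero_iff hK.sqrt]
    have hc : c = 0 := Subtype.ext hc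
    exact ⟨w, by rw [h3, hc]; simp⟩
  obtain ⟨hex, h1x, h2x, h3x⟩ := hV' x hxV
  change lineStalk (localRing π x) e = s.stalk x
  rw [h1x] at h3x ⊢
  exact (span_eq_lineStalk hK (mem_or_inv_mem_localRing π x) h2x h3x haff).symm

/-- Pseudotame functions up to fourth power affine transformations correspond to sections of SY
conic bundles. -/
noncomputable def bundleSectionEquiv (hf : ∀ i, IsPseudotameOn π (U i) (f i)) (hcover : ⨆ i, U i = ⊤) :
    Quotient (Pseudotame.setoid π) ≃ Σ a : Torsor π U f, a.BundleSection :=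
  Equiv.ofBijective _ ⟨toBundleSection_injective hf, toBundleSection_surjective hf hcover⟩

end Bijection

/-! ### Weak approximation. -/

section Approximation

variable {k : Type u} [Field k] {K : Type u} [Field K] [Algebra k K]

open Classical in
/-- The absolute value defined by a discrete valuation ring. -/
noncomputable def ordAbs {A : Subalgebra k K} {t : K} (ht : IsUniformizer A t) :
    AbsoluteValue K ℝ where
  toFun z := if z = 0 then 0 else (2 : ℝ) ^ (-ord A z)
  map_mul' z w := by
    by_cases hz : z = 0
    · simp [hz]
    by_cases hw : w = 0
    · simp [hw]
    simp only [hz, hw, mul_eq_zero, or_self, if_false]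
    rw [ht.ord_mul hz hw, neg_add, zpow_add₀ two_ne_zero]
  nonneg' z := by
    split_ifs <;> positivity
  eq_zero' z := by
    by_cases hz : z = 0
    · simp [hz]
    · simp only [hz, if_false, iff_false]
      positivity
  add_le' z w := by
    by_cases hz : z = 0
    · simp [hz]
    by_cases hw : w = 0
    · simp [hw]
    by_cases hzw : z + w = 0
    · simp only [hz, hw, hzw, if_true, if_false]
      positivity
    simp only [hz, hw, hzw, if_false]
    have h1 : (0 : ℝ) < 2 ^ (-ord A z) := by positivity
    have h2 : (0 : ℝ) < 2 ^ (-ord A w) := by positivity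
    have h := (ht.le_ord_add (z := z) (w := w) (n := min (ord A z) (ord A w))
      (.inr (min_le_left _ _)) (.inr (min_le_right _ _))).resolve_left hzw
    rcases min_choice (ord A z) (ord A w) with e | e
    · have := zpow_le_zpow_right₀ (one_le_two (α := ℝ)) (show -ord A (z + w) ≤ -ord A z by omega)
      linarith
    · have := zpow_le_zpow_right₀ (one_le_two (α := ℝ)) (show -ord A (z + w) ≤ -ord A w by omega)
      linarith

lemma ordAbs_of_ne {A : Subalgebra k K} {t : K} (ht : IsUniformizer A t) {z : K} (hz : z ≠ 0) :
    ordAbs ht z = (2 : ℝ) ^ (-ord A z) := if_neg hz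

lemma ordAbs_le_one_iff {A : Subalgebra k K} {t : K} (ht : IsUniformizer A t) {z : K} :
    ordAbs ht z ≤ 1 ↔ z ∈ A := by
  rw [ht.mem_iff]
  by_cases hz : z = 0
  · simp [hz]
  · rw [ordAbs_of_ne ht hz, zpow_le_one_iff_right₀ one_lt_two]
    simp [hz]

/-- Weak approximation: finitely many discrete valuation rings of a field have a common
uniformizer. -/
theorem exists_ord_eq_one {Y : Set (Subalgebra k K)} (hY : Y.Finite)
    (ht : ∀ A ∈ Y, ∃ t, IsUniformizer A t) : ∃ g : K, ∀ A ∈ Y, g ≠ 0 ∧ ord A g = 1 := by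
  have := hY.to_subtype
  choose t ht using fun A : Y => ht A A.2
  have hnon : ∀ A : Y, (ordAbs (ht A)).IsNontrivial := by
    refine fun A => ⟨t A, (ht A).ne_zero, ?_⟩
    rw [ordAbs_of_ne _ (ht A).ne_zero, (ht A).ord_self]
    norm_num
  -- Equivalent absolute values have the same unit ball, which is the valuation ring; distinct rings
  -- thus give inequivalent ones.
  have hdense := AbsoluteValue.denseRange_algebraMap_pi hnon fun A B hAB h => hAB <| by
    refine Subtype.ext (SetLike.ext fun z => ?_)
    rw [← ordAbs_le_one_iff (ht A), ← ordAbs_le_one_iff (ht B)]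
    exact h.le_one_iff
  -- The radius 1/2 is the absolute value of a uniformizer; a strictly smaller error has order at
  -- least 2 and leaves the order 1 intact.
  obtain ⟨g, hg⟩ := hdense.exists_mem_open
    (s := Set.univ.pi fun A => Metric.ball (WithAbs.toAbs _ (t A)) (1 / 2))
    (isOpen_set_pi Set.finite_univ fun A _ => Metric.isOpen_ball)
    ⟨fun A => WithAbs.toAbs _ (t A), fun A _ => Metric.mem_ball_self (by norm_num)⟩
  refine ⟨g, fun A hA => ?_⟩
  have h1 := hg ⟨A, hA⟩ trivial
  have hs : IsUniformizer A (t ⟨A, hA⟩) := ht ⟨A, hA⟩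
  have h2 : ordAbs hs (g - t ⟨A, hA⟩) < 1 / 2 := by
    rw [Metric.mem_ball, dist_eq_norm, WithAbs.norm_eq_apply_ofAbs] at h1
    exact h1
  generalize t ⟨A, hA⟩ = s at hs h2
  have h3 : g - s = 0 ∨ ord A s < ord A (g - s) := by
    by_cases h0 : g - s = 0
    · exact .inl h0
    right
    rw [ordAbs_of_ne _ h0, one_div, ← zpow_neg_one, zpow_lt_zpow_iff_right₀ one_lt_two] at h2
    rw [hs.ord_self]
    omega
  have h4 := hs.ord_add_of_lt hs.ne_zero h3
  rwa [add_sub_cancel, hs.ord_self] at h4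

end Approximation

/-! ### Splitting off bounded polar parts. -/

section Decomposition

open Polynomial

variable {k : Type u} [Field k] {K : Type u} [Field K] [Algebra k K]

/-- A polynomial in an element of negative order has the expected order. -/
lemma exists_unit_aeval {A : Subalgebra k K} {t : K} (ht : IsUniformizer A t) {u : K} (hu : u ∉ A)
    {q : k[X]} (hq : q ≠ 0) :
    ∃ v ∈ A, v⁻¹ ∈ A ∧ v ≠ 0 ∧ aeval u q = v * u ^ q.natDegree := by
  have hu0 : u ≠ 0 := by rintro rfl; exact hu A.zero_mem
  have hu' : u⁻¹ ∈ A := (ht.mem_or_inv_mem u).resolve_left hu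
  have : IsLocalRing A := isLocalRing_of_mem_or_inv_mem ht.mem_or_inv_mem
  let w : A := ⟨u⁻¹, hu'⟩
  have hw : ¬ IsUnit w := by
    rw [IsUniformizer.isUnit_iff]
    simp [w, hu]
  -- The reversed polynomial at u⁻¹ is the leading coefficient of `q` plus a multiple of the nonunit
  -- u⁻¹.
  have hunit : IsUnit (aeval w q.reverse) := by
    by_contra h
    have h1 : aeval w q.reverse = algebraMap k A q.leadingCoeff + w * aeval w q.reverse.divX := by
      conv_lhs => rw [← X_mul_divX_add q.reverse]
      simp [add_comm]
    have h2 : algebraMap k A q.leadingCoeff ∈ nonunits A := by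
      rw [eq_sub_of_add_eq h1.symm]
      exact (IsLocalRing.maximalIdeal A).sub_mem h
        ((IsLocalRing.maximalIdeal A).mul_mem_right _ hw)
    exact h2 ((IsUnit.mk0 _ (leadingCoeff_ne_zero.2 hq)).map _)
  obtain ⟨h1, h2⟩ := (IsUniformizer.isUnit_iff _).1 hunit
  refine ⟨_, (aeval w q.reverse).2, h2, h1, ?_⟩
  let _ := invertibleOfNonzero hu0
  have := eval₂_reverse_mul_pow (algebraMap k K) u q
  rw [aeval_subalgebra_coe, aeval_def, aeval_def, ← this, invOf_eq_inv]

lemma div_mem_of_degree_lt {A : Subalgebra k K} {t : K} (ht : IsUniformizer A t) {u : K}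
    (hu : u ∉ A) {r q : k[X]} (hrq : r.degree < q.degree) : aeval u r / aeval u q ∈ A := by
  rcases eq_or_ne r 0 with rfl | hr
  · simp
  have hq : q ≠ 0 := by rintro rfl; simp at hrq
  have hu0 : u ≠ 0 := by rintro rfl; exact hu A.zero_mem
  obtain ⟨v, hv, hv', hv0, e⟩ := exists_unit_aeval ht hu hr
  obtain ⟨w, hw, hw', hw0, e'⟩ := exists_unit_aeval ht hu hq
  obtain ⟨m, hm⟩ := Nat.exists_eq_add_of_le (natDegree_le_natDegree hrq.le)
  have : aeval u r / aeval u q = v * w⁻¹ * u⁻¹ ^ m := by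
    rw [e, e', hm, inv_pow, pow_add]
    field_simp
  rw [this]
  exact A.mul_mem (A.mul_mem hv hw') (A.pow_mem ((ht.mem_or_inv_mem u).resolve_left hu) m)

/-- Every function is the sum of a function whose poles are among those of `u` and a function whose
pole orders along the poles of `u` are bounded. -/
theorem exists_integral_add_bounded [CharP K 2] (hK : IsCurveField k K) {u : K}
    (hus : IsSeparableMorphism k u) {Y : Set (Subalgebra k K)} (hY : Y.Finite)
    (ht : ∀ A ∈ Y, ∃ t, IsUniformizer A t) (hu : ∀ A ∈ Y, u ∉ A) :
    ∃ m : ℕ, ∀ z : K, ∃ s r : K, z = s + r ∧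
      (∀ A : Subalgebra k K, (∀ z : K, z ∈ A ∨ z⁻¹ ∈ A) → u ∈ A → s ∈ A) ∧
      ∀ A ∈ Y, r * u⁻¹ ^ m ∈ A := by
  have := hK.finite u hus
  open scoped IntermediateField.algebraAdjoinAdjoin in
  -- A basis of K over k(u) is chosen integral over k[u], hence regular where `u` is. Each
  -- coordinate in k(u) is a polynomial in `u` plus a proper fraction. Proper fractions are regular
  -- at the poles of `u`, so the poles of `r` there are bounded by those of the finitely many basis
  -- elements.
  obtain ⟨I, b, hb⟩ := FiniteDimensional.exists_is_basis_integral (Algebra.adjoin k {u})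
    (IntermediateField.adjoin k {u}) K
  have hbound : ∀ (A : Subalgebra k K), A ∈ Y → ∀ i, ∃ m : ℕ, b i * u⁻¹ ^ m ∈ A := by
    intro A hA i
    obtain ⟨t, ht⟩ := ht A hA
    have hu0 : u ≠ 0 := by rintro rfl; exact hu A hA A.zero_mem
    have hou : ord A u < 0 := by
      have := hu A hA
      rw [ht.mem_iff] at this
      push Not at this
      exact this.2
    refine ⟨(ord A (b i)).natAbs, ht.mem_iff.2 (.inr ?_)⟩
    rw [ht.ord_mul (b.ne_zero i) (pow_ne_zero _ (inv_ne_zero hu0)), ht.ord_pow (inv_ne_zero hu0),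
      ht.ord_inv hu0]
    have : (((ord A (b i)).natAbs : ℕ) : ℤ) * 1 ≤ (((ord A (b i)).natAbs : ℕ) : ℤ) * (-ord A u) := by
      gcongr
      omega
    omega
  choose! m hm using hbound
  have hpow : ∀ A ∈ Y, u⁻¹ ∈ A := fun A hA => by
    obtain ⟨t, ht⟩ := ht A hA
    exact (ht.mem_or_inv_mem u).resolve_left (hu A hA)
  obtain ⟨M, hM⟩ : ∃ M, ∀ A ∈ Y, ∀ i, m A i ≤ M := by
    have hfin : (⋃ A ∈ Y, Set.range (m A)).Finite := hY.biUnion fun A _ => Set.finite_range _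
    obtain ⟨M, hM⟩ := hfin.bddAbove
    exact ⟨M, fun A hA i => hM (Set.mem_biUnion hA ⟨i, rfl⟩)⟩
  refine ⟨M, fun z => ?_⟩
  have hcoef : ∀ i, ∃ p r q : k[X], r.degree < q.degree ∧
      ((b.repr z i : IntermediateField.adjoin k {u}) : K) = aeval u p + aeval u r / aeval u q := by
    intro i
    obtain ⟨r, q, h⟩ := (IntermediateField.mem_adjoin_simple_iff k _).1 (b.repr z i).2
    by_cases hq : aeval u q = 0
    · exact ⟨0, 0, 1, by simp, by rw [h, hq]; simp⟩
    have hq0 : q ≠ 0 := by rintro rfl; simp at hq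
    refine ⟨r / q, r % q, q, EuclideanDomain.mod_lt r hq0, ?_⟩
    rw [h]
    conv_lhs => rw [← EuclideanDomain.div_add_mod r q]
    rw [map_add, map_mul, add_div, mul_div_cancel_left₀ _ hq]
  choose p r q hrq hc using hcoef
  refine ⟨∑ i, aeval u (p i) * b i, ∑ i, aeval u (r i) / aeval u (q i) * b i, ?_, ?_, ?_⟩
  · rw [← Finset.sum_add_distrib]
    conv_lhs => rw [← b.sum_repr z]
    refine Finset.sum_congr rfl fun i _ => ?_
    rw [IntermediateField.smul_def, hc, smul_eq_mul, add_mul]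
  · intro A hv huA
    have hle : Algebra.adjoin k {u} ≤ A := Algebra.adjoin_le (by simpa using huA)
    refine A.sum_mem fun i _ => A.mul_mem (hle ?_) (mem_of_isIntegral hv hle (hb i))
    exact aeval_mem_adjoin_singleton k u
  · intro A hA
    obtain ⟨t, ht⟩ := ht A hA
    rw [Finset.sum_mul]
    refine A.sum_mem fun i _ => ?_
    rw [mul_assoc]
    refine A.mul_mem (div_mem_of_degree_lt ht (hu A hA) (hrq i)) ?_
    obtain ⟨c, hc⟩ := Nat.exists_eq_add_of_le (hM A hA i)
    rw [hc, pow_add, ← mul_assoc]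
    exact A.mul_mem (hm A hA i) (A.pow_mem (hpow A hA) c)

end Decomposition

/-! ### Local tameness of F³ + s⁴. -/

section Tame

open Polynomial

variable {k : Type u} [Field k] {K : Type u} [Field K] [Algebra k K]

local notation "d" => KaehlerDifferential.D k K

namespace IsUniformizer

variable {A : Subalgebra k K} {t : K} (ht : IsUniformizer A t)
include ht

lemma isUnit_iff_ord {a : A} : IsUnit a ↔ (a : K) ≠ 0 ∧ ord A (a : K) = 0 := by
  rw [isUnit_iff]
  refine and_congr_right fun h0 => ?_
  have h1 := ht.mem_iff.1 a.2
  rw [ht.mem_iff, ht.ord_inv h0, or_iff_right (inv_ne_zero h0)]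
  have := h1.resolve_left h0
  omega

lemma one_le_ord {a : A} (h : ¬ IsUnit a) : (a : K) = 0 ∨ 1 ≤ ord A (a : K) := by
  by_cases h0 : (a : K) = 0
  · exact .inl h0
  rw [ht.isUnit_iff_ord] at h
  have := (ht.mem_iff.1 a.2).resolve_left h0
  right
  by_contra
  exact h ⟨h0, by omega⟩

lemma of_ord_eq_one {g : K} (h0 : g ≠ 0) (h : ord A g = 1) : IsUniformizer A g where
  mem := ht.mem_iff.2 (.inr (by omega))
  inv_notMem := by
    rw [ht.mem_iff, ht.ord_inv h0]
    simp [h0, h]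
  exists_eq z hz := by
    have hg : z * g ^ (-ord A z) ≠ 0 := mul_ne_zero hz (zpow_ne_zero _ h0)
    have ho : ord A (z * g ^ (-ord A z)) = 0 := by
      rw [ht.ord_mul hz (zpow_ne_zero _ h0), ht.ord_zpow h0, h]; ring
    refine ⟨ord A z, _, ht.mem_iff.2 (.inr ho.ge), ht.mem_iff.2 (.inr ?_), hg, ?_⟩
    · rw [ht.ord_inv hg, ho, neg_zero]
    · rw [mul_assoc, ← zpow_add₀ h0]; simp

variable [CharP K 2] (hK : IsCurveField k K)
include hK

/-- A nonunit whose differential generates the differentials is a uniformizer. -/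
lemma ord_eq_one_of_D {F c z : A} (hF : GeneratesB A F) (hc : IsUnit c) (hz : ¬ IsUnit z)
    (h : d (z : K) = (c : K) • d (F : K)) : (z : K) ≠ 0 ∧ ord A (z : K) = 1 := by
  have hFs := hF.isSeparable hK ht.mem_or_inv_mem
  obtain ⟨hc0, hc1⟩ := ht.isUnit_iff_ord.1 hc
  have hz0 : (z : K) ≠ 0 := by
    intro h0
    rw [h0, map_zero, eq_comm, smul_eq_zero] at h
    exact h.elim hc0 hFs
  refine ⟨hz0, le_antisymm ?_ ((ht.one_le_ord hz).resolve_left hz0)⟩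
  by_contra! hlt
  -- If z had order at least 2, then z = t²w with w regular, and dz would be t² times a regular
  -- differential.
  have hmem : z * t ^ (-2 : ℤ) ∈ A := ht.mul_zpow_mem_iff.2 (.inr hlt)
  obtain ⟨e, he⟩ := hF ⟨_, hmem⟩
  have h1 : d (z : K) = (t * e) ^ 2 • d (F : K) := by
    rw [mul_pow, mul_smul, ← he, ← D_sq_mul]
    congr 1
    change (z : K) = t ^ 2 * (z * t ^ (-2 : ℤ))
    have := ht.ne_zero
    rw [zpow_neg]
    field_simp
  rw [h1] at h
  have h2 : (t * e) ^ 2 = (c : K) := smul_left_injective K hFs h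
  have he0 : t * e ≠ 0 := by
    intro h3
    rw [h3] at h2
    exact hc0 (by rw [← h2]; simp)
  rw [← h2, ht.ord_pow he0, ht.ord_mul (left_ne_zero_of_mul he0) (right_ne_zero_of_mul he0),
    ht.ord_self] at hc1
  have := (ht.mem_iff.1 e.2).resolve_left (right_ne_zero_of_mul he0)
  push_cast at hc1
  omega

omit hK [CharP K 2] in
lemma isTameAt_of_pole {f : K} (h : Odd (ord A f)) (hneg : ord A f < 0) : IsTameAt A f := by
  have h0 : f ≠ 0 := by
    rintro rfl
    have : ord A (0 : K) = 0 := by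
      rw [ord, dif_neg]
      rintro ⟨n, hn⟩
      exact (ht.hasOrder_iff_ord.1 hn).1 rfl
    omega
  refine ⟨(ord A f).natAbs, ⟨f⁻¹, .inl ⟨?_, rfl⟩, ?_⟩, ?_⟩
  · rw [ht.mem_iff]
    push Not
    exact ⟨h0, hneg⟩
  · rw [ht.hasOrder_iff_ord, ht.ord_inv h0]
    exact ⟨inv_ne_zero h0, by omega⟩
  · obtain ⟨m, hm⟩ := h
    omega

end IsUniformizer

lemma exists_aeval_pow_four [CharP K 2] (hk : ∀ c : k, ∃ e : k, e ^ 2 = c) (P : k[X]) :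
    ∃ Q : k[X], ∀ s : K, aeval (s ^ 4) P = aeval s Q ^ 4 := by
  induction P using Polynomial.induction_on' with
  | add p q hp hq =>
    obtain ⟨p', hp⟩ := hp
    obtain ⟨q', hq⟩ := hq
    exact ⟨p' + q', fun s => by rw [map_add, map_add, hp, hq, add_pow_four]⟩
  | monomial n c =>
    obtain ⟨e, rfl⟩ := hk c
    obtain ⟨e, rfl⟩ := hk e
    refine ⟨monomial n e, fun s => ?_⟩
    rw [aeval_monomial, aeval_monomial, map_pow, map_pow]
    ring

lemma D_cube [CharP K 2] (F : K) : d (F ^ 3) = F ^ 2 • d F := by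
  rw [pow_succ, D_sq_mul]

lemma isSeparable_cube [CharP K 2] {F : K} (hF : IsSeparableMorphism k F) :
    IsSeparableMorphism k (F ^ 3) := by
  rw [IsSeparableMorphism, D_cube]
  refine smul_ne_zero (pow_ne_zero 2 ?_) hF
  rintro rfl
  exact hF (map_zero _)

/-- This is why third powers are used: F³ has the same symbols as F while its differential is
divisible by F². -/
lemma symbol_cube [CharP K 2] {F : K} (hF : IsSeparableMorphism k F) : symbol k (F ^ 3) F = 0 := by
  rw [symbol_eq (f₀ := 0) (f₁ := 0) (f₂ := 0) (f₃ := 1) hF (by ring)]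
  simp

variable [CharP K 2] [PerfectField k]

/-- The sum of the third power of an étale function and a fourth power is tame. -/
theorem isTameAt_cube_add (hK : IsCurveField k K) {A : Subalgebra k K} {t : K}
    (ht : IsUniformizer A t) {F s : A} (hF : GeneratesB A F) :
    IsTameAt A ((F : K) ^ 3 + (s : K) ^ 4) := by
  have hv := ht.mem_or_inv_mem
  have : IsLocalRing A := isLocalRing_of_mem_or_inv_mem hv
  have hFs := hF.isSeparable hK hv
  let f : A := F ^ 3 + s ^ 4
  have hDf : d (f : K) = (F : K) ^ 2 • d (F : K) := by
    change d ((F : K) ^ 3 + (s : K) ^ 4) = _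
    rw [show (s : K) ^ 4 = ((s : K) ^ 2) ^ 2 by ring, D_add_sq, D_cube]
  have hfs : IsSeparableMorphism k (f : K) := by
    rw [IsSeparableMorphism, hDf, ← D_cube]
    exact isSeparable_cube hFs
  obtain ⟨P, hP, hPf⟩ := exists_irreducible_not_isUnit hK hv ht.ne_top hfs
  have hP' := isUnit_aeval_derivative hP hPf
  suffices H : ∃ e : ℕ, ¬ 2 ∣ e ∧ (aeval f P : K) ≠ 0 ∧ ord A (aeval f P : K) = e by
    obtain ⟨e, he, h0, ho⟩ := H
    refine ⟨e, ⟨_, .inr ⟨f.2, P, hP, hPf, rfl⟩, ?_⟩, he⟩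
    rw [ht.hasOrder_iff_ord]
    rw [aeval_subalgebra_coe] at h0 ho
    exact ⟨h0, ho⟩
  -- If F is a unit, the differential of P(f) is the unit P'(f)F² times dF, and the index is 1.
  by_cases hu : IsUnit F
  · refine ⟨1, by norm_num, ht.ord_eq_one_of_D hK hF (c := aeval f (derivative P) * F ^ 2)
      (hP'.mul (hu.pow 2)) hPf ?_⟩
    rw [aeval_subalgebra_coe, Derivation.map_aeval, hDf, smul_smul]
    simp
  · obtain ⟨hF0, hF1⟩ := ht.ord_eq_one_of_D hK hF (c := 1) isUnit_one hu (by simp)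
    obtain ⟨Q, hQ⟩ := exists_aeval_pow_four (K := K) hK.sqrt P
    have hQ' : aeval (s ^ 4) P = aeval s Q ^ 4 := Subtype.ext (by
      rw [SubmonoidClass.coe_pow, aeval_subalgebra_coe, aeval_subalgebra_coe,
        SubmonoidClass.coe_pow, hQ])
    -- Now F is a uniformizer. Taylor expansion at s⁴ gives P(f) = Q(s)⁴ + P'(s⁴)F³ + κF⁶ with
    -- P'(s⁴) a unit and Q(s) a nonunit, so the index is 3.
    obtain ⟨κ, hκ⟩ := (P.map (algebraMap k A)).binomExpansion (s ^ 4) (F ^ 3)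
    obtain ⟨ρ, hρ⟩ := ((derivative P).map (algebraMap k A)).binomExpansion (s ^ 4) (F ^ 3)
    rw [derivative_map] at hκ
    simp only [eval_map_algebraMap, derivative_map] at hκ hρ
    rw [add_comm, hQ'] at hκ
    rw [add_comm] at hρ
    have hnu : ∀ {a : A}, ¬ IsUnit a ↔ a ∈ IsLocalRing.maximalIdeal A := Iff.rfl
    rw [hnu] at hu hPf
    have hunit : IsUnit (aeval (s ^ 4) (derivative P)) := by
      by_contra h
      rw [hnu] at h
      refine hnu.2 ?_ hP'
      rw [show f = F ^ 3 + s ^ 4 from rfl, hρ]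
      refine add_mem (add_mem h ?_) ?_
      · exact Ideal.mul_mem_left _ _ (Ideal.pow_mem_of_mem _ hu 3 (by norm_num))
      · exact Ideal.mul_mem_left _ _
          (Ideal.pow_mem_of_mem _ (Ideal.pow_mem_of_mem _ hu 3 (by norm_num)) 2 (by norm_num))
    have hQm : aeval s Q ∈ IsLocalRing.maximalIdeal A := by
      refine (inferInstance : (IsLocalRing.maximalIdeal A).IsPrime).mem_of_pow_mem 4 ?_
      have : aeval s Q ^ 4 = aeval f P - (aeval (s ^ 4) (derivative P) * F ^ 3 + κ * (F ^ 3) ^ 2) := by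
        rw [show f = F ^ 3 + s ^ 4 from rfl, hκ]; ring
      rw [this]
      refine sub_mem hPf (add_mem ?_ ?_)
      · exact Ideal.mul_mem_left _ _ (Ideal.pow_mem_of_mem _ hu 3 (by norm_num))
      · exact Ideal.mul_mem_left _ _
          (Ideal.pow_mem_of_mem _ (Ideal.pow_mem_of_mem _ hu 3 (by norm_num)) 2 (by norm_num))
    obtain ⟨hu0, hu1⟩ := ht.isUnit_iff_ord.1 hunit
    have hF3 := pow_ne_zero 3 hF0
    have ho : ord A ((aeval (s ^ 4) (derivative P) : A) * (F : K) ^ 3) = 3 := by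
      rw [ht.ord_mul hu0 hF3, ht.ord_pow hF0, hu1, hF1]; norm_num
    have hrest : ((aeval s Q : A) : K) ^ 4 + κ * ((F : K) ^ 3) ^ 2 = 0 ∨
        4 ≤ ord A (((aeval s Q : A) : K) ^ 4 + κ * ((F : K) ^ 3) ^ 2) := by
      apply ht.le_ord_add
      · rcases ht.one_le_ord (hnu.2 hQm) with h | h
        · left; rw [h]; simp
        by_cases h0 : ((aeval s Q : A) : K) = 0
        · left; rw [h0]; simp
        right
        rw [ht.ord_pow h0]
        simp only [Nat.cast_ofNat]
        omega
      · by_cases h0 : (κ : K) = 0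
        · left; rw [h0]; simp
        right
        rw [ht.ord_mul h0 (pow_ne_zero 2 hF3), ht.ord_pow hF3, ht.ord_pow hF0, hF1]
        have := (ht.mem_iff.1 κ.2).resolve_left h0
        push_cast
        omega
    have hsum := ht.ord_add_of_lt (mul_ne_zero hu0 hF3) (hrest.imp_right fun h => by rw [ho]; omega)
    refine ⟨3, by norm_num, ?_⟩
    have e : ((aeval f P : A) : K) = (aeval (s ^ 4) (derivative P) : A) * (F : K) ^ 3 +
        (((aeval s Q : A) : K) ^ 4 + κ * ((F : K) ^ 3) ^ 2) := by
      have := congrArg (Subtype.val : A → K) hκ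
      simp only [AddMemClass.coe_add, MulMemClass.coe_mul, SubmonoidClass.coe_pow] at this
      rw [show f = F ^ 3 + s ^ 4 from rfl, this]; ring
    rw [e]
    exact ⟨hsum.1, hsum.2.trans ho⟩

variable [CharP k 2]

/-- For a pseudotame `f`, the odd order of the third power of `f + v⁴` up to fourth powers. -/
theorem exists_ord_cube_add (hK : IsCurveField k K) {A : Subalgebra k K} {g : K}
    (hg : IsUniformizer A g) {f : K} (hf : IsSeparableMorphism k f) (hpt : IsPseudotameAt A f) :
    ∃ c : ℤ, Odd c ∧ ∀ v F₀ F₁ F₂ F₃ : K,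
      (f + v ^ 4) ^ 3 = F₀ ^ 4 + F₁ ^ 4 * g + F₂ ^ 4 * g ^ 2 + F₃ ^ 4 * g ^ 3 →
      (f + v ^ 4) ^ 3 + F₀ ^ 4 ≠ 0 ∧
        ord A ((f + v ^ 4) ^ 3 + F₀ ^ 4) = 2 * ord A (f + v ^ 4) + c := by
  have hgs := hg.isSeparable hK
  have hgB := hg.generatesB hK
  obtain ⟨β, hβ⟩ := hK.exists_D_eq_smul hgs f
  have hβ0 : β ≠ 0 := by
    rintro rfl
    exact hf (by rw [hβ]; simp)
  -- Here df = β²dg. An odd order exceeds by one the order of the differential, and d(F³) = F²df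
  -- because adding v⁴ does not change df; this yields 2 ord F + 2 ord β + 1.
  refine ⟨2 * ord A β + 1, ⟨_, rfl⟩, fun v F₀ F₁ F₂ F₃ e => ?_⟩
  have haff : FourthPowerAffine f (f + v ^ 4) := ⟨1, v, one_ne_zero, by ring⟩
  set F := f + v ^ 4 with hFdef
  have hFs := haff.isSeparable hf
  have hF0 : F ≠ 0 := by
    intro h
    exact hFs (by rw [h, map_zero])
  obtain ⟨h, hh, hsym⟩ := (isPseudotameAt_iff hK hg hf hgB).1 hpt
  obtain ⟨b, hb⟩ := hgB ⟨h, hh⟩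
  change d h = (b : K) ^ 2 • d g at hb
  have hsym3 : symbol k (F ^ 3) g = (b : K) ^ 2 • d g := by
    rw [← hK.symbol_add (isSeparable_cube hFs) hFs hgs, symbol_cube hFs, zero_add,
      symbol_affine hK haff hgs, ← hb]
    exact hsym
  obtain ⟨w, n, hn, ho⟩ := (hg.exists_odd_order_iff hK hgs (isSeparable_cube hFs)).2 ⟨b, b.2, hsym3⟩
  obtain ⟨h0, ho⟩ := hg.ord_eq_of_odd hg.ne_zero (by rw [hg.ord_self]; exact odd_one) e hn ho
  refine ⟨h0, ?_⟩
  obtain ⟨l, rfl⟩ := hn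
  have hgl := zpow_ne_zero l hg.ne_zero
  -- Dividing by an even power of `g` gives a uniformizer, whose differential is a unit multiple of
  -- dg; the power is a square and passes through d.
  let z := (F ^ 3 + F₀ ^ 4) * (g ^ l)⁻¹ ^ 2
  have hz0 : z ≠ 0 := mul_ne_zero h0 (pow_ne_zero 2 (inv_ne_zero hgl))
  have hz : IsUniformizer A z := by
    refine hg.of_ord_eq_one hz0 ?_
    rw [hg.ord_mul h0 (pow_ne_zero 2 (inv_ne_zero hgl)), ho, hg.ord_pow (inv_ne_zero hgl),
      hg.ord_inv hgl, hg.ord_zpow hg.ne_zero, hg.ord_self]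
    push_cast
    ring
  obtain ⟨c, hc, hc', hc0, ec⟩ := (hz.generatesB hK).exists_unit hK hg.mem_or_inv_mem hgB
  change d z = c ^ 2 • d g at ec
  have h1 : d (F ^ 3 + F₀ ^ 4) = (g ^ l * c) ^ 2 • d g := by
    rw [mul_pow, mul_smul, ← ec, ← D_sq_mul]
    congr 1
    simp only [z]
    field_simp
  have h2 : d (F ^ 3 + F₀ ^ 4) = (F * β) ^ 2 • d g := by
    rw [show F₀ ^ 4 = (F₀ ^ 2) ^ 2 by ring, D_add_sq, D_cube, mul_pow, mul_smul, ← hβ, hFdef,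
      show v ^ 4 = (v ^ 2) ^ 2 by ring, D_add_sq]
  have h3 : F * β = g ^ l * c := sq_smul_D_injective hgs (h2.symm.trans h1)
  have h4 := congrArg (ord A) h3
  have hcu : ord A c = 0 := hg.ord_eq hc hc' hc0 (by simp)
  rw [hg.ord_mul hF0 hβ0, hg.ord_mul hgl hc0, hg.ord_zpow hg.ne_zero, hg.ord_self, hcu] at h4
  rw [ho]
  omega

end Tame

/-! ### From pseudotame to tame morphisms. -/

section

variable {k : Type u} [Field k] {X : Scheme.{u}} [IsIntegral X]
  (π : X ⟶ Spec (CommRingCat.of k)) [SmoothOfRelativeDimension 1 π] [PerfectField k] [CharP k 2]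

omit [CharP k 2] in
lemma exists_isUniformizer_of_isClosed {x : X} (hx : IsClosed ({x} : Set X)) :
    ∃ t, IsUniformizer (localRing π x) t :=
  exists_isUniformizer_localRing π (localRing_ne_top π hx)

omit [CharP k 2] in
lemma exists_ord_eq_one_of_isClosed {S : Set X} (hS : S.Finite)
    (hS' : ∀ x ∈ S, IsClosed ({x} : Set X)) :
    ∃ g : FunctionField π, ∀ x ∈ S, g ≠ 0 ∧ ord (localRing π x) g = 1 := by
  obtain ⟨g, hg⟩ := exists_ord_eq_one (hS.image (localRing π)) (by
    rintro _ ⟨x, hx, rfl⟩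
    exact exists_isUniformizer_of_isClosed π (hS' x hx))
  exact ⟨g, fun x hx => hg _ ⟨x, hx, rfl⟩⟩

/-- There is a function `u` with at least one pole such that `f` is étale outside the poles
of `u`. -/
lemma exists_poles [CompactSpace X] {f : FunctionField π} (hf : IsSeparableMorphism k f) :
    ∃ u : FunctionField π, (∃ x : X, IsClosed ({x} : Set X) ∧ ord (localRing π x) u = -1 ∧ u ≠ 0) ∧
      {x : X | IsClosed ({x} : Set X) ∧ u ∉ localRing π x}.Finite ∧
      ∀ x : X, u ∈ localRing π x → ∃ h : f ∈ localRing π x, GeneratesB (localRing π x) ⟨f, h⟩ := by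
  have hK := isCurveField_functionField π
  have htop := localRing_genericPoint π
  have hmem : ∀ z, z ∈ localRing π (genericPoint X) := fun z => htop.ge Algebra.mem_top
  obtain ⟨V, hηV, hV⟩ := exists_generatesB_nhds π (g := ⟨f, hmem f⟩) (generatesB_top hK htop hf)
  have : Nonempty X := inferInstance
  -- An extra closed point guarantees a pole of `u` even if `f` is étale everywhere; the simple pole
  -- will show du ≠ 0.
  obtain ⟨x₀, -, hx₀⟩ := IsClosed.exists_closed_singleton (X := X) isClosed_univ Set.univ_nonempty
  have hVc : ∀ x, x ∉ V → IsClosed ({x} : Set X) := fun x hx =>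
    isClosed_singleton_of_ne π (by rintro rfl; exact hx hηV)
  have hS : ∀ x ∈ insert x₀ (V : Set X)ᶜ, IsClosed ({x} : Set X) := by
    rintro x (rfl | hx)
    exacts [hx₀, hVc x hx]
  obtain ⟨p, hp⟩ := exists_ord_eq_one_of_isClosed π ((finite_compl π ⟨_, hηV⟩).insert x₀) hS
  -- The function sought is the inverse of a common uniformizer at all bad points.
  have hord : ∀ x ∈ insert x₀ (V : Set X)ᶜ, ord (localRing π x) p⁻¹ = -1 ∧ p⁻¹ ≠ 0 := by
    intro x hx
    obtain ⟨t, ht⟩ := exists_isUniformizer_of_isClosed π (hS x hx)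
    obtain ⟨h0, h1⟩ := hp x hx
    rw [ht.ord_inv h0, h1]
    exact ⟨rfl, inv_ne_zero h0⟩
  obtain ⟨W, hηW, hW⟩ := exists_mem_localRing_nhds π (hmem p⁻¹)
  refine ⟨p⁻¹, ⟨x₀, hx₀, hord x₀ (.inl rfl)⟩, (finite_compl π ⟨_, hηW⟩).subset ?_, fun x hx => ?_⟩
  · exact fun x hx hxW => hx.2 (hW x hxW)
  · by_cases hxV : x ∈ V
    · exact hV x hxV
    · obtain ⟨t, ht⟩ := exists_isUniformizer_of_isClosed π (hVc x hxV)
      obtain ⟨h1, h0⟩ := hord x (.inr hxV)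
      have := (ht.mem_iff.1 hx).resolve_left h0
      omega

/-- A curve with a pseudotame morphism to the projective line has a tame one. -/
theorem exists_isTame [CompactSpace X] {f : FunctionField π} (hf : IsPseudotameOn π ⊤ f) :
    ∃ f' : FunctionField π, IsTame π f' := by
  have hK := isCurveField_functionField π
  have hfs := hf.1
  have hf0 : f ≠ 0 := by
    rintro rfl
    exact hfs (map_zero _)
  obtain ⟨u, ⟨x₀, hx₀, hux₀, hu0⟩, hfin, hgen⟩ := exists_poles π hfs
  set Z := {x : X | IsClosed ({x} : Set X) ∧ u ∉ localRing π x}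
  have hneg : ∀ x ∈ Z, ord (localRing π x) u < 0 := by
    rintro x ⟨hx, hxu⟩
    obtain ⟨t, ht⟩ := exists_isUniformizer_of_isClosed π hx
    by_contra! h
    exact hxu (ht.mem_iff.2 (.inr h))
  have hx₀Z : x₀ ∈ Z := by
    refine ⟨hx₀, fun h => ?_⟩
    obtain ⟨t, ht⟩ := exists_isUniformizer_of_isClosed π hx₀
    have := (ht.mem_iff.1 h).resolve_left hu0
    omega
  obtain ⟨t₀, ht₀⟩ := exists_isUniformizer_of_isClosed π hx₀
  have hus : IsSeparableMorphism k u := hK.isSeparable_of_odd ht₀ hu0 (by rw [hux₀]; decide)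
  obtain ⟨g, hg⟩ := exists_ord_eq_one_of_isClosed π hfin fun x hx => hx.1
  have hgu : ∀ x ∈ Z, IsUniformizer (localRing π x) g := by
    intro x hx
    obtain ⟨t, ht⟩ := exists_isUniformizer_of_isClosed π hx.1
    exact ht.of_ord_eq_one (hg x hx).1 (hg x hx).2
  have hgs := (hgu x₀ hx₀Z).isSeparable hK
  obtain ⟨M, hM⟩ := exists_integral_add_bounded hK hus (hfin.image (localRing π)) (by
    rintro _ ⟨x, hx, rfl⟩
    exact ⟨g, hgu x hx⟩) (by
    rintro _ ⟨x, hx, rfl⟩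
    exact hx.2)
  have hc := fun x hx => exists_ord_cube_add hK (hgu x hx) hfs (hf.2 x trivial hx.1)
  choose! c hcodd hc using hc
  obtain ⟨N, hN⟩ : ∃ N : ℕ, ∀ x ∈ Z, |c x| ≤ N ∧ |ord (localRing π x) f| ≤ N := by
    obtain ⟨N, hN⟩ := (hfin.image fun x => (|c x| + |ord (localRing π x) f|).toNat).bddAbove
    refine ⟨N, fun x hx => ?_⟩
    have := hN ⟨x, hx, rfl⟩
    simp only at this
    have h1 := abs_nonneg (c x)
    have h2 := abs_nonneg (ord (localRing π x) f)
    omega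
  -- `M` bounds the poles of the error r relative to `u`, and `N` bounds |c| and |ord f|. With this
  -- `m`, u^(4m) dominates f, and 8m ord u + c lies below both 0 and 4M ord u, the latter being a
  -- lower bound for the order of r⁴.
  let m : ℕ := M + N + 1
  let F := f + (u ^ m) ^ 4
  have haff : FourthPowerAffine f F := ⟨1, u ^ m, one_ne_zero, by simp [F]⟩
  have hFs := haff.isSeparable hfs
  obtain ⟨F₀, F₁, F₂, F₃, e⟩ := hK.exists_coords hgs (F ^ 3)
  obtain ⟨s, r, hsr, hs, hr⟩ := hM F₀
  -- Replacing F₀ by its part `s`, regular wherever `u` is, costs only r⁴.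
  have e' : F ^ 3 + s ^ 4 = F ^ 3 + F₀ ^ 4 + r ^ 4 := by
    rw [hsr, add_pow_four]
    linear_combination -r ^ 4 * two_eq_zero' (K := FunctionField π)
  refine ⟨F ^ 3 + s ^ 4, ?_, fun x hx => ?_⟩
  · rw [IsSeparableMorphism, show s ^ 4 = (s ^ 2) ^ 2 by ring, D_add_sq]
    exact isSeparable_cube hFs
  · by_cases hxu : u ∈ localRing π x
    · obtain ⟨t, ht⟩ := exists_isUniformizer_of_isClosed π hx
      obtain ⟨hfx, hfB⟩ := hgen x hxu
      have hFx : F ∈ localRing π x := add_mem hfx (pow_mem (pow_mem hxu m) 4)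
      have hsx := hs _ (mem_or_inv_mem_localRing π x) hxu
      -- F and f differ by a fourth power, so dF = df and F generates B wherever `f` does.
      refine isTameAt_cube_add hK ht (F := ⟨F, hFx⟩) (s := ⟨s, hsx⟩) fun h => ?_
      obtain ⟨a, ha⟩ := hfB h
      refine ⟨a, ha.trans ?_⟩
      congr 1
      change KaehlerDifferential.D k _ f = KaehlerDifferential.D k _ (f + (u ^ m) ^ 4)
      rw [show (u ^ m) ^ 4 = ((u ^ m) ^ 2) ^ 2 by ring, D_add_sq]
    · have hxZ : x ∈ Z := ⟨hx, hxu⟩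
      have ht := hgu x hxZ
      have hneg := hneg x hxZ
      obtain ⟨hN1, hN2⟩ := hN x hxZ
      rw [abs_le] at hN1 hN2
      have hum : (u ^ m) ^ 4 ≠ 0 := pow_ne_zero 4 (pow_ne_zero m hu0)
      have ho : ord (localRing π x) ((u ^ m) ^ 4) = 4 * (m * ord (localRing π x) u) := by
        rw [ht.ord_pow (pow_ne_zero m hu0), ht.ord_pow hu0]
        norm_num
      set a := ord (localRing π x) u
      have h1 : (m : ℤ) * a ≤ M * a - N - 1 := by
        have hm : (m : ℤ) = M + N + 1 := by simp [m]
        rw [hm]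
        nlinarith
      have h2 : (M : ℤ) * a ≤ 0 := by nlinarith
      have hFo : ord (localRing π x) F = 4 * (m * a) := by
        rw [← ho, ← (ht.ord_add_of_lt hum (w := f) (.inr (by omega))).2, add_comm]
      obtain ⟨hw0, hw⟩ := hc x hxZ (u ^ m) F₀ F₁ F₂ F₃ e
      change ord (localRing π x) (F ^ 3 + F₀ ^ 4) = 2 * ord (localRing π x) F + c x at hw
      have hr4 : r ^ 4 = 0 ∨ ord (localRing π x) (F ^ 3 + F₀ ^ 4) < ord (localRing π x) (r ^ 4) := by
        by_cases h0 : r = 0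
        · left; rw [h0]; simp
        right
        have h3 := (ht.mem_iff.1 (hr _ ⟨x, hxZ, rfl⟩)).resolve_left
          (mul_ne_zero h0 (pow_ne_zero _ (inv_ne_zero hu0)))
        rw [ht.ord_mul h0 (pow_ne_zero _ (inv_ne_zero hu0)), ht.ord_pow (inv_ne_zero hu0),
          ht.ord_inv hu0] at h3
        rw [ht.ord_pow h0, hw, hFo]
        push_cast
        have h4 : (M : ℤ) * -a = -(M * a) := by ring
        change 0 ≤ _ + (M : ℤ) * -a at h3
        omega
      obtain ⟨hne, hord⟩ := ht.ord_add_of_lt hw0 hr4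
      rw [e']
      -- The order is even plus the odd number `c`, and negative because the pole of F dominates.
      refine ht.isTameAt_of_pole ?_ ?_
      · rw [hord, hw]
        exact (even_two_mul _).add_odd (hcodd x hxZ)
      · rw [hord, hw, hFo]
        omega

omit [SmoothOfRelativeDimension 1 π] [PerfectField k] [CharP k 2] in
lemma IsTame.isPseudotameOn {f : FunctionField π} (hf : IsTame π f) : IsPseudotameOn π ⊤ f := by
  refine ⟨hf.1, fun x _ hx => ?_⟩
  obtain ⟨e, ⟨τ, hτ, ho⟩, he⟩ := hf.2 x hx
  refine ⟨τ, hτ, 0, e, ?_, by simpa using ho⟩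
  rw [Int.odd_iff]
  omega

end

end SY

theorem lemma6 {k : Type u} [Field k] [CharP k 2] [PerfectField k]
    {X : Scheme.{u}} [IsIntegral X] (π : X ⟶ Spec (CommRingCat.of k))
    [IsProper π] [SmoothOfRelativeDimension 1 π] [GeometricallyIrreducible π]
    {n : ℕ} (U : Fin n → X.Opens) (hU : ∀ i, IsAffineOpen (U i)) (hcover : ⨆ i, U i = ⊤)
    (f : Fin n → SY.FunctionField π) (hf : ∀ i, SY.IsPseudotameOn π (U i) (f i)) :
    (∃ Φ : Quotient (SY.Pseudotame.setoid π) ≃ Σ a : SY.Torsor π U f, a.BundleSection,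
      ∀ h : SY.Pseudotame π,
        (∀ i, (Φ (Quotient.mk _ h)).1.cochain i = SY.symbol k h.1 (f i)) ∧
        ∀ (x : X) (e : SY.localRing π x),
          SY.frobMk k e ∈ (Φ (Quotient.mk _ h)).2.stalk x ↔
            ∃ c d : SY.FunctionField π, (e : SY.FunctionField π) = c ^ 4 * h.1 + d ^ 4) ∧
    ((∃ g : SY.FunctionField π, SY.IsTame π g) ↔
      ∃ a : SY.Torsor π U f, a.IsTrivialBundle) := by
  have : CompactSpace X := QuasiCompact.compactSpace_of_compactSpace π
  refine ⟨⟨SY.bundleSectionEquiv hf hcover, fun h => ⟨fun i => rfl, fun x e => ?_⟩⟩, ?_, ?_⟩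
  · exact SY.frobMk_mem_lineStalk (SY.isCurveField_functionField π)
  · rintro ⟨g, hg⟩
    exact ⟨_, ⟨(SY.bundleSectionEquiv hf hcover (Quotient.mk _ ⟨g, hg.isPseudotameOn⟩)).2⟩⟩
  · rintro ⟨a, ⟨s⟩⟩
    obtain ⟨h, -⟩ := Quotient.exists_rep ((SY.bundleSectionEquiv hf hcover).symm ⟨a, s⟩)
    exact SY.exists_isTame π h.2
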